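/- A line segment in $\mathbb{R}^2$ is given by two distinct endpoints; $|s|$ denotes its length. For a set $S$ of $n$ segments and a closed ball $B$ of radius $r>0$, let $c_S(B)$ be the number of segments $s\in S$ with $|s|\ge r$ and $s\cap B\ne\emptyset$. $S$ is $\lambda$-low-density if $c_S(B)\le\lambda$ for every ball $B$; the density value $\lambda(S)$ is the least $\lambda\ge 0$ for which this holds. The model of computation is the unit-cost RAM over exact real numbers: registers and arrays hold natural numbers or real numbers, cells of arrays are addressed by natural numbers, and each of the following takes one step: loading, storing, copying and loading rational constants, the four arithmetic operations (on naturals: truncated subtraction and integer division), conversion of a natural number to a real, comparison, square root, floor, shifting a real $x$ by $k$ bits ($x\mapsto 2^{\pm k}x$, $k\in\mathbb{N}$), and $\mathrm{bit}_\triangle(\alpha,\beta)$, the index of the first bit after the binary point in which the reals $\alpha$ and $\beta$ differ ($0$ if there is none). The input consists of $n$ and the coordinates of the endpoints of the segments. Theorem. There are a single program $P$ for this machine and a constant $C$ such that for every $n\ge 1$ and every set $S$ of $n$ segments in $\mathbb{R}^2$ (repetitions, counted with multiplicity, are allowed), $P$ halts on input $S$ after at most $C\,(n\log n+\lambda(S)\,n)$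 steps and outputs an integer $v$ that is a $3$-approximation of the density value of $S$: $$\tfrac13\,\lambda(S)\le v\le\lambda(S).$$ -/

import Mathlib

/-! ## Segments and low density -/

/-- A (nondegenerate) line segment in the Euclidean plane, given by its two endpoints. -/
structure PlaneSegment where
  p : EuclideanSpace ℝ (Fin 2)
  q : EuclideanSpace ℝ (Fin 2)
  p_ne_q : p ≠ q

namespace PlaneSegment

/-- The points of the segment. -/
def carrier (s : PlaneSegment) : Set (EuclideanSpace ℝ (Fin 2)) := segment ℝ s.p s.q

/-- The length of the segment. -/
noncomputable def length (s : PlaneSegment) : ℝ := dist s.p s.q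

/-- The segment counts for the closed ball with centre `c` and radius `r`: it is at least as long
as the radius and it meets the ball. -/
def Intersects (s : PlaneSegment) (c : EuclideanSpace ℝ (Fin 2)) (r : ℝ) : Prop :=
  r ≤ s.length ∧ (s.carrier ∩ Metric.closedBall c r).Nonempty

end PlaneSegment

/-- The number of members of the family `S` that intersect the closed ball `B(c, r)` and have
length at least `r`. -/
noncomputable def ballCount {n : ℕ} (S : Fin n → PlaneSegment)
    (c : EuclideanSpace ℝ (Fin 2)) (r : ℝ) : ℕ :=
  Set.ncard {i : Fin n | (S i).Intersects c r}

/-- `S` is `lam`-low-density. -/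
def IsLowDensity {n : ℕ} (S : Fin n → PlaneSegment) (lam : ℝ) : Prop :=
  ∀ (c : EuclideanSpace ℝ (Fin 2)) (r : ℝ), 0 < r → (ballCount S c r : ℝ) ≤ lam

/-- The low-density value of `S`: the least `lam ≥ 0` such that `S` is `lam`-low-density. -/
noncomputable def densityValue {n : ℕ} (S : Fin n → PlaneSegment) : ℝ :=
  sInf {lam : ℝ | 0 ≤ lam ∧ IsLowDensity S lam}

/-- The infimum in the definition of the low-density value is attained. -/
theorem densityValue_isLeast {n : ℕ} (S : Fin n → PlaneSegment) :
    IsLeast {lam : ℝ | 0 ≤ lam ∧ IsLowDensity S lam} (densityValue S) := by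
  have hne : {lam : ℝ | 0 ≤ lam ∧ IsLowDensity S lam}.Nonempty := by
    refine ⟨n, Nat.cast_nonneg n, fun c r _ => ?_⟩
    have h := Set.ncard_le_ncard (Set.subset_univ {i : Fin n | (S i).Intersects c r})
    rw [Set.ncard_univ, Nat.card_eq_fintype_card, Fintype.card_fin] at h
    exact_mod_cast h
  refine ⟨⟨le_csInf hne fun _ h => h.1, fun c r hr => le_csInf hne fun _ h => h.2 c r hr⟩, ?_⟩
  exact fun lam h => csInf_le ⟨0, fun _ h' => h'.1⟩ h

/-! ## The unit-cost RAM

A random access machine over exact real numbers (and natural numbers, used for counting, for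
addresses and for bit positions). Besides the arithmetic operations, comparisons, the square root
and the floor function, it offers the bit operation `bitDiff` and shifts by a given number of bits.
Programs are in structured form; every instruction and every evaluation of a test costs one step.
-/

namespace UnitRAM

/-- The `i`-th bit of `x` after the binary point. -/
noncomputable def bit (x : ℝ) (i : ℕ) : ℤ := ⌊x * 2 ^ i⌋ % 2

/-- The index of the first bit after the binary point in which `x` and `y` differ
(and `0` if there is none). -/
noncomputable def bitDiff (x y : ℝ) : ℕ := sInf {i : ℕ | 1 ≤ i ∧ bit x i ≠ bit y i}

/-- Memory: registers and arrays, each holding natural numbers or real numbers.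
A program names registers and arrays by numerals (so it uses only finitely many of them);
the cells of an array are addressed by the contents of a register. -/
structure State where
  nreg : ℕ → ℕ
  rreg : ℕ → ℝ
  narr : ℕ → ℕ → ℕ
  rarr : ℕ → ℕ → ℝ

/-- Binary operations on natural numbers (truncated subtraction, integer division). -/
inductive NOp where
  | add | sub | mul | div

/-- Binary operations on real numbers. -/
inductive ROp where
  | add | sub | mul | div

def NOp.eval : NOp → ℕ → ℕ → ℕ
  | .add, x, y => x + y
  | .sub, x, y => x - y
  | .mul, x, y => x * y
  | .div, x, y => x / y

noncomputable def ROp.eval : ROp → ℝ → ℝ → ℝ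
  | .add, x, y => x + y
  | .sub, x, y => x - y
  | .mul, x, y => x * y
  | .div, x, y => x / y

/-- Instructions. The first argument is the destination register, except in the two store
instructions, where `nstore a y x` and `rstore a y x` write register `x` to the cell of array `a`
whose address is in register `y`. -/
inductive Instr where
  | nconst (x k : ℕ)
  | nmove (x y : ℕ)
  | nop (o : NOp) (x y z : ℕ)
  | nload (x a y : ℕ)
  | nstore (a y x : ℕ)
  | rconst (x : ℕ) (k : ℚ)
  | rmove (x y : ℕ)
  | rop (o : ROp) (x y z : ℕ)
  | rload (x a y : ℕ)
  | rstore (a y x : ℕ)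
  | rofnat (x y : ℕ)
  | rsqrt (x y : ℕ)
  | rfloor (x y : ℕ)
  | rshl (x y z : ℕ)
  | rshr (x y z : ℕ)
  | bitdiff (x y z : ℕ)

namespace State

def setN (σ : State) (x v : ℕ) : State :=
  { σ with nreg := Function.update σ.nreg x v }

noncomputable def setR (σ : State) (x : ℕ) (v : ℝ) : State :=
  { σ with rreg := Function.update σ.rreg x v }

def setNArr (σ : State) (a i v : ℕ) : State :=
  { σ with narr := Function.update σ.narr a (Function.update (σ.narr a) i v) }

noncomputable def setRArr (σ : State) (a i : ℕ) (v : ℝ) : State :=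
  { σ with rarr := Function.update σ.rarr a (Function.update (σ.rarr a) i v) }

end State

/-- The effect of an instruction. -/
noncomputable def Instr.apply : Instr → State → State
  | .nconst x k, σ => σ.setN x k
  | .nmove x y, σ => σ.setN x (σ.nreg y)
  | .nop o x y z, σ => σ.setN x (o.eval (σ.nreg y) (σ.nreg z))
  | .nload x a y, σ => σ.setN x (σ.narr a (σ.nreg y))
  | .nstore a y x, σ => σ.setNArr a (σ.nreg y) (σ.nreg x)
  | .rconst x k, σ => σ.setR x (k : ℝ)
  | .rmove x y, σ => σ.setR x (σ.rreg y)
  | .rop o x y z, σ => σ.setR x (o.eval (σ.rreg y) (σ.rreg z))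
  | .rload x a y, σ => σ.setR x (σ.rarr a (σ.nreg y))
  | .rstore a y x, σ => σ.setRArr a (σ.nreg y) (σ.rreg x)
  | .rofnat x y, σ => σ.setR x (σ.nreg y : ℝ)
  | .rsqrt x y, σ => σ.setR x (Real.sqrt (σ.rreg y))
  | .rfloor x y, σ => σ.setR x (⌊σ.rreg y⌋ : ℝ)
  | .rshl x y z, σ => σ.setR x (σ.rreg y * 2 ^ σ.nreg z)
  | .rshr x y z, σ => σ.setR x (σ.rreg y / 2 ^ σ.nreg z)
  | .bitdiff x y z, σ => σ.setN x (bitDiff (σ.rreg y) (σ.rreg z))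

/-- Tests: comparisons between two registers. -/
inductive Test where
  | neq (x y : ℕ)
  | nlt (x y : ℕ)
  | nle (x y : ℕ)
  | req (x y : ℕ)
  | rlt (x y : ℕ)
  | rle (x y : ℕ)

/-- The test `neq` compares natural numbers for equality, `req` real numbers. -/
def Test.Holds : Test → State → Prop
  | .neq x y, σ => σ.nreg x = σ.nreg y
  | .nlt x y, σ => σ.nreg x < σ.nreg y
  | .nle x y, σ => σ.nreg x ≤ σ.nreg y
  | .req x y, σ => σ.rreg x = σ.rreg y
  | .rlt x y, σ => σ.rreg x < σ.rreg y
  | .rle x y, σ => σ.rreg x ≤ σ.rreg y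

/-- Programs: instructions, sequencing, branching, and loops (`loop b P` repeats `P` as long as
the test `b` holds). -/
inductive Program where
  | skip
  | instr (i : Instr)
  | seq (P Q : Program)
  | branch (b : Test) (P Q : Program)
  | loop (b : Test) (P : Program)

/-- `Exec P σ t τ`: started in `σ`, the program `P` halts in `τ` after exactly `t` steps. -/
inductive Exec : Program → State → ℕ → State → Prop where
  | skip (σ : State) : Exec .skip σ 1 σ
  | instr (i : Instr) (σ : State) : Exec (.instr i) σ 1 (i.apply σ)
  | seq {P Q : Program} {σ τ υ : State} {t u : ℕ} :
      Exec P σ t τ → Exec Q τ u υ → Exec (.seq P Q) σ (t + u) υ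
  | branchTrue {b : Test} {P Q : Program} {σ τ : State} {t : ℕ} :
      b.Holds σ → Exec P σ t τ → Exec (.branch b P Q) σ (t + 1) τ
  | branchFalse {b : Test} {P Q : Program} {σ τ : State} {t : ℕ} :
      ¬ b.Holds σ → Exec Q σ t τ → Exec (.branch b P Q) σ (t + 1) τ
  | loopDone {b : Test} {P : Program} {σ : State} :
      ¬ b.Holds σ → Exec (.loop b P) σ 1 σ
  | loopStep {b : Test} {P : Program} {σ τ υ : State} {t u : ℕ} :
      b.Holds σ → Exec P σ t τ → Exec (.loop b P) τ u υ → Exec (.loop b P) σ (t + u + 1) υ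

/-- The machine is deterministic: final state and number of steps depend only on the program and
the initial state. -/
theorem Exec.deterministic {P : Program} {σ τ τ' : State} {t t' : ℕ}
    (h : Exec P σ t τ) (h' : Exec P σ t' τ') : t = t' ∧ τ = τ' := by
  induction h generalizing t' τ' with
  | skip => cases h'; exact ⟨rfl, rfl⟩
  | instr => cases h'; exact ⟨rfl, rfl⟩
  | seq _ _ ih₁ ih₂ =>
    cases h' with
    | seq a b =>
      obtain ⟨rfl, rfl⟩ := ih₁ a
      obtain ⟨rfl, rfl⟩ := ih₂ b
      exact ⟨rfl, rfl⟩
  | branchTrue hb _ ih =>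
    cases h' with
    | branchTrue _ a => obtain ⟨rfl, rfl⟩ := ih a; exact ⟨rfl, rfl⟩
    | branchFalse hn _ => exact absurd hb hn
  | branchFalse hb _ ih =>
    cases h' with
    | branchFalse _ a => obtain ⟨rfl, rfl⟩ := ih a; exact ⟨rfl, rfl⟩
    | branchTrue hn _ => exact absurd hn hb
  | loopDone hb =>
    cases h' with
    | loopDone _ => exact ⟨rfl, rfl⟩
    | loopStep hn _ _ => exact absurd hn hb
  | loopStep hb _ _ ih₁ ih₂ =>
    cases h' with
    | loopDone hn => exact absurd hb hn
    | loopStep _ a b =>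
      obtain ⟨rfl, rfl⟩ := ih₁ a
      obtain ⟨rfl, rfl⟩ := ih₂ b
      exact ⟨rfl, rfl⟩

/-- The initial state on a family of `n` segments: the natural-number register `0` holds `n`, the
real arrays `0, 1` hold the two coordinates of the first endpoints and `2, 3` those of the second
endpoints (cell `i` belongs to segment `i`); everything else is zero. -/
noncomputable def initState {n : ℕ} (S : Fin n → PlaneSegment) : State where
  nreg := fun x => if x = 0 then n else 0
  rreg := fun _ => 0
  narr := fun _ _ => 0
  rarr := fun a i =>
    if h : i < n then
      match a with
      | 0 => (S ⟨i, h⟩).p 0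
      | 1 => (S ⟨i, h⟩).p 1
      | 2 => (S ⟨i, h⟩).q 0
      | 3 => (S ⟨i, h⟩).q 1
      | _ => 0
    else 0

/-- On the input `S`, the program `P` halts after exactly `t` steps and outputs `v`
(the final content of the natural-number register `0`). -/
def Computes {n : ℕ} (P : Program) (S : Fin n → PlaneSegment) (t v : ℕ) : Prop :=
  ∃ τ : State, Exec P (initState S) t τ ∧ τ.nreg 0 = v

end UnitRAM

/-! Approximation. A similarity moves all segments into a tiny square inside the unit square, with
lengths below 1/64. A segment with length in `[2⁻ᵏ, 2·2⁻ᵏ)` has level `k` and owns the 11 × 11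
dyadic cells of width `2⁻ᵏ` around its first endpoint, which makes `121 n` cells. Given a ball,
raise its radius to the length of the shortest segment it counts: nothing is lost, and the radius
becomes comparable to the width `w` of that segment's level. The cell of this level around the
centre is owned by the shortest segment, and every counted segment comes near it and owns a cell
containing it (`Small.exists_cell`). A ball of radius `r ∈ [w, 2w)` is covered by three slightly
smaller balls (`exists_offset_disc`), with enough room to round centres and radii to multiples of `w
/ 64`. So 2²⁰ candidate balls per cell suffice: the best one reaches a third of every count
(`Small.count_le`), and being a ball it never exceeds `λ` (`hits_le`).

Time. Each cell needs the list of segments near it that own a cell containing it. These are at least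
as long as the cell is wide and meet one of 49 balls of radius `w`, so there are at most `49 λ` of
them (`card_le_of_near`). Nearness passes to containing cells (`Near.mono`), so the list is the
filtered list of the closest containing cell, plus the cell's own segment. The containing cells form
a stack when the cells are visited in Z-order, because descendants are consecutive there
(`Small.contains_between`). The bit operation compares two cells in Z-order in constant time
(`zle_iff`). Hence merge sort costs `O(n log n)` and the traversal `O(n (λ + 1))`, while `λ ≥ 1`.

Program. The algorithm is written in a language of expressions and counted loops with a semantics
`Cmd.run` and a step bound `Cmd.cost`; `Cmd.compile_correct` carries both over to the machine. Each
fragment is described by a statement `∃ K, ∀ data, …`, where `K` depends only on the code. -/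

namespace UnitRAM

/-! ## A small language with expressions and bounded loops, compiled to the machine -/

/-- The two kinds of values. -/
inductive Ty where
  | nat | real

/-- The values of each kind. -/
abbrev Ty.Val : Ty → Type
  | .nat => ℕ
  | .real => ℝ

/-- Expressions over the registers and arrays of a state. Tests have the values `0` and `1`. -/
inductive Exp : Ty → Type where
  | nvar (x : ℕ) : Exp .nat
  | ncst (k : ℕ) : Exp .nat
  | nop (o : NOp) (a b : Exp .nat) : Exp .nat
  | nld (a : ℕ) (i : Exp .nat) : Exp .nat
  | bdf (a b : Exp .real) : Exp .nat
  | nlt (a b : Exp .nat) : Exp .nat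
  | rle (a b : Exp .real) : Exp .nat
  | cond {t : Ty} (c : Exp .nat) (a b : Exp t) : Exp t
  | rvar (x : ℕ) : Exp .real
  | rcst (q : ℚ) : Exp .real
  | rop (o : ROp) (a b : Exp .real) : Exp .real
  | rld (a : ℕ) (i : Exp .nat) : Exp .real
  | ofn (a : Exp .nat) : Exp .real
  | sqrt (a : Exp .real) : Exp .real
  | floor (a : Exp .real) : Exp .real
  | shl (a : Exp .real) (k : Exp .nat) : Exp .real
  | shr (a : Exp .real) (k : Exp .nat) : Exp .real

/-- The value of an expression. -/
noncomputable def Exp.eval : {t : Ty} → Exp t → State → t.Val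
  | _, .nvar x, σ => σ.nreg x
  | _, .ncst k, _ => k
  | _, .nop o a b, σ => o.eval (a.eval σ) (b.eval σ)
  | _, .nld a i, σ => σ.narr a (i.eval σ)
  | _, .bdf a b, σ => bitDiff (a.eval σ) (b.eval σ)
  | _, .nlt a b, σ => if (show ℕ from a.eval σ) < b.eval σ then 1 else 0
  | _, .rle a b, σ => if (show ℝ from a.eval σ) ≤ b.eval σ then 1 else 0
  | _, .cond c a b, σ => if (show ℕ from c.eval σ) = 0 then b.eval σ else a.eval σ
  | _, .rvar x, σ => σ.rreg x
  | _, .rcst q, _ => (q : ℝ)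
  | _, .rop o a b, σ => o.eval (a.eval σ) (b.eval σ)
  | _, .rld a i, σ => σ.rarr a (i.eval σ)
  | _, .ofn a, σ => ((show ℕ from a.eval σ) : ℝ)
  | _, .sqrt a, σ => Real.sqrt (a.eval σ)
  | _, .floor a, σ => (⌊(show ℝ from a.eval σ)⌋ : ℝ)
  | _, .shl a k, σ => (show ℝ from a.eval σ) * 2 ^ (show ℕ from k.eval σ)
  | _, .shr a k, σ => (show ℝ from a.eval σ) / 2 ^ (show ℕ from k.eval σ)

/-- A bound for the number of steps that the evaluation of an expression takes. -/
def Exp.size : {t : Ty} → Exp t → ℕ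
  | _, .nvar _ => 1
  | _, .ncst _ => 1
  | _, .nop _ a b => a.size + b.size + 1
  | _, .nld _ i => i.size + 1
  | _, .bdf a b => a.size + b.size + 1
  | _, .nlt a b => a.size + b.size + 2
  | _, .rle a b => a.size + b.size + 2
  | _, .cond c a b => c.size + a.size + b.size + 2
  | _, .rvar _ => 1
  | _, .rcst _ => 1
  | _, .rop _ a b => a.size + b.size + 1
  | _, .rld _ i => i.size + 1
  | _, .ofn a => a.size + 1
  | _, .sqrt a => a.size + 1
  | _, .floor a => a.size + 1
  | _, .shl a k => a.size + k.size + 1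
  | _, .shr a k => a.size + k.size + 1

/-- Code that leaves the value of an expression in the temporary register `2 * d + 1`. The
variable `x` lives in register `2 * x`. -/
def Exp.compile : {t : Ty} → Exp t → ℕ → Program
  | _, .nvar x, d => .instr (.nmove (2 * d + 1) (2 * x))
  | _, .ncst k, d => .instr (.nconst (2 * d + 1) k)
  | _, .nop o a b, d => .seq (a.compile d) (.seq (b.compile (d + 1))
      (.instr (.nop o (2 * d + 1) (2 * d + 1) (2 * (d + 1) + 1))))
  | _, .nld a i, d => .seq (i.compile d) (.instr (.nload (2 * d + 1) a (2 * d + 1)))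
  | _, .bdf a b, d => .seq (a.compile d) (.seq (b.compile (d + 1))
      (.instr (.bitdiff (2 * d + 1) (2 * d + 1) (2 * (d + 1) + 1))))
  | _, .nlt a b, d => .seq (a.compile d) (.seq (b.compile (d + 1))
      (.branch (.nlt (2 * d + 1) (2 * (d + 1) + 1))
        (.instr (.nconst (2 * d + 1) 1)) (.instr (.nconst (2 * d + 1) 0))))
  | _, .rle a b, d => .seq (a.compile d) (.seq (b.compile (d + 1))
      (.branch (.rle (2 * d + 1) (2 * (d + 1) + 1))
        (.instr (.nconst (2 * d + 1) 1)) (.instr (.nconst (2 * d + 1) 0))))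
  | _, .cond c a b, d => .seq (c.compile d) (.seq (.instr (.nconst (2 * (d + 1) + 1) 0))
      (.branch (.neq (2 * d + 1) (2 * (d + 1) + 1)) (b.compile d) (a.compile d)))
  | _, .rvar x, d => .instr (.rmove (2 * d + 1) (2 * x))
  | _, .rcst q, d => .instr (.rconst (2 * d + 1) q)
  | _, .rop o a b, d => .seq (a.compile d) (.seq (b.compile (d + 1))
      (.instr (.rop o (2 * d + 1) (2 * d + 1) (2 * (d + 1) + 1))))
  | _, .rld a i, d => .seq (i.compile d) (.instr (.rload (2 * d + 1) a (2 * d + 1)))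
  | _, .ofn a, d => .seq (a.compile d) (.instr (.rofnat (2 * d + 1) (2 * d + 1)))
  | _, .sqrt a, d => .seq (a.compile d) (.instr (.rsqrt (2 * d + 1) (2 * d + 1)))
  | _, .floor a, d => .seq (a.compile d) (.instr (.rfloor (2 * d + 1) (2 * d + 1)))
  | _, .shl a k, d => .seq (a.compile d) (.seq (k.compile (d + 1))
      (.instr (.rshl (2 * d + 1) (2 * d + 1) (2 * (d + 1) + 1))))
  | _, .shr a k, d => .seq (a.compile d) (.seq (k.compile (d + 1))
      (.instr (.rshr (2 * d + 1) (2 * d + 1) (2 * (d + 1) + 1))))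

/-- The machine state `ρ` represents `σ`: variables are held in the registers with even names. -/
structure Rel (σ ρ : State) : Prop where
  nreg : ∀ x, ρ.nreg (2 * x) = σ.nreg x
  rreg : ∀ x, ρ.rreg (2 * x) = σ.rreg x
  narr : ρ.narr = σ.narr
  rarr : ρ.rarr = σ.rarr

/-- The temporaries with index below `d` agree. -/
structure Pres (d : ℕ) (ρ τ : State) : Prop where
  nreg : ∀ x < d, τ.nreg (2 * x + 1) = ρ.nreg (2 * x + 1)
  rreg : ∀ x < d, τ.rreg (2 * x + 1) = ρ.rreg (2 * x + 1)

theorem Pres.refl (d : ℕ) (ρ : State) : Pres d ρ ρ := ⟨fun _ _ => rfl, fun _ _ => rfl⟩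

theorem Pres.trans {d d' : ℕ} {ρ τ υ : State} (h : Pres d ρ τ) (h' : Pres d' τ υ) (hd : d ≤ d') :
    Pres d ρ υ :=
  ⟨fun x hx => (h'.nreg x (by omega)).trans (h.nreg x hx),
    fun x hx => (h'.rreg x (by omega)).trans (h.rreg x hx)⟩

theorem Pres.setN {d d' : ℕ} {ρ τ : State} (h : Pres d ρ τ) (hd : d ≤ d') (v : ℕ) :
    Pres d ρ (τ.setN (2 * d' + 1) v) := by
  refine ⟨fun x hx => ?_, h.rreg⟩
  have : 2 * x + 1 ≠ 2 * d' + 1 := by omega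
  simpa [State.setN, Function.update_of_ne this] using h.nreg x hx

theorem Pres.setR {d d' : ℕ} {ρ τ : State} (h : Pres d ρ τ) (hd : d ≤ d') (v : ℝ) :
    Pres d ρ (τ.setR (2 * d' + 1) v) := by
  refine ⟨h.nreg, fun x hx => ?_⟩
  have : 2 * x + 1 ≠ 2 * d' + 1 := by omega
  simpa [State.setR, Function.update_of_ne this] using h.rreg x hx

theorem Rel.setN_temp {σ ρ : State} (h : Rel σ ρ) (d v : ℕ) : Rel σ (ρ.setN (2 * d + 1) v) := by
  refine ⟨fun x => ?_, h.rreg, h.narr, h.rarr⟩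
  have : 2 * x ≠ 2 * d + 1 := by omega
  simpa [State.setN, Function.update_of_ne this] using h.nreg x

theorem Rel.setR_temp {σ ρ : State} (h : Rel σ ρ) (d : ℕ) (v : ℝ) :
    Rel σ (ρ.setR (2 * d + 1) v) := by
  refine ⟨h.nreg, fun x => ?_, h.narr, h.rarr⟩
  have : 2 * x ≠ 2 * d + 1 := by omega
  simpa [State.setR, Function.update_of_ne this] using h.rreg x

theorem Rel.setN {σ ρ : State} (h : Rel σ ρ) (x v : ℕ) :
    Rel (σ.setN x v) (ρ.setN (2 * x) v) := by
  refine ⟨fun y => ?_, h.rreg, h.narr, h.rarr⟩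
  by_cases hy : y = x
  · subst hy; simp [State.setN]
  · have : 2 * y ≠ 2 * x := by omega
    simpa [State.setN, Function.update_of_ne this, Function.update_of_ne hy] using h.nreg y

theorem Rel.setR {σ ρ : State} (h : Rel σ ρ) (x : ℕ) (v : ℝ) :
    Rel (σ.setR x v) (ρ.setR (2 * x) v) := by
  refine ⟨h.nreg, fun y => ?_, h.narr, h.rarr⟩
  by_cases hy : y = x
  · subst hy; simp [State.setR]
  · have : 2 * y ≠ 2 * x := by omega
    simpa [State.setR, Function.update_of_ne this, Function.update_of_ne hy] using h.rreg y

/-- The content of a register of the given kind. -/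
def State.val (ρ : State) : (t : Ty) → ℕ → t.Val
  | .nat, x => ρ.nreg x
  | .real, x => ρ.rreg x

theorem Pres.val {d : ℕ} {ρ τ : State} (h : Pres d ρ τ) (t : Ty) {x : ℕ} (hx : x < d) :
    τ.val t (2 * x + 1) = ρ.val t (2 * x + 1) := by
  cases t
  · exact h.nreg x hx
  · exact h.rreg x hx

/-- The code for `e` computes the value of `e`. -/
def Exp.Correct {t : Ty} (e : Exp t) : Prop :=
  ∀ (d : ℕ) (σ ρ : State), Rel σ ρ → ∃ τ k, Exec (e.compile d) ρ k τ ∧ k ≤ e.size ∧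
    Rel σ τ ∧ Pres d ρ τ ∧ τ.val t (2 * d + 1) = e.eval σ

/-- Evaluation of two expressions one after the other. -/
theorem Exp.Correct.pair {s t : Ty} {a : Exp s} {b : Exp t} (ha : a.Correct) (hb : b.Correct)
    (d : ℕ) {σ ρ : State} (h : Rel σ ρ) :
    ∃ τ υ k l, Exec (a.compile d) ρ k τ ∧ Exec (b.compile (d + 1)) τ l υ ∧
      k + l ≤ a.size + b.size ∧ Rel σ υ ∧ Pres d ρ υ ∧
      υ.val s (2 * d + 1) = a.eval σ ∧ υ.val t (2 * (d + 1) + 1) = b.eval σ := by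
  obtain ⟨τ, k, h1, hk, h2, h3, h4⟩ := ha d σ ρ h
  obtain ⟨υ, l, g1, hl, g2, g3, g4⟩ := hb (d + 1) σ τ h2
  exact ⟨τ, υ, k, l, h1, g1, by omega, g2, h3.trans g3 (by omega),
    (g3.val s (by omega)).trans h4, g4⟩

/-- A second operand is evaluated at depth `d + 1`, so the first result, waiting in temporary `d`,
survives by `Pres`; variables sit in even registers and are out of reach. -/
theorem Exp.correct {t : Ty} (e : Exp t) : e.Correct := by
  induction e with
  | nvar x =>
    intro d σ ρ h
    exact ⟨_, 1, .instr _ _, le_rfl, h.setN_temp d _, (Pres.refl d ρ).setN le_rfl _, by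
      simp [Instr.apply, State.val, State.setN, Exp.eval, h.nreg]⟩
  | ncst k =>
    intro d σ ρ h
    exact ⟨_, 1, .instr _ _, le_rfl, h.setN_temp d _, (Pres.refl d ρ).setN le_rfl _, by
      simp [Instr.apply, State.val, State.setN, Exp.eval]⟩
  | rvar x =>
    intro d σ ρ h
    exact ⟨_, 1, .instr _ _, le_rfl, h.setR_temp d _, (Pres.refl d ρ).setR le_rfl _, by
      simp [Instr.apply, State.val, State.setR, Exp.eval, h.rreg]⟩
  | rcst k =>
    intro d σ ρ h
    exact ⟨_, 1, .instr _ _, le_rfl, h.setR_temp d _, (Pres.refl d ρ).setR le_rfl _, by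
      simp [Instr.apply, State.val, State.setR, Exp.eval]⟩
  | nop o a b iha ihb =>
    intro d σ ρ h
    obtain ⟨τ, υ, k, l, h1, h2, hk, hr, hp, hv, hw⟩ := iha.pair ihb d h
    refine ⟨_, k + (l + 1), .seq h1 (.seq h2 (.instr _ _)), by simp only [Exp.size]; omega,
      hr.setN_temp d _, hp.setN le_rfl _, ?_⟩
    simp only [State.val] at hv hw
    simp [Instr.apply, State.val, State.setN, Exp.eval, hv, hw]
  | bdf a b iha ihb =>
    intro d σ ρ h
    obtain ⟨τ, υ, k, l, h1, h2, hk, hr, hp, hv, hw⟩ := iha.pair ihb d h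
    refine ⟨_, k + (l + 1), .seq h1 (.seq h2 (.instr _ _)), by simp only [Exp.size]; omega,
      hr.setN_temp d _, hp.setN le_rfl _, ?_⟩
    simp only [State.val] at hv hw
    simp [Instr.apply, State.val, State.setN, Exp.eval, hv, hw]
  | rop o a b iha ihb =>
    intro d σ ρ h
    obtain ⟨τ, υ, k, l, h1, h2, hk, hr, hp, hv, hw⟩ := iha.pair ihb d h
    refine ⟨_, k + (l + 1), .seq h1 (.seq h2 (.instr _ _)), by simp only [Exp.size]; omega,
      hr.setR_temp d _, hp.setR le_rfl _, ?_⟩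
    simp only [State.val] at hv hw
    simp [Instr.apply, State.val, State.setR, Exp.eval, hv, hw]
  | shl a b iha ihb =>
    intro d σ ρ h
    obtain ⟨τ, υ, k, l, h1, h2, hk, hr, hp, hv, hw⟩ := iha.pair ihb d h
    refine ⟨_, k + (l + 1), .seq h1 (.seq h2 (.instr _ _)), by simp only [Exp.size]; omega,
      hr.setR_temp d _, hp.setR le_rfl _, ?_⟩
    simp only [State.val] at hv hw
    simp [Instr.apply, State.val, State.setR, Exp.eval, hv, hw]
  | shr a b iha ihb =>
    intro d σ ρ h
    obtain ⟨τ, υ, k, l, h1, h2, hk, hr, hp, hv, hw⟩ := iha.pair ihb d h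
    refine ⟨_, k + (l + 1), .seq h1 (.seq h2 (.instr _ _)), by simp only [Exp.size]; omega,
      hr.setR_temp d _, hp.setR le_rfl _, ?_⟩
    simp only [State.val] at hv hw
    simp [Instr.apply, State.val, State.setR, Exp.eval, hv, hw]
  | nlt a b iha ihb =>
    intro d σ ρ h
    obtain ⟨τ, υ, k, l, h1, h2, hk, hr, hp, hv, hw⟩ := iha.pair ihb d h
    simp only [State.val] at hv hw
    by_cases hc : υ.nreg (2 * d + 1) < υ.nreg (2 * (d + 1) + 1)
    · refine ⟨_, k + (l + (1 + 1)), .seq h1 (.seq h2 (.branchTrue hc (.instr _ _))),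
        by simp only [Exp.size]; omega, hr.setN_temp d _, hp.setN le_rfl _, ?_⟩
      rw [hv, hw] at hc
      simp [Instr.apply, State.val, State.setN, Exp.eval, hc]
    · refine ⟨_, k + (l + (1 + 1)), .seq h1 (.seq h2 (.branchFalse hc (.instr _ _))),
        by simp only [Exp.size]; omega, hr.setN_temp d _, hp.setN le_rfl _, ?_⟩
      rw [hv, hw] at hc
      simp [Instr.apply, State.val, State.setN, Exp.eval, hc]
  | rle a b iha ihb =>
    intro d σ ρ h
    obtain ⟨τ, υ, k, l, h1, h2, hk, hr, hp, hv, hw⟩ := iha.pair ihb d h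
    simp only [State.val] at hv hw
    by_cases hc : υ.rreg (2 * d + 1) ≤ υ.rreg (2 * (d + 1) + 1)
    · refine ⟨_, k + (l + (1 + 1)), .seq h1 (.seq h2 (.branchTrue hc (.instr _ _))),
        by simp only [Exp.size]; omega, hr.setN_temp d _, hp.setN le_rfl _, ?_⟩
      rw [hv, hw] at hc
      simp [Instr.apply, State.val, State.setN, Exp.eval, hc]
    · refine ⟨_, k + (l + (1 + 1)), .seq h1 (.seq h2 (.branchFalse hc (.instr _ _))),
        by simp only [Exp.size]; omega, hr.setN_temp d _, hp.setN le_rfl _, ?_⟩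
      rw [hv, hw] at hc
      simp [Instr.apply, State.val, State.setN, Exp.eval, hc]
  | cond c a b ihc iha ihb =>
    intro d σ ρ h
    obtain ⟨τ, k, h1, hk, hr, hp, hv⟩ := ihc d σ ρ h
    have hr' := hr.setN_temp (d + 1) 0
    have hp' := hp.setN (Nat.le_succ d) 0
    have e1 : (τ.setN (2 * (d + 1) + 1) 0).nreg (2 * d + 1) = c.eval σ := by
      rw [← hv]; simp [State.val, State.setN]
    have e2 : (τ.setN (2 * (d + 1) + 1) 0).nreg (2 * (d + 1) + 1) = 0 := by simp [State.setN]
    by_cases hc : (show ℕ from c.eval σ) = 0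
    · obtain ⟨υ, l, g1, hl, g2, g3, g4⟩ := ihb d σ _ hr'
      refine ⟨υ, k + (1 + (l + 1)), .seq h1 (.seq (.instr _ _) (.branchTrue ?_ g1)),
        by simp only [Exp.size]; omega, g2, hp'.trans g3 le_rfl, ?_⟩
      · exact e1.trans (hc.trans e2.symm)
      · simp only [Exp.eval]; rw [if_pos hc, g4]
    · obtain ⟨υ, l, g1, hl, g2, g3, g4⟩ := iha d σ _ hr'
      refine ⟨υ, k + (1 + (l + 1)), .seq h1 (.seq (.instr _ _) (.branchFalse ?_ g1)),
        by simp only [Exp.size]; omega, g2, hp'.trans g3 le_rfl, ?_⟩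
      · intro h'
        exact hc (e1.symm.trans ((show _ = _ from h').trans e2))
      · simp only [Exp.eval]; rw [if_neg hc, g4]
  | nld a i ih =>
    intro d σ ρ h
    obtain ⟨τ, k, h1, hk, hr, hp, hv⟩ := ih d σ ρ h
    refine ⟨_, k + 1, .seq h1 (.instr _ _), by simp only [Exp.size]; omega,
      hr.setN_temp d _, hp.setN le_rfl _, ?_⟩
    simp only [State.val] at hv
    simp [Instr.apply, State.val, State.setN, Exp.eval, hv, hr.narr]
  | rld a i ih =>
    intro d σ ρ h
    obtain ⟨τ, k, h1, hk, hr, hp, hv⟩ := ih d σ ρ h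
    refine ⟨_, k + 1, .seq h1 (.instr _ _), by simp only [Exp.size]; omega,
      hr.setR_temp d _, hp.setR le_rfl _, ?_⟩
    simp only [State.val] at hv
    simp [Instr.apply, State.val, State.setR, Exp.eval, hv, hr.rarr]
  | ofn a ih =>
    intro d σ ρ h
    obtain ⟨τ, k, h1, hk, hr, hp, hv⟩ := ih d σ ρ h
    refine ⟨_, k + 1, .seq h1 (.instr _ _), by simp only [Exp.size]; omega,
      hr.setR_temp d _, hp.setR le_rfl _, ?_⟩
    simp only [State.val] at hv
    simp [Instr.apply, State.val, State.setR, Exp.eval, hv]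
  | sqrt a ih =>
    intro d σ ρ h
    obtain ⟨τ, k, h1, hk, hr, hp, hv⟩ := ih d σ ρ h
    refine ⟨_, k + 1, .seq h1 (.instr _ _), by simp only [Exp.size]; omega,
      hr.setR_temp d _, hp.setR le_rfl _, ?_⟩
    simp only [State.val] at hv
    simp [Instr.apply, State.val, State.setR, Exp.eval, hv]
  | floor a ih =>
    intro d σ ρ h
    obtain ⟨τ, k, h1, hk, hr, hp, hv⟩ := ih d σ ρ h
    refine ⟨_, k + 1, .seq h1 (.instr _ _), by simp only [Exp.size]; omega,
      hr.setR_temp d _, hp.setR le_rfl _, ?_⟩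
    simp only [State.val] at hv
    simp [Instr.apply, State.val, State.setR, Exp.eval, hv]

/-! ### Commands, their cost and their compilation -/

/-- Commands; `loop x e c` runs `c` with `x = 0, 1, …` up to the value of `e` (exclusively)
at the start. -/
inductive Cmd where
  | nset (x : ℕ) (e : Exp .nat)
  | rset (x : ℕ) (e : Exp .real)
  | nst (a : ℕ) (i e : Exp .nat)
  | skip
  | seq (c d : Cmd)
  | ite (e : Exp .nat) (c d : Cmd)
  | loop (x : ℕ) (e : Exp .nat) (c : Cmd)

/-- The state after `k` rounds of a loop with counter `x` and body `f`. -/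
def iter (x : ℕ) (f : State → State) (σ : State) : ℕ → State
  | 0 => σ
  | k + 1 => f ((iter x f σ k).setN x k)

/-- The effect of a command. -/
noncomputable def Cmd.run : Cmd → State → State
  | .nset x e, σ => σ.setN x (e.eval σ)
  | .rset x e, σ => σ.setR x (e.eval σ)
  | .nst a i e, σ => σ.setNArr a (i.eval σ) (e.eval σ)
  | .skip, σ => σ
  | .seq c d, σ => d.run (c.run σ)
  | .ite e c d, σ => if (show ℕ from e.eval σ) = 0 then d.run σ else c.run σ
  | .loop x e c, σ => iter x c.run σ (e.eval σ)

/-- A bound for the number of steps of a command. -/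
noncomputable def Cmd.cost : Cmd → State → ℕ
  | .nset _ e, _ => e.size + 1
  | .rset _ e, _ => e.size + 1
  | .nst _ i e, _ => i.size + e.size + 1
  | .skip, _ => 1
  | .seq c d, σ => c.cost σ + d.cost (c.run σ)
  | .ite e c d, σ => e.size + 2 + (if (show ℕ from e.eval σ) = 0 then d.cost σ else c.cost σ)
  | .loop x e c, σ => e.size + 2 +
      ∑ k ∈ Finset.range (e.eval σ), (c.cost ((iter x c.run σ k).setN x k) + 4)

/-- The code of a command; temporaries with index below `d` are left alone. -/
def Cmd.compile : Cmd → ℕ → Program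
  | .nset x e, d => .seq (e.compile d) (.instr (.nmove (2 * x) (2 * d + 1)))
  | .rset x e, d => .seq (e.compile d) (.instr (.rmove (2 * x) (2 * d + 1)))
  | .nst a i e, d => .seq (i.compile d) (.seq (e.compile (d + 1))
      (.instr (.nstore a (2 * d + 1) (2 * (d + 1) + 1))))
  | .skip, _ => .skip
  | .seq c c', d => .seq (c.compile d) (c'.compile d)
  | .ite e c c', d => .seq (e.compile d) (.seq (.instr (.nconst (2 * (d + 1) + 1) 0))
      (.branch (.neq (2 * d + 1) (2 * (d + 1) + 1)) (c'.compile d) (c.compile d)))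
  | .loop x e c, d => .seq (e.compile d) (.seq (.instr (.nconst (2 * (d + 1) + 1) 0))
      (.loop (.nlt (2 * (d + 1) + 1) (2 * d + 1))
        (.seq (.instr (.nmove (2 * x) (2 * (d + 1) + 1))) (.seq (c.compile (d + 2))
          (.seq (.instr (.nconst (2 * (d + 2) + 1) 1))
            (.instr (.nop .add (2 * (d + 1) + 1) (2 * (d + 1) + 1) (2 * (d + 2) + 1))))))))

theorem Rel.setNArr {σ ρ : State} (h : Rel σ ρ) (a i v : ℕ) :
    Rel (σ.setNArr a i v) (ρ.setNArr a i v) :=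
  ⟨h.nreg, h.rreg, by simp [State.setNArr, h.narr], h.rarr⟩

/-- A compiled loop keeps its bound in temporary `d` and its counter in `d + 1`, and its body works
from depth `d + 2`, so both survive. The variable `x` receives only a copy of the counter, hence the
body may overwrite it. In the loop case, `key` is an induction on the number `j` of remaining
rounds. -/
theorem Cmd.compile_correct (c : Cmd) : ∀ (d : ℕ) (σ ρ : State), Rel σ ρ →
    ∃ τ k, Exec (c.compile d) ρ k τ ∧ k ≤ c.cost σ ∧ Rel (c.run σ) τ ∧ Pres d ρ τ := by
  induction c with
  | nset x e =>
    intro d σ ρ h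
    obtain ⟨τ, k, h1, hk, hr, hp, hv⟩ := e.correct d σ ρ h
    refine ⟨_, k + 1, .seq h1 (.instr _ _), by simp only [Cmd.cost]; omega, ?_, ?_⟩
    · simp only [State.val] at hv
      simpa [Instr.apply, hv, Cmd.run] using hr.setN x (e.eval σ)
    · refine ⟨fun y hy => ?_, hp.rreg⟩
      have : 2 * y + 1 ≠ 2 * x := by omega
      simpa [Instr.apply, State.setN, Function.update_of_ne this] using hp.nreg y hy
  | rset x e =>
    intro d σ ρ h
    obtain ⟨τ, k, h1, hk, hr, hp, hv⟩ := e.correct d σ ρ h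
    refine ⟨_, k + 1, .seq h1 (.instr _ _), by simp only [Cmd.cost]; omega, ?_, ?_⟩
    · simp only [State.val] at hv
      simpa [Instr.apply, hv, Cmd.run] using hr.setR x (e.eval σ)
    · refine ⟨hp.nreg, fun y hy => ?_⟩
      have : 2 * y + 1 ≠ 2 * x := by omega
      simpa [Instr.apply, State.setR, Function.update_of_ne this] using hp.rreg y hy
  | nst a i e =>
    intro d σ ρ h
    obtain ⟨τ, υ, k, l, h1, h2, hk, hr, hp, hv, hw⟩ := i.correct.pair e.correct d h
    refine ⟨_, k + (l + 1), .seq h1 (.seq h2 (.instr _ _)), by simp only [Cmd.cost]; omega, ?_,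
      ⟨hp.nreg, hp.rreg⟩⟩
    simp only [State.val] at hv hw
    simpa [Instr.apply, hv, hw, Cmd.run] using hr.setNArr a (i.eval σ) (e.eval σ)
  | skip =>
    intro d σ ρ h
    exact ⟨ρ, 1, .skip _, le_rfl, h, .refl _ _⟩
  | seq c c' ih ih' =>
    intro d σ ρ h
    obtain ⟨τ, k, h1, hk, hr, hp⟩ := ih d σ ρ h
    obtain ⟨υ, l, h2, hl, hr', hp'⟩ := ih' d _ τ hr
    exact ⟨υ, k + l, .seq h1 h2, by simp only [Cmd.cost]; omega, hr', hp.trans hp' le_rfl⟩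
  | ite e c c' ih ih' =>
    intro d σ ρ h
    obtain ⟨τ, k, h1, hk, hr, hp, hv⟩ := e.correct d σ ρ h
    have hr' := hr.setN_temp (d + 1) 0
    have hp' := hp.setN (Nat.le_succ d) 0
    have e1 : (τ.setN (2 * (d + 1) + 1) 0).nreg (2 * d + 1) = e.eval σ := by
      rw [← hv]; simp [State.val, State.setN]
    have e2 : (τ.setN (2 * (d + 1) + 1) 0).nreg (2 * (d + 1) + 1) = 0 := by simp [State.setN]
    by_cases hc : (show ℕ from e.eval σ) = 0
    · obtain ⟨υ, l, g1, hl, g2, g3⟩ := ih' d σ _ hr'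
      refine ⟨υ, k + (1 + (l + 1)), .seq h1 (.seq (.instr _ _) (.branchTrue ?_ g1)),
        ?_, ?_, hp'.trans g3 le_rfl⟩
      · exact e1.trans (hc.trans e2.symm)
      · simp only [Cmd.cost]; rw [if_pos hc]; omega
      · simp only [Cmd.run]; rw [if_pos hc]; exact g2
    · obtain ⟨υ, l, g1, hl, g2, g3⟩ := ih d σ _ hr'
      refine ⟨υ, k + (1 + (l + 1)), .seq h1 (.seq (.instr _ _) (.branchFalse ?_ g1)),
        ?_, ?_, hp'.trans g3 le_rfl⟩
      · intro h'
        exact hc (e1.symm.trans ((show _ = _ from h').trans e2))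
      · simp only [Cmd.cost]; rw [if_neg hc]; omega
      · simp only [Cmd.run]; rw [if_neg hc]; exact g2
  | loop x e c ih =>
    intro d σ ρ h
    obtain ⟨τ, k, h1, hk, hr, hp, hv⟩ := e.correct d σ ρ h
    set b : ℕ := e.eval σ with hb
    have key : ∀ j i, i + j = b → ∀ ρ', Rel (iter x c.run σ i) ρ' →
        ρ'.nreg (2 * d + 1) = b → ρ'.nreg (2 * (d + 1) + 1) = i → ∃ υ l,
        Exec (.loop (.nlt (2 * (d + 1) + 1) (2 * d + 1))
          (.seq (.instr (.nmove (2 * x) (2 * (d + 1) + 1))) (.seq (c.compile (d + 2))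
          (.seq (.instr (.nconst (2 * (d + 2) + 1) 1))
            (.instr (.nop .add (2 * (d + 1) + 1) (2 * (d + 1) + 1) (2 * (d + 2) + 1)))))))
          ρ' l υ ∧ l ≤ 1 + ∑ k ∈ Finset.Ico i b, (c.cost ((iter x c.run σ k).setN x k) + 4) ∧
        Rel (iter x c.run σ b) υ ∧ Pres d ρ' υ := by
      intro j
      induction j with
      | zero =>
        intro i hi ρ' hρ hb' hi'
        obtain rfl : i = b := by omega
        refine ⟨ρ', 1, .loopDone ?_, by simp, hρ, .refl _ _⟩
        simp [Test.Holds, hb', hi']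
      | succ j IH =>
        intro i hi ρ' hρ hb' hi'
        have r1 := hρ.setN x i
        obtain ⟨υ, l, g1, hl, g2, g3⟩ := ih (d + 2) _ _ r1
        have n1 : υ.nreg (2 * d + 1) = b := by
          rw [g3.nreg d (by omega)]
          have : 2 * d + 1 ≠ 2 * x := by omega
          simp [State.setN, Function.update_of_ne this, hb']
        have n2 : υ.nreg (2 * (d + 1) + 1) = i := by
          rw [g3.nreg (d + 1) (by omega)]
          have : 2 * (d + 1) + 1 ≠ 2 * x := by omega
          simp only [State.setN, Function.update_of_ne this, hi']
        have n3 : (υ.setN (2 * (d + 2) + 1) 1).nreg (2 * (d + 1) + 1) = i := by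
          simp [State.setN, n2]
        have n4 : (υ.setN (2 * (d + 2) + 1) 1).nreg (2 * (d + 2) + 1) = 1 := by
          simp [State.setN]
        have r2 : Rel (iter x c.run σ (i + 1))
            ((υ.setN (2 * (d + 2) + 1) 1).setN (2 * (d + 1) + 1) (i + 1)) :=
          (g2.setN_temp (d + 2) 1).setN_temp (d + 1) _
        obtain ⟨ω, l', w1, hl', w2, w3⟩ := IH (i + 1) (by omega) _ r2
          (by simp [State.setN, n1]) (by simp [State.setN])
        have hin : (Instr.nmove (2 * x) (2 * (d + 1) + 1)).apply ρ' = ρ'.setN (2 * x) i := by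
          simp [Instr.apply, hi']
        have hin2 : (Instr.nop .add (2 * (d + 1) + 1) (2 * (d + 1) + 1) (2 * (d + 2) + 1)).apply
            (υ.setN (2 * (d + 2) + 1) 1) =
            (υ.setN (2 * (d + 2) + 1) 1).setN (2 * (d + 1) + 1) (i + 1) := by
          simp only [Instr.apply, NOp.eval, n3, n4]
        refine ⟨ω, (1 + (l + (1 + 1))) + l' + 1, .loopStep ?_ (.seq (.instr _ _) (.seq (hin ▸ g1)
          (.seq (.instr _ _) (.instr _ _)))) ?_, ?_, w2, ?_⟩
        · simp only [Test.Holds, hb', hi']; omega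
        · simp only [Instr.apply] at hin2 ⊢
          rw [hin2]; exact w1
        · rw [Finset.sum_eq_sum_Ico_succ_bot (by omega)]; omega
        · have p1 : Pres d ρ' (ρ'.setN (2 * x) i) := by
            refine ⟨fun y hy => ?_, fun _ _ => rfl⟩
            have : 2 * y + 1 ≠ 2 * x := by omega
            simp [State.setN, Function.update_of_ne this]
          have p2 := p1.trans g3 (by omega)
          exact ((p2.setN (d' := d + 2) (by omega) 1).setN (d' := d + 1) (by omega) (i + 1)).trans
            w3 le_rfl
    have hr' := hr.setN_temp (d + 1) 0
    have hp' := hp.setN (Nat.le_succ d) 0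
    obtain ⟨υ, l, g1, hl, g2, g3⟩ := key b 0 (by omega) _ hr' (by
      simp only [State.val] at hv
      simp [State.setN, hv, hb]) (by simp [State.setN])
    refine ⟨υ, k + (1 + l), .seq h1 (.seq (.instr _ _) g1), ?_, g2, hp'.trans g3 le_rfl⟩
    simp only [Cmd.cost]
    rw [Finset.range_eq_Ico, ← hb]
    omega

theorem Cmd.computes (c : Cmd) {n : ℕ} (S : Fin n → PlaneSegment) :
    ∃ t, Computes (c.compile 0) S t ((c.run (initState S)).nreg 0) ∧ t ≤ c.cost (initState S) := by
  have h : Rel (initState S) (initState S) :=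
    ⟨fun x => by simp [initState], fun _ => rfl, rfl, rfl⟩
  obtain ⟨τ, k, h1, hk, hr, -⟩ := c.compile_correct 0 _ _ h
  exact ⟨k, ⟨τ, h1, hr.nreg 0⟩, hk⟩

end UnitRAM

/-! ## Bits and the Z-order -/

namespace UnitRAM

theorem floor_mul_two_pow_succ (x : ℝ) (i : ℕ) :
    ⌊x * 2 ^ (i + 1)⌋ = 2 * ⌊x * 2 ^ i⌋ + bit x (i + 1) := by
  have h : ⌊x * 2 ^ (i + 1)⌋ / 2 = ⌊x * 2 ^ i⌋ := by
    have h2 : x * 2 ^ i = x * 2 ^ (i + 1) / ((2 : ℕ) : ℝ) := by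
      rw [pow_succ]; push_cast; ring
    rw [h2, Int.floor_div_natCast]; rfl
  unfold bit
  omega

/-- If no bit differs up to the position `d`, the numbers agree up to that position. -/
theorem floor_eq_of_bit_eq {x y : ℝ} (h0 : ⌊x⌋ = ⌊y⌋) {d : ℕ}
    (h : ∀ i, 1 ≤ i → i ≤ d → bit x i = bit y i) : ⌊x * 2 ^ d⌋ = ⌊y * 2 ^ d⌋ := by
  induction d with
  | zero => simpa using h0
  | succ d ih =>
    rw [floor_mul_two_pow_succ, floor_mul_two_pow_succ, ih fun i h1 h2 => h i h1 (by omega),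
      h (d + 1) (by omega) le_rfl]

theorem eq_of_floor_eq {x y : ℝ} (h : ∀ i : ℕ, ⌊x * 2 ^ i⌋ = ⌊y * 2 ^ i⌋) : x = y := by
  by_contra hne
  have hpos : 0 < |x - y| := abs_pos.mpr (sub_ne_zero.mpr hne)
  obtain ⟨i, hi⟩ := exists_nat_gt (1 / |x - y|)
  have h1 : |x * 2 ^ i - y * 2 ^ i| < 1 := Int.abs_sub_lt_one_of_floor_eq_floor (h i)
  rw [← sub_mul, abs_mul, abs_of_pos (by positivity : (0 : ℝ) < 2 ^ i)] at h1
  rw [div_lt_iff₀ hpos] at hi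
  have h2 : (i : ℝ) ≤ 2 ^ i := by exact_mod_cast Nat.lt_two_pow_self.le
  nlinarith

/-- Positions start at 1, so the default value `sInf ∅ = 0` cannot be mistaken for a differing bit.
-/
theorem eq_of_bitDiff_eq_zero {x y : ℝ} (h0 : ⌊x⌋ = ⌊y⌋) (h : bitDiff x y = 0) : x = y := by
  refine eq_of_floor_eq fun i => floor_eq_of_bit_eq h0 fun j hj _ => ?_
  by_contra hne
  have h1 : bitDiff x y ∈ {i : ℕ | 1 ≤ i ∧ bit x i ≠ bit y i} := Nat.sInf_mem ⟨j, hj, hne⟩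
  have := h1.1
  omega

theorem floor_eq_of_lt_bitDiff {x y : ℝ} (h0 : ⌊x⌋ = ⌊y⌋) {i : ℕ} (hi : i < bitDiff x y) :
    ⌊x * 2 ^ i⌋ = ⌊y * 2 ^ i⌋ := by
  refine floor_eq_of_bit_eq h0 fun j hj hji => ?_
  by_contra hne
  have : bitDiff x y ≤ j := Nat.sInf_le ⟨hj, hne⟩
  omega

/-- The prefixes before the first differing bit agree, so that bit alone separates the two floors.
-/
theorem floor_ne_of_bitDiff {x y : ℝ} (h0 : ⌊x⌋ = ⌊y⌋) (h : bitDiff x y ≠ 0) :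
    ⌊x * 2 ^ bitDiff x y⌋ ≠ ⌊y * 2 ^ bitDiff x y⌋ := by
  have hne : {i : ℕ | 1 ≤ i ∧ bit x i ≠ bit y i}.Nonempty := by
    by_contra hc
    rw [Set.not_nonempty_iff_eq_empty] at hc
    exact h (by simp [bitDiff, hc])
  have h1 : bitDiff x y ∈ {i : ℕ | 1 ≤ i ∧ bit x i ≠ bit y i} := Nat.sInf_mem hne
  obtain ⟨d, hd⟩ : ∃ d, bitDiff x y = d + 1 := ⟨bitDiff x y - 1, by have := h1.1; omega⟩
  have h2 := h1.2
  have h3 := floor_eq_of_lt_bitDiff h0 (i := d) (by omega)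
  rw [hd] at h2 ⊢
  rw [floor_mul_two_pow_succ, floor_mul_two_pow_succ]
  omega

/-- The position of the leading bit of a number below `1` determines its magnitude. -/
theorem bitDiff_zero_bounds {x : ℝ} (h0 : 0 < x) (h1 : x < 1) :
    1 ≤ bitDiff x 0 ∧ 1 / 2 ^ bitDiff x 0 ≤ x ∧ x < 2 * (1 / 2 ^ bitDiff x 0) := by
  have hf : ⌊x⌋ = ⌊(0 : ℝ)⌋ := by
    rw [Int.floor_zero, Int.floor_eq_zero_iff]; exact ⟨h0.le, h1⟩
  have hne : bitDiff x 0 ≠ 0 := fun h => h0.ne' (eq_of_bitDiff_eq_zero hf h)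
  have h2 := floor_ne_of_bitDiff hf hne
  have h3 := floor_eq_of_lt_bitDiff hf (i := bitDiff x 0 - 1) (by omega)
  obtain ⟨d, hd⟩ : ∃ d, bitDiff x 0 = d + 1 := ⟨bitDiff x 0 - 1, by omega⟩
  rw [hd] at h2 h3 ⊢
  simp only [zero_mul, Int.floor_zero, Nat.add_sub_cancel] at h2 h3
  have hp : (0 : ℝ) < 2 ^ d := by positivity
  refine ⟨by omega, ?_, ?_⟩
  · have h4 : 1 ≤ ⌊x * 2 ^ (d + 1)⌋ := by
      have : 0 ≤ ⌊x * 2 ^ (d + 1)⌋ := Int.floor_nonneg.mpr (by positivity)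
      omega
    have h5 : (1 : ℝ) ≤ x * 2 ^ (d + 1) := by
      have := Int.le_floor.mp h4
      exact_mod_cast this
    rw [div_le_iff₀ (by positivity)]
    exact h5
  · have h4 := (Int.floor_eq_zero_iff.mp h3).2
    rw [pow_succ]
    have : 2 * (1 / (2 ^ d * 2) : ℝ) = 1 / 2 ^ d := by field_simp
    rw [this, lt_div_iff₀ hp]
    exact h4

/-- The sequence of grid cells that contain a point. -/
noncomputable def zseq (x y : ℝ) : Lex (ℕ → ℤ ×ₗ ℤ) :=
  toLex fun i => toLex (⌊x * 2 ^ i⌋, ⌊y * 2 ^ i⌋)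

/-- Sort key: points in Z-order, ties by level. -/
noncomputable def zkey (x y : ℝ) (k : ℕ) : Lex (ℕ → ℤ ×ₗ ℤ) ×ₗ ℕ := toLex (zseq x y, k)

theorem zseq_apply (x y : ℝ) (i : ℕ) : zseq x y i = toLex (⌊x * 2 ^ i⌋, ⌊y * 2 ^ i⌋) := rfl

theorem zseq_apply_eq_iff {x y x' y' : ℝ} {i : ℕ} : zseq x y i = zseq x' y' i ↔
    ⌊x * 2 ^ i⌋ = ⌊x' * 2 ^ i⌋ ∧ ⌊y * 2 ^ i⌋ = ⌊y' * 2 ^ i⌋ := by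
  rw [zseq_apply, zseq_apply, toLex_inj, Prod.mk.injEq]

/-- Floors are monotone, so the sequences compare pointwise, hence lexicographically. This is what
places a cell before its descendants, whose corners lie to the upper right of its own. -/
theorem zseq_mono {x y x' y' : ℝ} (hx : x ≤ x') (hy : y ≤ y') : zseq x y ≤ zseq x' y' := by
  refine Pi.toLex_monotone fun i => Prod.Lex.toLex_mono ⟨?_, ?_⟩
  · exact Int.floor_mono (by gcongr)
  · exact Int.floor_mono (by gcongr)

theorem zseq_lt {x y x' y' : ℝ} {d : ℕ}
    (h : ∀ i < d, ⌊x * 2 ^ i⌋ = ⌊x' * 2 ^ i⌋ ∧ ⌊y * 2 ^ i⌋ = ⌊y' * 2 ^ i⌋)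
    (hd : ⌊x * 2 ^ d⌋ < ⌊x' * 2 ^ d⌋ ∨
      ⌊x * 2 ^ d⌋ = ⌊x' * 2 ^ d⌋ ∧ ⌊y * 2 ^ d⌋ < ⌊y' * 2 ^ d⌋) :
    zseq x y < zseq x' y' :=
  ⟨d, fun i hi => zseq_apply_eq_iff.mpr (h i hi), Prod.Lex.lt_iff.mpr hd⟩

theorem zkey_lt_of_zseq_lt {x y x' y' : ℝ} {k k' : ℕ} (h : zseq x y < zseq x' y') :
    zkey x y k < zkey x' y' k' := Prod.Lex.lt_iff.mpr (Or.inl h)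

/-- Points of a lexicographically ordered interval share the common prefix of its endpoints. -/
theorem lex_between_apply_eq {α : Type*} [LinearOrder α] {a b c : Lex (ℕ → α)} {k : ℕ}
    (hab : a ≤ b) (hbc : b ≤ c) (h : ∀ i ≤ k, a i = c i) : ∀ i ≤ k, a i = b i := by
  rcases hab.eq_or_lt with rfl | ⟨p, hp, hp'⟩
  · exact fun _ _ => rfl
  have hp' : a p < b p := hp'
  intro i hi
  by_contra hne
  have hpi : p ≤ i := by
    by_contra hlt
    exact hne (hp i (by omega))
  rcases hbc.eq_or_lt with rfl | ⟨q, hq, hq'⟩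
  · exact hne (h i hi)
  have hq' : b q < c q := hq'
  rcases lt_or_ge q p with hqp | hqp
  · have h1 : a q = b q := hp q hqp
    have h2 := h q (by omega)
    rw [← h1, h2] at hq'
    exact lt_irrefl _ hq'
  · have h2 := h p (by omega)
    rcases hqp.eq_or_lt with rfl | hlt
    · rw [← h2] at hq'
      exact lt_asymm hp' hq'
    · have h1 : b p = c p := hq p hlt
      rw [← h1] at h2
      exact hp'.ne h2

/-- The comparison of two cells (corner and level), by means of `bitDiff`. -/
def Zle (x y : ℝ) (k : ℕ) (x' y' : ℝ) (k' : ℕ) : Prop :=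
  if bitDiff x x' = 0 then
    if bitDiff y y' = 0 then k < k' + 1 else y ≤ y'
  else
    if bitDiff y y' = 0 then x ≤ x' else
      if bitDiff x x' < bitDiff y y' + 1 then x ≤ x' else y ≤ y'

theorem lt_iff_floor_lt {x y : ℝ} {d : ℕ} (h : ⌊x * 2 ^ d⌋ ≠ ⌊y * 2 ^ d⌋) :
    (⌊x * 2 ^ d⌋ < ⌊y * 2 ^ d⌋ ∧ x ≤ y) ∨ (⌊y * 2 ^ d⌋ < ⌊x * 2 ^ d⌋ ∧ ¬ x ≤ y) := by
  rcases le_or_gt x y with hxy | hxy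
  · have : ⌊x * 2 ^ d⌋ ≤ ⌊y * 2 ^ d⌋ := Int.floor_mono (by gcongr)
    exact Or.inl ⟨lt_of_le_of_ne this h, hxy⟩
  · have : ⌊y * 2 ^ d⌋ ≤ ⌊x * 2 ^ d⌋ := Int.floor_mono (by gcongr)
    exact Or.inr ⟨lt_of_le_of_ne this h.symm, hxy.not_ge⟩

/-- With equal integer parts, `bitDiff` is the first grid level at which a coordinate separates the
points. The smaller of the two positions is where the cell sequences first differ; on a tie `x`
decides, since pairs are ordered lexicographically. At that level the floors are ordered like the
numbers themselves. -/
theorem zle_iff {x y x' y' : ℝ} {k k' : ℕ} (hx : ⌊x⌋ = ⌊x'⌋) (hy : ⌊y⌋ = ⌊y'⌋) :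
    Zle x y k x' y' k' ↔ zkey x y k ≤ zkey x' y' k' := by
  have caseX : bitDiff x x' ≠ 0 → (bitDiff y y' = 0 ∨ bitDiff x x' ≤ bitDiff y y') →
      (x ≤ x' ↔ zkey x y k ≤ zkey x' y' k') := by
    intro h1 h2
    have hag : ∀ i < bitDiff x x', ⌊x * 2 ^ i⌋ = ⌊x' * 2 ^ i⌋ ∧ ⌊y * 2 ^ i⌋ = ⌊y' * 2 ^ i⌋ := by
      intro i hi
      refine ⟨floor_eq_of_lt_bitDiff hx hi, ?_⟩
      rcases h2 with h2 | h2
      · rw [eq_of_bitDiff_eq_zero hy h2]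
      · exact floor_eq_of_lt_bitDiff hy (by omega)
    rcases lt_iff_floor_lt (floor_ne_of_bitDiff hx h1) with ⟨h3, h4⟩ | ⟨h3, h4⟩
    · exact ⟨fun _ => (zkey_lt_of_zseq_lt (zseq_lt hag (Or.inl h3))).le, fun _ => h4⟩
    · refine ⟨fun h => absurd h h4, fun h => absurd h (not_le.mpr ?_)⟩
      exact zkey_lt_of_zseq_lt (zseq_lt (fun i hi => ⟨(hag i hi).1.symm, (hag i hi).2.symm⟩)
        (Or.inl h3))
  have caseY : bitDiff y y' ≠ 0 → (bitDiff x x' = 0 ∨ bitDiff y y' < bitDiff x x') →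
      (y ≤ y' ↔ zkey x y k ≤ zkey x' y' k') := by
    intro h1 h2
    have hxd : ∀ i ≤ bitDiff y y', ⌊x * 2 ^ i⌋ = ⌊x' * 2 ^ i⌋ := by
      intro i hi
      rcases h2 with h2 | h2
      · rw [eq_of_bitDiff_eq_zero hx h2]
      · exact floor_eq_of_lt_bitDiff hx (by omega)
    have hag : ∀ i < bitDiff y y', ⌊x * 2 ^ i⌋ = ⌊x' * 2 ^ i⌋ ∧ ⌊y * 2 ^ i⌋ = ⌊y' * 2 ^ i⌋ :=
      fun i hi => ⟨hxd i hi.le, floor_eq_of_lt_bitDiff hy hi⟩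
    rcases lt_iff_floor_lt (floor_ne_of_bitDiff hy h1) with ⟨h3, h4⟩ | ⟨h3, h4⟩
    · exact ⟨fun _ => (zkey_lt_of_zseq_lt (zseq_lt hag (Or.inr ⟨hxd _ le_rfl, h3⟩))).le,
        fun _ => h4⟩
    · refine ⟨fun h => absurd h h4, fun h => absurd h (not_le.mpr ?_)⟩
      exact zkey_lt_of_zseq_lt (zseq_lt (fun i hi => ⟨(hag i hi).1.symm, (hag i hi).2.symm⟩)
        (Or.inr ⟨(hxd _ le_rfl).symm, h3⟩))
  unfold Zle
  split_ifs with h1 h2 h3 h4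
  · rw [eq_of_bitDiff_eq_zero hx h1, eq_of_bitDiff_eq_zero hy h2]
    simp only [zkey, Prod.Lex.le_iff, ofLex_toLex, true_and, Nat.lt_succ_iff]
    exact ⟨Or.inr, fun h => h.resolve_left (lt_irrefl _)⟩
  · exact caseY h2 (Or.inl h1)
  · exact caseX h1 (Or.inl h3)
  · exact caseX h1 (Or.inr (by omega))
  · exact caseY h3 (Or.inr (by omega))

end UnitRAM

/-! ## Quadtree cells around segments -/

namespace UnitRAM

/-- A finite family of segments in coordinates. -/
structure SegData where
  n : ℕ
  px : ℕ → ℝ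
  py : ℕ → ℝ
  qx : ℕ → ℝ
  qy : ℕ → ℝ

namespace SegData

variable (D : SegData)

/-- The length of a segment. -/
noncomputable def len (j : ℕ) : ℝ := Real.sqrt ((D.qx j - D.px j) ^ 2 + (D.qy j - D.py j) ^ 2)

/-- The segment `j` meets the disc with centre `(cx, cy)` and radius `r`. -/
def Meets (j : ℕ) (cx cy r : ℝ) : Prop :=
  ∃ t : ℝ, 0 ≤ t ∧ t ≤ 1 ∧ (D.px j + t * (D.qx j - D.px j) - cx) ^ 2 +
    (D.py j + t * (D.qy j - D.py j) - cy) ^ 2 ≤ r ^ 2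

open Classical in
/-- The number of segments that are at least as long as `r` and meet the disc. -/
noncomputable def count (cx cy r : ℝ) : ℕ :=
  ((Finset.range D.n).filter fun j => r ≤ D.len j ∧ D.Meets j cx cy r).card

/-- All segments are nondegenerate and lie in a small square about `(1/2, 1/2)`. -/
structure Small : Prop where
  px : ∀ j < D.n, |D.px j - 1 / 2| ≤ 1 / 256
  py : ∀ j < D.n, |D.py j - 1 / 2| ≤ 1 / 256
  qx : ∀ j < D.n, |D.qx j - 1 / 2| ≤ 1 / 256
  qy : ∀ j < D.n, |D.qy j - 1 / 2| ≤ 1 / 256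
  len : ∀ j < D.n, 0 < D.len j

/-- The grid level of a segment. -/
noncomputable def lev (j : ℕ) : ℕ := bitDiff (D.len j) 0

/-- The number of cells. -/
def size : ℕ := 121 * D.n

/-- The segment to which a cell belongs. -/
def own (u : ℕ) : ℕ := u / 121

/-- The level of a cell. -/
noncomputable def level (u : ℕ) : ℕ := D.lev (own u)

/-- The corner of a cell. -/
noncomputable def cornerX (u : ℕ) : ℝ :=
  (⌊D.px (own u) * 2 ^ D.level u⌋ + ((u - own u * 121) / 11 : ℕ) - 5) / 2 ^ D.level u

/-- The corner of a cell. -/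
noncomputable def cornerY (u : ℕ) : ℝ :=
  (⌊D.py (own u) * 2 ^ D.level u⌋ +
    (u - own u * 121 - (u - own u * 121) / 11 * 11 : ℕ) - 5) / 2 ^ D.level u

/-- The side length of a cell. -/
noncomputable def width (u : ℕ) : ℝ := 1 / 2 ^ D.level u

/-- One cell contains another. -/
def Contains (u v : ℕ) : Prop :=
  D.level u < D.level v + 1 ∧ D.cornerX u ≤ D.cornerX v ∧ ¬ D.cornerX u + D.width u ≤ D.cornerX v ∧
    D.cornerY u ≤ D.cornerY v ∧ ¬ D.cornerY u + D.width u ≤ D.cornerY v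

/-- The order in which the cells are processed. -/
def Le (u v : ℕ) : Prop :=
  Zle (D.cornerX u) (D.cornerY u) (D.level u) (D.cornerX v) (D.cornerY v) (D.level v)

/-- The segment `j` comes close to the cell `u`. -/
def Near (u j : ℕ) : Prop :=
  D.Meets j (D.cornerX u + D.width u / 2) (D.cornerY u + D.width u / 2) (3 * D.width u)

/-- The radius of a candidate disc of a cell. -/
noncomputable def candRadius (u c : ℕ) : ℝ :=
  ((64 + (c - c / 64 * 64) : ℕ) : ℝ) / 64 * D.width u

/-- The centre of a candidate disc of a cell. -/
noncomputable def candX (u c : ℕ) : ℝ :=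
  D.cornerX u + (((c / 64 - c / 8192 * 128 : ℕ) : ℝ) - 32) / 64 * D.width u

/-- The centre of a candidate disc of a cell. -/
noncomputable def candY (u c : ℕ) : ℝ :=
  D.cornerY u + (((c / 8192 : ℕ) : ℝ) - 32) / 64 * D.width u

/-- The segment `j` counts for the candidate disc `c` of the cell `u`. -/
def Hit (u c j : ℕ) : Prop :=
  D.candRadius u c ≤ D.len j ∧ D.Meets j (D.candX u c) (D.candY u c) (D.candRadius u c)

variable {D}

theorem width_pos (u : ℕ) : 0 < D.width u := by unfold width; positivity

theorem own_lt {u : ℕ} (hu : u < D.size) : own u < D.n := by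
  unfold size at hu; unfold own; omega

theorem len_sq (j : ℕ) : D.len j ^ 2 = (D.qx j - D.px j) ^ 2 + (D.qy j - D.py j) ^ 2 :=
  Real.sq_sqrt (by positivity)

theorem Small.len_lt (h : D.Small) {j : ℕ} (hj : j < D.n) : D.len j < 1 / 64 := by
  have h1 := abs_le.mp (h.px j hj)
  have h2 := abs_le.mp (h.py j hj)
  have h3 := abs_le.mp (h.qx j hj)
  have h4 := abs_le.mp (h.qy j hj)
  have e1 : (D.qx j - D.px j) ^ 2 ≤ (1 / 128) ^ 2 := sq_le_sq' (by linarith) (by linarith)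
  have e2 : (D.qy j - D.py j) ^ 2 ≤ (1 / 128) ^ 2 := sq_le_sq' (by linarith) (by linarith)
  refine lt_of_pow_lt_pow_left₀ 2 (by norm_num) ?_
  rw [len_sq]; linarith

theorem Small.lev_bounds (h : D.Small) {j : ℕ} (hj : j < D.n) :
    1 / 2 ^ D.lev j ≤ D.len j ∧ D.len j < 2 * (1 / 2 ^ D.lev j) :=
  (bitDiff_zero_bounds (h.len j hj) ((h.len_lt hj).trans (by norm_num))).2

theorem Small.lev_le_of_len (h : D.Small) {j : ℕ} (hj : j < D.n) {k : ℕ}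
    (hk : 1 / 2 ^ k ≤ D.len j) : D.lev j ≤ k := by
  have h1 := (h.lev_bounds hj).2
  by_contra hlt
  have h2 : (2 : ℝ) ^ (k + 1) ≤ 2 ^ D.lev j := pow_le_pow_right₀ (by norm_num) (by omega)
  have h3 : (1 : ℝ) / 2 ^ D.lev j ≤ 1 / 2 ^ (k + 1) := by gcongr
  have h4 : (2 : ℝ) * (1 / 2 ^ (k + 1)) = 1 / 2 ^ k := by rw [pow_succ]; field_simp
  linarith

theorem Small.lev_le_lev (h : D.Small) {i j : ℕ} (hi : i < D.n) (hj : j < D.n)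
    (hij : D.len i ≤ D.len j) : D.lev j ≤ D.lev i :=
  h.lev_le_of_len hj ((h.lev_bounds hi).1.trans hij)

theorem cornerX_mul (u : ℕ) : D.cornerX u * 2 ^ D.level u =
    ((⌊D.px (own u) * 2 ^ D.level u⌋ + ((u - own u * 121) / 11 : ℕ) - 5 : ℤ) : ℝ) := by
  rw [cornerX, div_mul_cancel₀ _ (by positivity), Int.cast_sub, Int.cast_add, Int.cast_natCast,
    Int.cast_ofNat]

theorem cornerY_mul (u : ℕ) : D.cornerY u * 2 ^ D.level u =
    ((⌊D.py (own u) * 2 ^ D.level u⌋ +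
      (u - own u * 121 - (u - own u * 121) / 11 * 11 : ℕ) - 5 : ℤ) : ℝ) := by
  rw [cornerY, div_mul_cancel₀ _ (by positivity), Int.cast_sub, Int.cast_add, Int.cast_natCast,
    Int.cast_ofNat]

/-- Corners shifted by a few cells stay inside the unit square. -/
theorem corner_floor_zero {p w : ℝ} {k : ℕ} {e : ℕ} (hp : |p - 1 / 2| ≤ 1 / 256)
    (hw : 1 / 2 ^ k < (1 : ℝ) / 64) (he : e ≤ 10)
    (hw' : w = (⌊p * 2 ^ k⌋ + (e : ℝ) - 5) / 2 ^ k) : ⌊w⌋ = 0 := by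
  have h1 := Int.floor_le (p * 2 ^ k)
  have h2 := Int.lt_floor_add_one (p * 2 ^ k)
  have h3 := abs_le.mp hp
  have hk : (0 : ℝ) < 2 ^ k := by positivity
  have h4 : (64 : ℝ) < 2 ^ k := by
    rw [div_lt_div_iff₀ hk (by norm_num)] at hw; linarith
  have h5 : (e : ℝ) ≤ 10 := by exact_mod_cast he
  have h6 : (0 : ℝ) ≤ e := Nat.cast_nonneg e
  rw [Int.floor_eq_zero_iff, hw']
  constructor
  · apply div_nonneg _ hk.le
    nlinarith
  · rw [div_lt_one hk]
    nlinarith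

/-- Integer parts that all vanish make `zle_iff` applicable to any two cells. -/
theorem Small.floor_cornerX (h : D.Small) {u : ℕ} (hu : u < D.size) : ⌊D.cornerX u⌋ = 0 :=
  corner_floor_zero (h.px _ (own_lt hu))
    ((h.lev_bounds (own_lt hu)).1.trans_lt (h.len_lt (own_lt hu))) (by unfold own; omega) rfl

theorem Small.floor_cornerY (h : D.Small) {u : ℕ} (hu : u < D.size) : ⌊D.cornerY u⌋ = 0 :=
  corner_floor_zero (h.py _ (own_lt hu))
    ((h.lev_bounds (own_lt hu)).1.trans_lt (h.len_lt (own_lt hu))) (by unfold own; omega) rfl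

theorem Small.le_iff (h : D.Small) {u v : ℕ} (hu : u < D.size) (hv : v < D.size) : D.Le u v ↔
    zkey (D.cornerX u) (D.cornerY u) (D.level u) ≤
      zkey (D.cornerX v) (D.cornerY v) (D.level v) :=
  zle_iff (by rw [h.floor_cornerX hu, h.floor_cornerX hv])
    (by rw [h.floor_cornerY hu, h.floor_cornerY hv])

/-- A number lies in the cell of width `2⁻ᵏ` with corner `x` iff it rounds to the same grid point. -/
theorem floor_eq_of_mem_cell {x y w : ℝ} {k : ℕ} (hw : w = 1 / 2 ^ k) {a : ℤ}
    (hx : x * 2 ^ k = a) : ⌊y * 2 ^ k⌋ = ⌊x * 2 ^ k⌋ ↔ x ≤ y ∧ ¬ x + w ≤ y := by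
  have hk : (0 : ℝ) < 2 ^ k := by positivity
  rw [hx, Int.floor_intCast, Int.floor_eq_iff, ← hx, not_le]
  have h1 : x * 2 ^ k + 1 = (x + w) * 2 ^ k := by rw [hw]; field_simp
  rw [h1, mul_le_mul_iff_left₀ hk, mul_lt_mul_iff_left₀ hk]

theorem floor_eq_of_floor_eq {x y : ℝ} {i k : ℕ} (hik : i ≤ k)
    (h : ⌊x * 2 ^ k⌋ = ⌊y * 2 ^ k⌋) : ⌊x * 2 ^ i⌋ = ⌊y * 2 ^ i⌋ := by
  obtain ⟨d, rfl⟩ := Nat.exists_eq_add_of_le hik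
  induction d with
  | zero => simpa using h
  | succ d ih =>
    refine ih (by omega) ?_
    rw [← add_assoc, floor_mul_two_pow_succ, floor_mul_two_pow_succ] at h
    unfold bit at h
    omega

/-- Containment becomes a common prefix: the corner of `v` lies in `u` exactly if both corners round
to the same grid point at the level of `u`, and agreement at one level forces agreement at all
coarser ones. -/
theorem contains_iff {u v : ℕ} : D.Contains u v ↔ D.level u ≤ D.level v ∧
    ∀ i ≤ D.level u, zseq (D.cornerX u) (D.cornerY u) i = zseq (D.cornerX v) (D.cornerY v) i := by
  unfold Contains
  rw [Nat.lt_succ_iff]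
  refine and_congr_right fun _ => ?_
  rw [← and_assoc, ← floor_eq_of_mem_cell (w := D.width u) rfl (cornerX_mul u),
    ← floor_eq_of_mem_cell (w := D.width u) rfl (cornerY_mul u)]
  constructor
  · rintro ⟨h1, h2⟩ i hi
    exact zseq_apply_eq_iff.mpr ⟨floor_eq_of_floor_eq hi h1.symm, floor_eq_of_floor_eq hi h2.symm⟩
  · intro h
    have := zseq_apply_eq_iff.mp (h _ le_rfl)
    exact ⟨this.1.symm, this.2.symm⟩

theorem Contains.trans {u v w : ℕ} (h : D.Contains u v) (h' : D.Contains v w) :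
    D.Contains u w := by
  rw [contains_iff] at *
  exact ⟨h.1.trans h'.1, fun i hi => (h.2 i hi).trans (h'.2 i (hi.trans h.1))⟩

theorem Small.le_of_contains (h : D.Small) {u v : ℕ} (hu : u < D.size) (hv : v < D.size)
    (hc : D.Contains u v) : D.Le u v := by
  rw [h.le_iff hu hv, zkey, zkey, Prod.Lex.le_iff]
  rcases (zseq_mono hc.2.1 hc.2.2.2.1).lt_or_eq with h1 | h1
  · exact Or.inl h1
  · exact Or.inr ⟨h1, Nat.lt_succ_iff.mp hc.1⟩

theorem zseq_le_of_zkey_le {x y x' y' : ℝ} {k k' : ℕ} (h : zkey x y k ≤ zkey x' y' k') :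
    zseq x y ≤ zseq x' y' := by
  rw [zkey, zkey, Prod.Lex.le_iff] at h
  rcases h with h | h
  · exact le_of_lt h
  · exact h.1.le

theorem corner_eq_of_zseq {u v : ℕ} (hk : D.level u = D.level v)
    (h : zseq (D.cornerX u) (D.cornerY u) (D.level u) =
      zseq (D.cornerX v) (D.cornerY v) (D.level u)) :
    D.cornerX u = D.cornerX v ∧ D.cornerY u = D.cornerY v := by
  obtain ⟨h1, h2⟩ := zseq_apply_eq_iff.mp h
  have hp : (2 : ℝ) ^ D.level u ≠ 0 := by positivity
  have a1 := cornerX_mul (D := D) u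
  have a2 := cornerX_mul (D := D) v
  have b1 := cornerY_mul (D := D) u
  have b2 := cornerY_mul (D := D) v
  rw [← hk] at a2 b2
  rw [a1, a2, Int.floor_intCast, Int.floor_intCast] at h1
  rw [b1, b2, Int.floor_intCast, Int.floor_intCast] at h2
  constructor
  · apply mul_right_cancel₀ hp; rw [a1, a2, h1]
  · apply mul_right_cancel₀ hp; rw [b1, b2, h2]

/-- The descendants of a cell are consecutive. -/
theorem Small.contains_between (h : D.Small) {u v w : ℕ} (hu : u < D.size) (hv : v < D.size)
    (hw : w < D.size) (huv : D.Le u v) (hvw : D.Le v w) (hc : D.Contains u w) :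
    D.Contains u v := by
  rw [h.le_iff hu hv] at huv
  rw [h.le_iff hv hw] at hvw
  rw [contains_iff] at hc ⊢
  have hs := lex_between_apply_eq (zseq_le_of_zkey_le huv) (zseq_le_of_zkey_le hvw) hc.2
  refine ⟨?_, hs⟩
  -- If `v` were coarser than `u`, the shared prefix would put the corner of `u` inside `v`, so the
  -- sequence of `v` would be at most that of `u`. Then `Le u v` could hold only through the tie on
  -- levels, which goes the wrong way.
  by_contra hlt
  rw [not_le] at hlt
  have hx : D.cornerX v ≤ D.cornerX u ∧ D.cornerY v ≤ D.cornerY u := by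
    have h1 := zseq_apply_eq_iff.mp (hs _ hlt.le)
    have h2 := (floor_eq_of_mem_cell rfl (cornerX_mul v)).mp h1.1
    have h3 := (floor_eq_of_mem_cell rfl (cornerY_mul v)).mp h1.2
    exact ⟨h2.1, h3.1⟩
  have h4 := zseq_mono hx.1 hx.2
  rw [zkey, zkey, Prod.Lex.le_iff] at huv
  rcases huv with h5 | h5
  · exact absurd h5 (not_lt.mpr h4)
  · exact absurd h5.2 (not_le.mpr hlt)

/-- Several segments may own the same dyadic cell, and such copies are tied in the order. A
containing cell that comes later can only be a copy, because then the keys compare both ways. -/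
theorem Small.eq_of_contains_of_le (h : D.Small) {u v : ℕ} (hu : u < D.size) (hv : v < D.size)
    (hc : D.Contains u v) (hle : D.Le v u) :
    D.level u = D.level v ∧ D.cornerX u = D.cornerX v ∧ D.cornerY u = D.cornerY v := by
  have h1 := h.le_of_contains hu hv hc
  rw [h.le_iff hu hv] at h1
  rw [h.le_iff hv hu] at hle
  have h2 := le_antisymm h1 hle
  have h3 : (zseq (D.cornerX u) (D.cornerY u), D.level u) =
    (zseq (D.cornerX v) (D.cornerY v), D.level v) := toLex_inj.mp h2
  rw [Prod.mk.injEq] at h3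
  exact ⟨h3.2, corner_eq_of_zseq h3.2 (by rw [h3.1])⟩

/-- A segment has at most one cell that contains a given cell. -/
theorem eq_of_own_eq {u v w : ℕ} (hu : D.Contains u w) (hv : D.Contains v w)
    (ho : own u = own v) : u = v := by
  have hk : D.level u = D.level v := by unfold level; rw [ho]
  rw [contains_iff] at hu hv
  have h1 := (hu.2 _ le_rfl).trans (hv.2 _ hk.le).symm
  obtain ⟨h2, h3⟩ := corner_eq_of_zseq hk h1
  have a1 := cornerX_mul (D := D) u
  have a2 := cornerX_mul (D := D) v
  have b1 := cornerY_mul (D := D) u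
  have b2 := cornerY_mul (D := D) v
  rw [h2, hk, a2, Int.cast_inj, ho] at a1
  rw [h3, hk, b2, Int.cast_inj, ho] at b1
  unfold own at *
  omega

/-! ### Metric estimates for cells, segments and covering discs -/

theorem Meets.dist_p {j : ℕ} {cx cy r : ℝ} (h : D.Meets j cx cy r) (hr : 0 ≤ r) :
    |D.px j - cx| ≤ r + D.len j ∧ |D.py j - cy| ≤ r + D.len j := by
  obtain ⟨t, h0, h1, h2⟩ := h
  have hl : 0 ≤ D.len j := Real.sqrt_nonneg _
  have e1 : |D.qx j - D.px j| ≤ D.len j :=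
    abs_le_of_sq_le_sq (by rw [len_sq]; nlinarith [sq_nonneg (D.qy j - D.py j)]) hl
  have e2 : |D.qy j - D.py j| ≤ D.len j :=
    abs_le_of_sq_le_sq (by rw [len_sq]; nlinarith [sq_nonneg (D.qx j - D.px j)]) hl
  have f1 : |D.px j + t * (D.qx j - D.px j) - cx| ≤ r :=
    abs_le_of_sq_le_sq (by nlinarith [sq_nonneg (D.py j + t * (D.qy j - D.py j) - cy)]) hr
  have f2 : |D.py j + t * (D.qy j - D.py j) - cy| ≤ r :=
    abs_le_of_sq_le_sq (by nlinarith [sq_nonneg (D.px j + t * (D.qx j - D.px j) - cx)]) hr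
  rw [abs_le] at e1 e2 f1 f2
  constructor <;> rw [abs_le] <;> constructor <;> nlinarith

/-- In one coordinate: the cell of level `k` above a cell of level `k0` that lies close to `p`
is one of the eleven cells around the one of `p`. -/
theorem exists_offset {p c : ℝ} {k k0 : ℕ} (hk : k ≤ k0) {a0 : ℤ} (hc : c = a0 / 2 ^ k0)
    (hp : |p - (c + 1 / 2 ^ k0 / 2)| < 5 * (1 / 2 ^ k)) :
    ∃ e : ℕ, e ≤ 10 ∧ (⌊p * 2 ^ k⌋ + (e : ℝ) - 5) / 2 ^ k ≤ c ∧
      ¬ (⌊p * 2 ^ k⌋ + (e : ℝ) - 5) / 2 ^ k + 1 / 2 ^ k ≤ c := by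
  obtain ⟨d, rfl⟩ := Nat.exists_eq_add_of_le hk
  have hk0 : (0 : ℝ) < 2 ^ k := by positivity
  have hd0 : (0 : ℝ) < 2 ^ d := by positivity
  set P : ℝ := p * 2 ^ k with hP
  set A : ℤ := ⌊c * 2 ^ k⌋ with hA
  have hA1 : (A : ℝ) ≤ c * 2 ^ k := Int.floor_le _
  have hA2 : c * 2 ^ k < A + 1 := Int.lt_floor_add_one _
  have hP1 : (⌊P⌋ : ℝ) ≤ P := Int.floor_le _
  have hP2 : P < ⌊P⌋ + 1 := Int.lt_floor_add_one _
  have hcd : c * 2 ^ k * 2 ^ d = a0 := by rw [hc, pow_add]; field_simp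
  -- The fine cell does not stick out of the coarse one, because a strict inequality between
  -- integers leaves room for 1. Hence its centre lies in the coarse cell.
  have hA3 : c * 2 ^ k + 1 / 2 ^ d ≤ A + 1 := by
    have h1 : (a0 : ℝ) < (A + 1) * 2 ^ d := by rw [← hcd]; gcongr
    have h2 : a0 + 1 ≤ (A + 1) * 2 ^ d := by
      have : a0 < (A + 1) * 2 ^ d := by exact_mod_cast h1
      omega
    have h3 : (a0 : ℝ) + 1 ≤ (A + 1) * 2 ^ d := by exact_mod_cast h2
    rw [← hcd] at h3
    have h4 : (c * 2 ^ k + 1 / 2 ^ d) * 2 ^ d ≤ (A + 1) * 2 ^ d := by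
      have : (c * 2 ^ k + 1 / 2 ^ d) * 2 ^ d = c * 2 ^ k * 2 ^ d + 1 := by field_simp
      rw [this]; exact h3
    exact le_of_mul_le_mul_right h4 hd0
  have hd1 : (0 : ℝ) < 1 / 2 ^ d := by positivity
  have hq : |P - (c * 2 ^ k + 1 / 2 ^ d / 2)| < 5 := by
    have : P - (c * 2 ^ k + 1 / 2 ^ d / 2) = (p - (c + 1 / 2 ^ (k + d) / 2)) * 2 ^ k := by
      rw [hP, pow_add]; field_simp
    rw [this, abs_mul, abs_of_pos hk0]
    refine (mul_lt_mul_of_pos_right hp hk0).trans_eq ?_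
    rw [mul_assoc, one_div, inv_mul_cancel₀ hk0.ne', mul_one]
  rw [abs_lt] at hq
  -- `P` and the rescaled centre differ by less than 5, and each exceeds its grid point by less than
  -- 1. So the grid points differ by less than 6, that is by at most 5: eleven offsets.
  have r1 : ⌊P⌋ - 5 ≤ A := by
    have : (⌊P⌋ : ℝ) < A + 6 := by linarith
    have : ⌊P⌋ < A + 6 := by exact_mod_cast this
    omega
  have r2 : A ≤ ⌊P⌋ + 5 := by
    have : (A : ℝ) < ⌊P⌋ + 6 := by linarith
    have : A < ⌊P⌋ + 6 := by exact_mod_cast this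
    omega
  obtain ⟨e, he⟩ := Int.eq_ofNat_of_zero_le (show 0 ≤ A - ⌊P⌋ + 5 by omega)
  have he' : (⌊P⌋ : ℝ) + e - 5 = A := by
    have : ⌊P⌋ + (e : ℤ) - 5 = A := by omega
    exact_mod_cast this
  refine ⟨e, by omega, ?_, ?_⟩
  · rw [he', div_le_iff₀ hk0]; exact hA1
  · rw [he', not_le, ← add_div, lt_div_iff₀ hk0]; exact hA2

/-- A segment that comes close to a cell of its own level or deeper has a cell containing it. -/
theorem Small.exists_cell (h : D.Small) {j k0 : ℕ} (hj : j < D.n) (hk : D.lev j ≤ k0)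
    {a0 b0 : ℤ} {x y : ℝ} (hx : x = a0 / 2 ^ k0) (hy : y = b0 / 2 ^ k0)
    (hm : D.Meets j (x + 1 / 2 ^ k0 / 2) (y + 1 / 2 ^ k0 / 2) (3 * (1 / 2 ^ k0))) :
    ∃ u < D.size, own u = j ∧ D.level u = D.lev j ∧
      D.cornerX u ≤ x ∧ ¬ D.cornerX u + D.width u ≤ x ∧
      D.cornerY u ≤ y ∧ ¬ D.cornerY u + D.width u ≤ y := by
  -- In each coordinate the endpoint is at most `3 · 2⁻ᵏ⁰ + len` from the centre, and this is below
  -- `(3 + 2) · 2⁻ᵏ` for `k = D.lev j`: the 5 required by `exists_offset`.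
  obtain ⟨d1, d2⟩ := hm.dist_p (by positivity)
  have hl := (h.lev_bounds hj).2
  have hw : (1 : ℝ) / 2 ^ k0 ≤ 1 / 2 ^ D.lev j := by gcongr; norm_num
  obtain ⟨e, he, e1, e2⟩ := exists_offset hk hx (d1.trans_lt (by linarith))
  obtain ⟨f, hf, f1, f2⟩ := exists_offset hk hy (d2.trans_lt (by linarith))
  have ho : own (j * 121 + (e * 11 + f)) = j := by unfold own; omega
  have hlv : D.level (j * 121 + (e * 11 + f)) = D.lev j := by rw [level, ho]
  have he' : (j * 121 + (e * 11 + f) - j * 121) / 11 = e := by omega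
  have hX : D.cornerX (j * 121 + (e * 11 + f)) =
      (⌊D.px j * 2 ^ D.lev j⌋ + (e : ℝ) - 5) / 2 ^ D.lev j := by
    rw [cornerX, hlv, ho, he']
  have hY : D.cornerY (j * 121 + (e * 11 + f)) =
      (⌊D.py j * 2 ^ D.lev j⌋ + (f : ℝ) - 5) / 2 ^ D.lev j := by
    rw [cornerY, hlv, ho, he']
    congr 4
    omega
  have hW : D.width (j * 121 + (e * 11 + f)) = 1 / 2 ^ D.lev j := by rw [width, hlv]
  refine ⟨j * 121 + (e * 11 + f), by unfold size; omega, ho, hlv, ?_⟩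
  rw [hX, hY, hW]
  exact ⟨e1, e2, f1, f2⟩

/-- The triangle inequality in the plane in polynomial form, by Cauchy–Schwarz. -/
theorem add_sq_add_add_sq_le {x y a b r s : ℝ} (hr : 0 ≤ r) (hs : 0 ≤ s)
    (h : x ^ 2 + y ^ 2 ≤ r ^ 2) (h' : a ^ 2 + b ^ 2 ≤ s ^ 2) :
    (x + a) ^ 2 + (y + b) ^ 2 ≤ (r + s) ^ 2 := by
  have h1 : x * a + y * b ≤ r * s := by
    refine le_of_abs_le (abs_le_of_sq_le_sq ?_ (by positivity))
    calc (x * a + y * b) ^ 2 ≤ (x ^ 2 + y ^ 2) * (a ^ 2 + b ^ 2) := by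
          nlinarith [sq_nonneg (x * b - y * a)]
      _ ≤ r ^ 2 * s ^ 2 := by gcongr
      _ = (r * s) ^ 2 := by ring
  nlinarith

theorem Meets.mono {j : ℕ} {cx cy r cx' cy' R s : ℝ} (h : D.Meets j cx cy r) (hr : 0 ≤ r)
    (hs : 0 ≤ s) (hc : (cx - cx') ^ 2 + (cy - cy') ^ 2 ≤ s ^ 2) (hR : r + s ≤ R) :
    D.Meets j cx' cy' R := by
  obtain ⟨t, h0, h1, h2⟩ := h
  refine ⟨t, h0, h1, ?_⟩
  have h3 := add_sq_add_add_sq_le hr hs h2 hc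
  have h4 : (r + s) ^ 2 ≤ R ^ 2 := by gcongr
  calc _ = _ := by ring
    _ ≤ _ := h3.trans h4

/-- In one coordinate: nested grid cells. -/
theorem add_width_le {x y w w' : ℝ} {k k' : ℕ} (hk : k ≤ k') (hw : w = 1 / 2 ^ k)
    (hw' : w' = 1 / 2 ^ k') {a b : ℤ} (hx : x * 2 ^ k = a) (hy : y * 2 ^ k' = b)
    (h : ¬ x + w ≤ y) : y + w' ≤ x + w := by
  rw [not_le] at h
  obtain ⟨d, rfl⟩ := Nat.exists_eq_add_of_le hk
  have hk0 : (0 : ℝ) < 2 ^ (k + d) := by positivity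
  have e1 : (x + w) * 2 ^ (k + d) = ((a + 1) * 2 ^ d : ℤ) := by
    push_cast; rw [← hx, hw, pow_add]; field_simp
  have e2 : (y + w') * 2 ^ (k + d) = (b + 1 : ℤ) := by
    push_cast; rw [← hy, hw']; field_simp
  have h1 : (b : ℝ) < ((a + 1) * 2 ^ d : ℤ) := by
    rw [← e1, ← hy]; gcongr
  have h2 : b + 1 ≤ (a + 1) * 2 ^ d := by exact_mod_cast h1
  refine le_of_mul_le_mul_right ?_ hk0
  rw [e1, e2]
  exact_mod_cast h2

/-- In each coordinate the centres of nested cells differ by at most half the difference of the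
widths, so the disc of radius three widths about the inner centre lies in that about the outer one.
This is why a list can be filtered from the list of a containing cell. -/
theorem Near.mono {u v j : ℕ} (hc : D.Contains u v) (h : D.Near v j) : D.Near u j := by
  have hk := Nat.lt_succ_iff.mp hc.1
  have hx := add_width_le hk rfl rfl (cornerX_mul u) (cornerX_mul v) hc.2.2.1
  have hy := add_width_le hk rfl rfl (cornerY_mul u) (cornerY_mul v) hc.2.2.2.2
  have hx1 := hc.2.1
  have hy1 := hc.2.2.2.1
  have hw : D.width v ≤ D.width u := by unfold width; gcongr; norm_num
  have hv := width_pos (D := D) v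
  change D.width v ≤ D.width u at hw
  change D.cornerX v + D.width v ≤ D.cornerX u + D.width u at hx
  change D.cornerY v + D.width v ≤ D.cornerY u + D.width u at hy
  refine Meets.mono (s := D.width u - D.width v) h (by positivity) (by linarith) ?_ (by linarith)
  have ex := sq_le_sq' (a := D.cornerX v + D.width v / 2 - (D.cornerX u + D.width u / 2))
    (b := (D.width u - D.width v) / 2) (by linarith) (by linarith)
  have ey := sq_le_sq' (a := D.cornerY v + D.width v / 2 - (D.cornerY u + D.width u / 2))
    (b := (D.width u - D.width v) / 2) (by linarith) (by linarith)
  nlinarith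

/-- Rounding to multiples of `w` errs by at most `w / 2` per coordinate, which keeps a point of the
plane within `w` of a grid point. Seven multiples per coordinate give the 49 discs of
`card_le_of_near`. -/
theorem exists_int_close {x c w : ℝ} (hw : 0 < w) (h : |x - c| ≤ 3 * w) :
    ∃ a ∈ Finset.Icc (-3 : ℤ) 3, (x - (c + a * w)) ^ 2 ≤ (w / 2) ^ 2 := by
  refine ⟨round ((x - c) / w), ?_, ?_⟩
  · rw [abs_le] at h
    have h1 : (x - c) / w ≤ 3 := by rw [div_le_iff₀ hw]; exact h.2
    have h2 : -3 ≤ (x - c) / w := by rw [le_div_iff₀ hw]; linarith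
    rw [Finset.mem_Icc, round_eq, Int.le_floor]
    refine ⟨by push_cast; linarith, ?_⟩
    have : ⌊(x - c) / w + 1 / 2⌋ < 4 := by rw [Int.floor_lt]; push_cast; linarith
    omega
  · have h1 := abs_sub_round ((x - c) / w)
    have h2 : x - (c + round ((x - c) / w) * w) = ((x - c) / w - round ((x - c) / w)) * w := by
      field_simp; ring
    rw [h2, ← sq_abs, abs_mul, abs_of_pos hw]
    have := mul_le_mul_of_nonneg_right h1 hw.le
    exact pow_le_pow_left₀ (by positivity) (by linarith) 2

/-- The long segments close to a cell are few. -/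
theorem card_le_of_near {L : ℕ} (hL : ∀ cx cy r, 0 < r → D.count cx cy r ≤ L) {u : ℕ}
    {s : Finset ℕ} (hs : ∀ j ∈ s, j < D.n ∧ D.width u ≤ D.len j ∧ D.Near u j) :
    s.card ≤ 49 * L := by
  classical
  have hw := width_pos (D := D) u
  set f : ℤ × ℤ → Finset ℕ := fun ab => (Finset.range D.n).filter fun j =>
    D.width u ≤ D.len j ∧ D.Meets j (D.cornerX u + D.width u / 2 + ab.1 * D.width u)
      (D.cornerY u + D.width u / 2 + ab.2 * D.width u) (D.width u) with hf
  have hsub : s ⊆ (Finset.Icc (-3 : ℤ) 3 ×ˢ Finset.Icc (-3 : ℤ) 3).biUnion f := by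
    intro j hj
    obtain ⟨h1, h2, t, h3, h4, h5⟩ := hs j hj
    obtain ⟨a, ha, ha'⟩ := exists_int_close (x := D.px j + t * (D.qx j - D.px j))
      (c := D.cornerX u + D.width u / 2) hw (abs_le_of_sq_le_sq
        (by nlinarith [sq_nonneg (D.py j + t * (D.qy j - D.py j) - (D.cornerY u + D.width u / 2))])
        (by positivity))
    obtain ⟨b, hb, hb'⟩ := exists_int_close (x := D.py j + t * (D.qy j - D.py j))
      (c := D.cornerY u + D.width u / 2) hw (abs_le_of_sq_le_sq
        (by nlinarith [sq_nonneg (D.px j + t * (D.qx j - D.px j) - (D.cornerX u + D.width u / 2))])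
        (by positivity))
    rw [Finset.mem_biUnion]
    refine ⟨(a, b), Finset.mem_product.mpr ⟨ha, hb⟩, ?_⟩
    rw [hf, Finset.mem_filter]
    exact ⟨Finset.mem_range.mpr h1, h2, t, h3, h4, by nlinarith⟩
  calc s.card ≤ _ := Finset.card_le_card hsub
    _ ≤ (Finset.Icc (-3 : ℤ) 3 ×ˢ Finset.Icc (-3 : ℤ) 3).card * L := by
        refine Finset.card_biUnion_le_card_mul _ _ _ fun ab _ => ?_
        have := hL (D.cornerX u + D.width u / 2 + ab.1 * D.width u)
          (D.cornerY u + D.width u / 2 + ab.2 * D.width u) (D.width u) hw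
        unfold count at this
        convert this
    _ = 49 * L := by simp

/-- The offsets of the three discs that cover a given disc. -/
theorem exists_offset_disc {x y d e r ρ : ℝ} (hr : 1 ≤ r) (hxy : x ^ 2 + y ^ 2 ≤ r ^ 2)
    (hd : 0 ≤ d) (hd' : d ≤ 1 / 64) (he : 0 ≤ e) (he' : e ≤ 1 / 64) (hρ : r - 1 / 64 ≤ ρ) :
    (x + d - 0) ^ 2 + (y + e - 1 / 2) ^ 2 ≤ ρ ^ 2 ∨
    (x + d - 7 / 16) ^ 2 + (y + e - (-1 / 4)) ^ 2 ≤ ρ ^ 2 ∨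
    (x + d - (-7 / 16)) ^ 2 + (y + e - (-1 / 4)) ^ 2 ≤ ρ ^ 2 := by
  have hs0 := Real.sqrt_nonneg (x ^ 2 + y ^ 2)
  have hs1 := Real.sq_sqrt (show 0 ≤ x ^ 2 + y ^ 2 by positivity)
  set s := Real.sqrt (x ^ 2 + y ^ 2) with hs
  have hsr : s ≤ r := le_of_sq_le_sq (by rw [hs1]; exact hxy) (by linarith)
  -- `65 / 256 = (7/16)² + (1/4)²` is the larger squared length of an offset. The margin `3/64 =
  -- 1/64 + 1/32` pays for rounding the radius and the centre.
  have hbig : s ^ 2 - s / 2 + 65 / 256 ≤ (r - 3 / 64) ^ 2 := by nlinarith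
  have fin : ∀ a b : ℝ, (x + a) ^ 2 + (y + b) ^ 2 ≤ (r - 3 / 64) ^ 2 →
      (x + a + d) ^ 2 + (y + b + e) ^ 2 ≤ ρ ^ 2 := by
    intro a b hab
    have h1 := add_sq_add_add_sq_le (s := 1 / 32) (a := d) (b := e) (by linarith) (by norm_num) hab
      (by nlinarith)
    have h2 : (r - 3 / 64 + 1 / 32) ^ 2 ≤ ρ ^ 2 := pow_le_pow_left₀ (by linarith) (by linarith) 2
    exact h1.trans h2
  have hy1 : -s ≤ y := by
    have := abs_le_of_sq_le_sq (show y ^ 2 ≤ s ^ 2 by nlinarith) hs0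
    exact (abs_le.mp this).1
  -- The three offsets nearly form an equilateral triangle of circumradius `1/2`, with `7/16` in
  -- place of `√3/4`. Every direction is within about 60° of one of them, which subtracts at least
  -- `s / 2` from the squared distance.
  rcases le_or_gt (s / 2) y with h1 | h1
  · left
    have := fin 0 (-1 / 2) (le_trans (by nlinarith) hbig)
    calc _ = _ := by ring
      _ ≤ _ := this
  -- Squaring and cancelling `s + y` leaves `65 y ≤ 33 s`, which follows from `y < s / 2`.
  · have key : ∀ z : ℝ, 0 ≤ z → z ^ 2 + y ^ 2 = s ^ 2 → 4 * (s + y) ≤ 7 * z := by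
      intro z hz hzy
      refine le_of_sq_le_sq ?_ (by linarith)
      nlinarith
    right
    rcases le_total 0 x with hx | hx
    · left
      have hk := key x hx (by linarith)
      have := fin (-7 / 16) (1 / 4) (le_trans (by nlinarith) hbig)
      calc _ = _ := by ring
        _ ≤ _ := this
    · right
      have hk := key (-x) (by linarith) (by linarith [neg_sq x])
      have := fin (7 / 16) (1 / 4) (le_trans (by nlinarith) hbig)
      calc _ = _ := by ring
        _ ≤ _ := this

end SegData

end UnitRAM

/-! ## Candidate discs suffice -/

namespace UnitRAM

namespace SegData

/-- The number of candidate discs of a cell. -/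
def candCount : ℕ := 1048576

variable (D : SegData)

/-- `g` enumerates the cells in the processing order. -/
structure Sorted (g : ℕ → ℕ) : Prop where
  lt : ∀ m < D.size, g m < D.size
  surj : ∀ u < D.size, ∃ m < D.size, g m = u
  inj : ∀ m < D.size, ∀ m' < D.size, g m = g m' → m = m'
  le : ∀ m m', m < m' → m' < D.size → D.Le (g m) (g m')

/-- The segment `j` belongs to the list of the cell `g m`. -/
def Listed (g : ℕ → ℕ) (m j : ℕ) : Prop :=
  j < D.n ∧ D.Near (g m) j ∧ ∃ p ≤ m, own (g p) = j ∧ D.Contains (g p) (g m)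

open Classical in
/-- The number of segments in the list of `g m` that count for the candidate disc `c`. -/
noncomputable def hits (g : ℕ → ℕ) (m c : ℕ) : ℕ :=
  ((Finset.range D.n).filter fun j => D.Listed g m j ∧ D.Hit (g m) c j).card

variable {D}

theorem candRadius_pos (u c : ℕ) : 0 < D.candRadius u c := by
  have := width_pos (D := D) u
  unfold candRadius
  positivity

/-- A candidate is a genuine disc, and restricting to listed segments only lowers its count. This
yields the upper bound for the output. -/
theorem hits_le {L : ℕ} (hL : ∀ cx cy r, 0 < r → D.count cx cy r ≤ L) (g : ℕ → ℕ) (m c : ℕ) :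
    D.hits g m c ≤ L := by
  classical
  refine le_trans (Finset.card_le_card ?_) (hL (D.candX (g m) c) (D.candY (g m) c)
    (D.candRadius (g m) c) (candRadius_pos _ _))
  intro j hj
  rw [Finset.mem_filter] at hj ⊢
  exact ⟨hj.1, hj.2.2⟩

/-- A grid point close to a given point, in one coordinate. -/
theorem exists_grid {z x w : ℝ} (hw : 0 < w) (h1 : x ≤ z) (h2 : ¬ x + w ≤ z) :
    ∃ a : ℕ, a ≤ 63 ∧ x + a / 64 * w ≤ z ∧ z ≤ x + a / 64 * w + w / 64 := by
  rw [not_le] at h2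
  have h0 : 0 ≤ (z - x) / w * 64 := by
    have : 0 ≤ z - x := by linarith
    positivity
  have e : (z - x) / w * 64 * (w / 64) = z - x := by field_simp
  have hlt : (z - x) / w * 64 < 64 := by
    have : (z - x) / w < 1 := by rw [div_lt_one hw]; linarith
    linarith
  have f1 := Nat.floor_le h0
  have f2 := Nat.lt_floor_add_one ((z - x) / w * 64)
  have hw' : 0 < w / 64 := by positivity
  refine ⟨⌊(z - x) / w * 64⌋₊, ?_, ?_, ?_⟩
  · have : ⌊(z - x) / w * 64⌋₊ < 64 := by
      rw [Nat.floor_lt h0]; exact_mod_cast hlt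
    omega
  · have := mul_le_mul_of_nonneg_right f1 hw'.le
    rw [e] at this; linarith
  · have := mul_le_mul_of_nonneg_right f2.le hw'.le
    rw [e] at this; linarith

theorem eq_of_mem_cell {x y w : ℝ} {k : ℕ} (hw : w = 1 / 2 ^ k) {a b : ℤ} (hx : x * 2 ^ k = a)
    (hy : y * 2 ^ k = b) (h1 : x ≤ y) (h2 : ¬ x + w ≤ y) : x = y := by
  have h3 := (floor_eq_of_mem_cell hw hx).mpr ⟨h1, h2⟩
  rw [hx, hy, Int.floor_intCast, Int.floor_intCast] at h3
  apply mul_right_cancel₀ (pow_ne_zero k (two_ne_zero (α := ℝ)))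
  rw [hx, hy, h3]

/-- A candidate is coded in mixed radix: one digit of base 64 for the radius, two of base 128 for
the centre, as decoded in `candRadius`, `candX` and `candY`. The bases multiply to `candCount`. -/
theorem cand_index {m a b : ℕ} (hm : m < 64) (ha : a < 128) (hb : b < 128) :
    m + 64 * (a + 128 * b) < candCount ∧
    m + 64 * (a + 128 * b) - (m + 64 * (a + 128 * b)) / 64 * 64 = m ∧
    (m + 64 * (a + 128 * b)) / 64 - (m + 64 * (a + 128 * b)) / 8192 * 128 = a ∧
    (m + 64 * (a + 128 * b)) / 8192 = b := by
  unfold candCount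
  omega

/-- The disc of a segment of the cell's level is covered by three candidate discs. -/
theorem exists_cand {u : ℕ} {cx cy r : ℝ} (hr : D.width u ≤ r) (hr' : r < 2 * D.width u)
    (hx : D.cornerX u ≤ cx) (hx' : ¬ D.cornerX u + D.width u ≤ cx)
    (hy : D.cornerY u ≤ cy) (hy' : ¬ D.cornerY u + D.width u ≤ cy) :
    ∃ c1 < candCount, ∃ c2 < candCount, ∃ c3 < candCount, ∀ j, r ≤ D.len j → D.Meets j cx cy r →
      D.Hit u c1 j ∨ D.Hit u c2 j ∨ D.Hit u c3 j := by
  have hw := width_pos (D := D) u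
  obtain ⟨a, ha, a1, a2⟩ := exists_grid hw hx hx'
  obtain ⟨b, hb, b1, b2⟩ := exists_grid hw hy hy'
  obtain ⟨m, hm, m1, m2⟩ := exists_grid hw hr (by linarith)
  -- Centre digits count 64ths of the width, shifted by 32. The offsets `(0, 1/2)`, `(7/16, -1/4)`
  -- and `(-7/16, -1/4)` are `(0, 32)`, `(28, -16)` and `(-28, -16)` in this unit.
  obtain ⟨l1, r1, x1, y1⟩ := cand_index (m := m) (a := a + 32) (b := b + 64)
    (by omega) (by omega) (by omega)
  obtain ⟨l2, r2, x2, y2⟩ := cand_index (m := m) (a := a + 60) (b := b + 16)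
    (by omega) (by omega) (by omega)
  obtain ⟨l3, r3, x3, y3⟩ := cand_index (m := m) (a := a + 4) (b := b + 16)
    (by omega) (by omega) (by omega)
  refine ⟨_, l1, _, l2, _, l3, ?_⟩
  intro j hj ⟨t, t0, t1, ht⟩
  -- The radius is rounded down, so a segment of length at least `r` is long enough for the
  -- candidate.
  have hρ : ((64 + m : ℕ) : ℝ) / 64 * D.width u ≤ r := by
    push_cast; linarith
  unfold Hit candRadius candX candY
  rw [r1, x1, y1, r2, x2, y2, r3, x3, y3]
  set w := D.width u with hwdef
  set X := D.px j + t * (D.qx j - D.px j) with hX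
  set Y := D.py j + t * (D.qy j - D.py j) with hY
  have hw2 : 0 < w ^ 2 := by positivity
  have main := exists_offset_disc (x := (X - cx) / w) (y := (Y - cy) / w)
    (d := (cx - (D.cornerX u + a / 64 * w)) / w) (e := (cy - (D.cornerY u + b / 64 * w)) / w)
    (r := r / w) (ρ := ((64 + m : ℕ) : ℝ) / 64)
    (by rw [le_div_iff₀ hw]; linarith)
    (by
      rw [div_pow, div_pow, div_pow, ← add_div]; gcongr)
    (div_nonneg (by linarith) hw.le)
    (by rw [div_le_iff₀ hw]; linarith)
    (div_nonneg (by linarith) hw.le)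
    (by rw [div_le_iff₀ hw]; linarith)
    (by
      rw [tsub_le_iff_right, div_le_iff₀ hw]; push_cast; linarith)
  have scale : ∀ p q s t' u' : ℝ, p ^ 2 + q ^ 2 ≤ s ^ 2 → t' = p * w → u' = q * w →
      t' ^ 2 + u' ^ 2 ≤ (s * w) ^ 2 := by
    rintro p q s _ _ h rfl rfl
    rw [mul_pow, mul_pow, mul_pow, ← add_mul]; gcongr
  rcases main with h | h | h
  · refine Or.inl ⟨hρ.trans hj, t, t0, t1, scale _ _ _ _ _ h ?_ ?_⟩
    · push_cast; field_simp; ring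
    · push_cast; field_simp; ring
  · refine Or.inr (Or.inl ⟨hρ.trans hj, t, t0, t1, scale _ _ _ _ _ h ?_ ?_⟩)
    · push_cast; field_simp; ring
    · push_cast; field_simp; ring
  · refine Or.inr (Or.inr ⟨hρ.trans hj, t, t0, t1, scale _ _ _ _ _ h ?_ ?_⟩)
    · push_cast; field_simp; ring
    · push_cast; field_simp; ring

/-- The best candidate disc is a 3-approximation. -/
theorem Small.count_le (h : D.Small) {g : ℕ → ℕ} (hg : D.Sorted g) {best : ℕ}
    (hb : ∀ m < D.size, ∀ c < candCount, D.hits g m c ≤ best) {cx cy r : ℝ} (hr : 0 < r) :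
    D.count cx cy r ≤ 3 * best := by
  classical
  set J := (Finset.range D.n).filter fun j => r ≤ D.len j ∧ D.Meets j cx cy r with hJ
  change J.card ≤ 3 * best
  rcases J.eq_empty_or_nonempty with he | hne
  · rw [he]; simp
  -- Enlarging the radius to the length of the shortest member keeps all of `J` and ties the radius
  -- to the cell width at level `D.lev i`.
  obtain ⟨i, hi, hmin⟩ := J.exists_min_image D.len hne
  have hmem : ∀ j ∈ J, j < D.n ∧ D.len i ≤ D.len j ∧ D.Meets j cx cy (D.len i) := by
    intro j hj
    have h1 := (Finset.mem_filter.mp hj)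
    have h2 := (Finset.mem_filter.mp hi)
    refine ⟨Finset.mem_range.mp h1.1, hmin j hj, ?_⟩
    exact h1.2.2.mono hr.le le_rfl (by simp) (by simpa using h2.2.1)
  have hin := (hmem i hi).1
  obtain ⟨hl1, hl2⟩ := h.lev_bounds hin
  set k := D.lev i with hk
  have hkp : (0 : ℝ) < 2 ^ k := by positivity
  set w : ℝ := 1 / 2 ^ k with hw
  have hwp : 0 < w := by positivity
  set x : ℝ := ⌊cx * 2 ^ k⌋ / 2 ^ k with hx
  set y : ℝ := ⌊cy * 2 ^ k⌋ / 2 ^ k with hy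
  have bound : ∀ z : ℝ, (⌊z * 2 ^ k⌋ : ℝ) / 2 ^ k ≤ z ∧ z < ⌊z * 2 ^ k⌋ / 2 ^ k + w := by
    intro z
    constructor
    · rw [div_le_iff₀ hkp]; exact Int.floor_le _
    · rw [hw, ← add_div, lt_div_iff₀ hkp]; exact Int.lt_floor_add_one _
  obtain ⟨hx1, hx2⟩ := bound cx
  obtain ⟨hy1, hy2⟩ := bound cy
  have hnear : ∀ j ∈ J, D.Meets j (x + w / 2) (y + w / 2) (3 * w) := by
    intro j hj
    refine (hmem j hj).2.2.mono (s := w) (h.len i hin).le hwp.le ?_ (by linarith)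
    have e1 := sq_le_sq' (a := cx - (x + w / 2)) (b := w / 2) (by linarith) (by linarith)
    have e2 := sq_le_sq' (a := cy - (y + w / 2)) (b := w / 2) (by linarith) (by linarith)
    nlinarith
  have hcell : ∀ j ∈ J, ∃ u < D.size, own u = j ∧ D.level u = D.lev j ∧
      D.cornerX u ≤ x ∧ ¬ D.cornerX u + D.width u ≤ x ∧
      D.cornerY u ≤ y ∧ ¬ D.cornerY u + D.width u ≤ y := fun j hj =>
    h.exists_cell (hmem j hj).1 (h.lev_le_lev hin (hmem j hj).1 (hmem j hj).2.1) rfl rfl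
      (hnear j hj)
  -- These are the positions of all copies of the cell. For the last copy, every cell containing it
  -- precedes it or is the copy itself, so its list comprises all of `J`; an earlier copy may miss
  -- owners of later ones.
  set M := (Finset.range D.size).filter fun m =>
    D.level (g m) = k ∧ D.cornerX (g m) = x ∧ D.cornerY (g m) = y with hM
  have hMne : M.Nonempty := by
    obtain ⟨u, hu, -, h1, h2, h3, h4, h5⟩ := hcell i hi
    obtain ⟨m, hm, rfl⟩ := hg.surj u hu
    refine ⟨m, Finset.mem_filter.mpr ⟨Finset.mem_range.mpr hm, h1, ?_, ?_⟩⟩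
    · exact eq_of_mem_cell (w := D.width (g m)) rfl (cornerX_mul _)
        (by rw [h1, div_mul_cancel₀ _ hkp.ne']) h2 h3
    · exact eq_of_mem_cell (w := D.width (g m)) rfl (cornerY_mul _)
        (by rw [h1, div_mul_cancel₀ _ hkp.ne']) h4 h5
  obtain ⟨m, hm, hmax⟩ := M.exists_max_image id hMne
  obtain ⟨hmN, hmk, hmx, hmy⟩ := Finset.mem_filter.mp hm
  rw [Finset.mem_range] at hmN
  have hmw : D.width (g m) = w := by rw [width, hmk]
  have hlist : ∀ j ∈ J, D.Listed g m j := by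
    intro j hj
    refine ⟨(hmem j hj).1, ?_, ?_⟩
    · unfold Near
      rw [hmx, hmy, hmw]; exact hnear j hj
    · obtain ⟨u, hu, h1, h2, h3⟩ := hcell j hj
      obtain ⟨p, hp, rfl⟩ := hg.surj u hu
      have hc : D.Contains (g p) (g m) := by
        unfold Contains
        rw [hmx, hmy, h2, hmk]
        exact ⟨Nat.lt_succ_of_le (h.lev_le_lev hin (hmem j hj).1 (hmem j hj).2.1), h3⟩
      refine ⟨p, ?_, h1, hc⟩
      by_contra hlt
      rw [not_le] at hlt
      obtain ⟨e1, e2, e3⟩ := h.eq_of_contains_of_le hu (hg.lt m hmN) hc (hg.le m p hlt hp)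
      have : p ≤ m := hmax p (Finset.mem_filter.mpr ⟨Finset.mem_range.mpr hp,
        e1.trans hmk, e2.trans hmx, e3.trans hmy⟩)
      omega
  obtain ⟨c1, hc1, c2, hc2, c3, hc3, hcov⟩ := exists_cand (u := g m) (cx := cx) (cy := cy)
    (r := D.len i)
    (by rw [hmw]; exact hl1) (by rw [hmw]; exact hl2) (by rw [hmx]; exact hx1)
    (by rw [hmx, hmw, not_le]; exact hx2) (by rw [hmy]; exact hy1)
    (by rw [hmy, hmw, not_le]; exact hy2)
  set F : ℕ → Finset ℕ := fun c =>
    (Finset.range D.n).filter fun j => D.Listed g m j ∧ D.Hit (g m) c j with hF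
  have hsub : J ⊆ F c1 ∪ (F c2 ∪ F c3) := by
    intro j hj
    have hjn := Finset.mem_range.mpr (hmem j hj).1
    have h1 := hlist j hj
    simp only [Finset.mem_union, hF, Finset.mem_filter]
    rcases hcov j (hmem j hj).2.1 (hmem j hj).2.2 with h2 | h2 | h2
    · exact Or.inl ⟨hjn, h1, h2⟩
    · exact Or.inr (Or.inl ⟨hjn, h1, h2⟩)
    · exact Or.inr (Or.inr ⟨hjn, h1, h2⟩)
  have k1 : (F c1).card ≤ best := by exact hb m hmN c1 hc1
  have k2 : (F c2).card ≤ best := by exact hb m hmN c2 hc2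
  have k3 : (F c3).card ≤ best := by exact hb m hmN c3 hc3
  have := Finset.card_le_card hsub
  have := Finset.card_union_le (F c1) (F c2 ∪ F c3)
  have := Finset.card_union_le (F c2) (F c3)
  omega

end SegData

end UnitRAM

/-! ## Reasoning about commands -/

namespace UnitRAM

/-- The value of an expression for a natural number. -/
noncomputable def Exp.nval (e : Exp .nat) (σ : State) : ℕ := e.eval σ

/-- The value of an expression for a real number. -/
noncomputable def Exp.rval (e : Exp .real) (σ : State) : ℝ := e.eval σ

/-- An expression serves as a test that holds if its value is not zero. -/
def Exp.Tru (e : Exp .nat) (σ : State) : Prop := e.nval σ ≠ 0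

instance : Add (Exp .nat) := ⟨.nop .add⟩
instance : Sub (Exp .nat) := ⟨.nop .sub⟩
instance : Mul (Exp .nat) := ⟨.nop .mul⟩
instance : Div (Exp .nat) := ⟨.nop .div⟩
instance (k : ℕ) : OfNat (Exp .nat) k := ⟨.ncst k⟩
instance : Add (Exp .real) := ⟨.rop .add⟩
instance : Sub (Exp .real) := ⟨.rop .sub⟩
instance : Mul (Exp .real) := ⟨.rop .mul⟩
instance : Div (Exp .real) := ⟨.rop .div⟩
instance (k : ℕ) : OfNat (Exp .real) k := ⟨.rcst k⟩

namespace Exp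

variable (σ : State)

theorem nval_nvar (x : ℕ) : (nvar x).nval σ = σ.nreg x := rfl
theorem nval_ofNat (k : ℕ) : (ofNat(k) : Exp .nat).nval σ = k := rfl
theorem nval_add (a b : Exp .nat) : (a + b).nval σ = a.nval σ + b.nval σ := rfl
theorem nval_sub (a b : Exp .nat) : (a - b).nval σ = a.nval σ - b.nval σ := rfl
theorem nval_mul (a b : Exp .nat) : (a * b).nval σ = a.nval σ * b.nval σ := rfl
theorem nval_div (a b : Exp .nat) : (a / b).nval σ = a.nval σ / b.nval σ := rfl
theorem nval_nld (a : ℕ) (i : Exp .nat) : (nld a i).nval σ = σ.narr a (i.nval σ) := rfl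
theorem nval_bdf (a b : Exp .real) : (bdf a b).nval σ = bitDiff (a.rval σ) (b.rval σ) := rfl
theorem rval_rvar (x : ℕ) : (rvar x).rval σ = σ.rreg x := rfl
theorem rval_ofNat (k : ℕ) : (ofNat(k) : Exp .real).rval σ = k := by
  change (((k : ℕ) : ℚ) : ℝ) = k
  simp
theorem rval_add (a b : Exp .real) : (a + b).rval σ = a.rval σ + b.rval σ := rfl
theorem rval_sub (a b : Exp .real) : (a - b).rval σ = a.rval σ - b.rval σ := rfl
theorem rval_mul (a b : Exp .real) : (a * b).rval σ = a.rval σ * b.rval σ := rfl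
theorem rval_div (a b : Exp .real) : (a / b).rval σ = a.rval σ / b.rval σ := rfl
theorem rval_rld (a : ℕ) (i : Exp .nat) : (rld a i).rval σ = σ.rarr a (i.nval σ) := rfl
theorem rval_ofn (a : Exp .nat) : (ofn a).rval σ = (a.nval σ : ℝ) := rfl
theorem rval_sqrt (a : Exp .real) : (sqrt a).rval σ = Real.sqrt (a.rval σ) := rfl
theorem rval_floor (a : Exp .real) : (floor a).rval σ = (⌊a.rval σ⌋ : ℝ) := rfl
theorem rval_shl (a : Exp .real) (k : Exp .nat) : (shl a k).rval σ = a.rval σ * 2 ^ k.nval σ := rfl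
theorem rval_shr (a : Exp .real) (k : Exp .nat) : (shr a k).rval σ = a.rval σ / 2 ^ k.nval σ := rfl

theorem nval_cond (c a b : Exp .nat) :
    (cond c a b).nval σ = if c.nval σ = 0 then b.nval σ else a.nval σ := rfl
theorem rval_cond (c : Exp .nat) (a b : Exp .real) :
    (cond c a b).rval σ = if c.nval σ = 0 then b.rval σ else a.rval σ := rfl

theorem nval_cond_lt (a b c d : Exp .nat) :
    (cond (nlt a b) c d).nval σ = if a.nval σ < b.nval σ then c.nval σ else d.nval σ := by
  have : (nlt a b).nval σ = if a.nval σ < b.nval σ then 1 else 0 := rfl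
  rw [nval_cond, this]
  split_ifs <;> simp_all

theorem rval_cond_le (a b c d : Exp .real) :
    (cond (rle a b) c d).rval σ = if a.rval σ ≤ b.rval σ then c.rval σ else d.rval σ := by
  have : (rle a b).nval σ = if a.rval σ ≤ b.rval σ then 1 else 0 := rfl
  rw [rval_cond, this]
  split_ifs <;> simp_all

theorem tru_nlt (a b : Exp .nat) : (nlt a b).Tru σ ↔ a.nval σ < b.nval σ := by
  have : (nlt a b).nval σ = if a.nval σ < b.nval σ then 1 else 0 := rfl
  rw [Tru, this]
  simp

theorem tru_rle (a b : Exp .real) : (rle a b).Tru σ ↔ a.rval σ ≤ b.rval σ := by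
  have : (rle a b).nval σ = if a.rval σ ≤ b.rval σ then 1 else 0 := rfl
  rw [Tru, this]
  simp

theorem tru_mul (a b : Exp .nat) : (a * b).Tru σ ↔ a.Tru σ ∧ b.Tru σ := by
  simp [Tru, nval_mul]

theorem tru_not (a : Exp .nat) : (1 - a).Tru σ ↔ ¬ a.Tru σ := by
  have : (1 - a).nval σ = 1 - a.nval σ := rfl
  simp only [Tru, this]; omega

theorem tru_cond (c a b : Exp .nat) :
    (cond c a b).Tru σ ↔ if c.nval σ = 0 then b.Tru σ else a.Tru σ := by
  unfold Tru; rw [nval_cond]; split_ifs <;> rfl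

theorem tru_cond_lt (a b c d : Exp .nat) :
    (cond (nlt a b) c d).Tru σ ↔ if a.nval σ < b.nval σ then c.Tru σ else d.Tru σ := by
  unfold Tru; rw [nval_cond_lt]; split_ifs <;> rfl

theorem tru_zero : ¬ (0 : Exp .nat).Tru σ := fun h => h rfl

theorem tru_one : (1 : Exp .nat).Tru σ := one_ne_zero

end Exp

namespace Cmd

theorem run_nset (x : ℕ) (e : Exp .nat) (σ : State) :
    (nset x e).run σ = σ.setN x (e.nval σ) := rfl
theorem run_rset (x : ℕ) (e : Exp .real) (σ : State) :
    (rset x e).run σ = σ.setR x (e.rval σ) := rfl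
theorem run_nst (a : ℕ) (i e : Exp .nat) (σ : State) :
    (nst a i e).run σ = σ.setNArr a (i.nval σ) (e.nval σ) := rfl
theorem run_seq (c d : Cmd) (σ : State) : (seq c d).run σ = d.run (c.run σ) := rfl
theorem run_skip (σ : State) : skip.run σ = σ := rfl

theorem run_ite_pos {e : Exp .nat} {σ : State} (h : e.Tru σ) (c d : Cmd) :
    (ite e c d).run σ = c.run σ := if_neg h
theorem run_ite_neg {e : Exp .nat} {σ : State} (h : ¬ e.Tru σ) (c d : Cmd) :
    (ite e c d).run σ = d.run σ := if_pos (not_not.mp h)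

theorem cost_seq (c d : Cmd) (σ : State) :
    (seq c d).cost σ = c.cost σ + d.cost (c.run σ) := rfl
theorem cost_ite_pos {e : Exp .nat} {σ : State} (h : e.Tru σ) (c d : Cmd) :
    (ite e c d).cost σ = e.size + 2 + c.cost σ := congrArg (e.size + 2 + ·) (if_neg h)
theorem cost_ite_neg {e : Exp .nat} {σ : State} (h : ¬ e.Tru σ) (c d : Cmd) :
    (ite e c d).cost σ = e.size + 2 + d.cost σ :=
  congrArg (e.size + 2 + ·) (if_pos (not_not.mp h))

/-- Commands without loops. -/
def LoopFree : Cmd → Prop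
  | seq c d => c.LoopFree ∧ d.LoopFree
  | ite _ c d => c.LoopFree ∧ d.LoopFree
  | loop _ _ _ => False
  | _ => True

/-- Source of the constants for the innermost loop bodies: without loops, the state influences the
cost only through finitely many branches. -/
theorem LoopFree.exists_cost_le {c : Cmd} (h : c.LoopFree) : ∃ K, ∀ σ, c.cost σ ≤ K := by
  induction c with
  | nset x e => exact ⟨_, fun σ => le_rfl⟩
  | rset x e => exact ⟨_, fun σ => le_rfl⟩
  | nst a i e => exact ⟨_, fun σ => le_rfl⟩
  | skip => exact ⟨_, fun σ => le_rfl⟩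
  | seq c d ihc ihd =>
    obtain ⟨K, hK⟩ := ihc h.1
    obtain ⟨K', hK'⟩ := ihd h.2
    exact ⟨K + K', fun σ => add_le_add (hK _) (hK' _)⟩
  | ite e c d ihc ihd =>
    obtain ⟨K, hK⟩ := ihc h.1
    obtain ⟨K', hK'⟩ := ihd h.2
    refine ⟨e.size + 2 + (K + K'), fun σ => ?_⟩
    have := hK σ
    have := hK' σ
    by_cases ht : e.Tru σ
    · rw [cost_ite_pos ht]; omega
    · rw [cost_ite_neg ht]; omega
  | loop x e c => exact h.elim

/-- Loop rule: an invariant that also keeps track of the number of steps. -/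
theorem loop_rule {x : ℕ} {e : Exp .nat} {c : Cmd} {σ : State} (I : ℕ → State → ℕ → Prop)
    (h0 : I 0 σ 0)
    (hs : ∀ k < e.nval σ, ∀ τ s, I k τ s → I (k + 1) (c.run (τ.setN x k))
      (s + (c.cost (τ.setN x k) + 4))) :
    ∃ s, I (e.nval σ) ((loop x e c).run σ) s ∧ (loop x e c).cost σ = e.size + 2 + s := by
  refine ⟨_, ?_, rfl⟩
  have : ∀ k ≤ e.nval σ, I k (iter x c.run σ k)
      (∑ k ∈ Finset.range k, (c.cost ((iter x c.run σ k).setN x k) + 4)) := by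
    intro k
    induction k with
    | zero => intro _; exact h0
    | succ k ih =>
      intro hk
      rw [Finset.sum_range_succ]
      exact hs k hk _ _ (ih (by omega))
  exact this _ le_rfl

/-- Loop rule for rounds of bounded cost. -/
theorem loop_rule_const {x : ℕ} {e : Exp .nat} {c : Cmd} {σ : State} (I : ℕ → State → Prop)
    (K : ℕ) (h0 : I 0 σ)
    (hs : ∀ k < e.nval σ, ∀ τ, I k τ → I (k + 1) (c.run (τ.setN x k)) ∧
      c.cost (τ.setN x k) ≤ K) :
    I (e.nval σ) ((loop x e c).run σ) ∧
      (loop x e c).cost σ ≤ e.size + 2 + e.nval σ * (K + 4) := by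
  obtain ⟨s, ⟨h1, h2⟩, h3⟩ := loop_rule (x := x) (e := e) (c := c) (σ := σ)
    (fun k τ s => I k τ ∧ s ≤ k * (K + 4)) ⟨h0, by simp⟩ (by
      rintro k hk τ s ⟨h1, h2⟩
      obtain ⟨h3, h4⟩ := hs k hk τ h1
      refine ⟨h3, ?_⟩
      rw [add_mul, one_mul]; omega)
  exact ⟨h1, by omega⟩

/-- The natural-number registers that a command may change. -/
def wrN : Cmd → List ℕ
  | nset x _ => [x]
  | rset _ _ => []
  | nst _ _ _ => []
  | skip => []
  | seq c d => c.wrN ++ d.wrN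
  | ite _ c d => c.wrN ++ d.wrN
  | loop x _ c => x :: c.wrN

/-- The real-number registers that a command may change. -/
def wrR : Cmd → List ℕ
  | nset _ _ => []
  | rset x _ => [x]
  | nst _ _ _ => []
  | skip => []
  | seq c d => c.wrR ++ d.wrR
  | ite _ c d => c.wrR ++ d.wrR
  | loop _ _ c => c.wrR

/-- The arrays that a command may change. -/
def wrA : Cmd → List ℕ
  | nset _ _ => []
  | rset _ _ => []
  | nst a _ _ => [a]
  | skip => []
  | seq c d => c.wrA ++ d.wrA
  | ite _ c d => c.wrA ++ d.wrA
  | loop _ _ c => c.wrA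

/-- Frame rule: invariants need to follow only what a fragment writes, and membership in the
explicit lists is settled by `decide`. Real arrays, which hold the input, are never written. -/
theorem run_frame (c : Cmd) : ∀ σ : State,
    (∀ x ∉ c.wrN, (c.run σ).nreg x = σ.nreg x) ∧ (∀ x ∉ c.wrR, (c.run σ).rreg x = σ.rreg x) ∧
    (∀ x ∉ c.wrA, (c.run σ).narr x = σ.narr x) ∧ (c.run σ).rarr = σ.rarr := by
  induction c with
  | nset x e =>
    intro σ
    refine ⟨fun y hy => ?_, fun _ _ => rfl, fun _ _ => rfl, rfl⟩
    exact Function.update_of_ne (by simpa [wrN] using hy) _ _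
  | rset x e =>
    intro σ
    refine ⟨fun _ _ => rfl, fun y hy => ?_, fun _ _ => rfl, rfl⟩
    exact Function.update_of_ne (by simpa [wrR] using hy) _ _
  | nst a i e =>
    intro σ
    refine ⟨fun _ _ => rfl, fun _ _ => rfl, fun y hy => ?_, rfl⟩
    exact Function.update_of_ne (by simpa [wrA] using hy) _ _
  | skip => exact fun σ => ⟨fun _ _ => rfl, fun _ _ => rfl, fun _ _ => rfl, rfl⟩
  | seq c d ihc ihd =>
    intro σ
    obtain ⟨a1, a2, a3, a4⟩ := ihc σ
    obtain ⟨b1, b2, b3, b4⟩ := ihd (c.run σ)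
    simp only [wrN, wrR, wrA, List.mem_append, not_or]
    exact ⟨fun x hx => (b1 x hx.2).trans (a1 x hx.1), fun x hx => (b2 x hx.2).trans (a2 x hx.1),
      fun x hx => (b3 x hx.2).trans (a3 x hx.1), b4.trans a4⟩
  | ite e c d ihc ihd =>
    intro σ
    obtain ⟨a1, a2, a3, a4⟩ := ihc σ
    obtain ⟨b1, b2, b3, b4⟩ := ihd σ
    simp only [wrN, wrR, wrA, List.mem_append, not_or]
    by_cases ht : e.Tru σ
    · rw [run_ite_pos ht]
      exact ⟨fun x hx => a1 x hx.1, fun x hx => a2 x hx.1, fun x hx => a3 x hx.1, a4⟩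
    · rw [run_ite_neg ht]
      exact ⟨fun x hx => b1 x hx.2, fun x hx => b2 x hx.2, fun x hx => b3 x hx.2, b4⟩
  | loop x e c ih =>
    intro σ
    simp only [wrN, wrR, wrA, List.mem_cons, not_or]
    have : ∀ k, (∀ y, y ≠ x ∧ y ∉ c.wrN → (iter x c.run σ k).nreg y = σ.nreg y) ∧
        (∀ y ∉ c.wrR, (iter x c.run σ k).rreg y = σ.rreg y) ∧
        (∀ y ∉ c.wrA, (iter x c.run σ k).narr y = σ.narr y) ∧
        (iter x c.run σ k).rarr = σ.rarr := by
      intro k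
      induction k with
      | zero => exact ⟨fun _ _ => rfl, fun _ _ => rfl, fun _ _ => rfl, rfl⟩
      | succ k ihk =>
        obtain ⟨a1, a2, a3, a4⟩ := ihk
        obtain ⟨b1, b2, b3, b4⟩ := ih ((iter x c.run σ k).setN x k)
        exact ⟨fun y hy => (b1 y hy.2).trans ((Function.update_of_ne hy.1 _ _).trans (a1 y hy)),
          fun y hy => (b2 y hy).trans (a2 y hy), fun y hy => (b3 y hy).trans (a3 y hy),
          b4.trans a4⟩
    exact this _

variable {c : Cmd} {σ : State}

theorem run_nreg {x : ℕ} (h : x ∉ c.wrN) : (c.run σ).nreg x = σ.nreg x := (c.run_frame σ).1 x h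
theorem run_rreg {x : ℕ} (h : x ∉ c.wrR) : (c.run σ).rreg x = σ.rreg x := (c.run_frame σ).2.1 x h
theorem run_narr {x : ℕ} (h : x ∉ c.wrA) : (c.run σ).narr x = σ.narr x := (c.run_frame σ).2.2.1 x h
theorem run_rarr : (c.run σ).rarr = σ.rarr := (c.run_frame σ).2.2.2

end Cmd

/-! ## Expressions for the quantities of the cells -/

/-- The machine state holds the scaled coordinates of the segments. -/
structure Rep (D : SegData) (σ : State) : Prop where
  px : ∀ j, 1 / 2 + σ.rarr 0 j * σ.rreg 0 = D.px j
  py : ∀ j, 1 / 2 + σ.rarr 1 j * σ.rreg 0 = D.py j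
  qx : ∀ j, 1 / 2 + σ.rarr 2 j * σ.rreg 0 = D.qx j
  qy : ∀ j, 1 / 2 + σ.rarr 3 j * σ.rreg 0 = D.qy j

theorem Rep.congr {D : SegData} {σ τ : State} (h : Rep D σ) (h1 : τ.rarr = σ.rarr)
    (h2 : τ.rreg 0 = σ.rreg 0) : Rep D τ := by
  constructor <;> rw [h1, h2]
  exacts [h.px, h.py, h.qx, h.qy]

theorem Rep.run {D : SegData} {σ : State} (h : Rep D σ) {c : Cmd} (hc : 0 ∉ c.wrR) :
    Rep D (c.run σ) := h.congr Cmd.run_rarr (Cmd.run_rreg hc)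

theorem Rep.setN {D : SegData} {σ : State} (h : Rep D σ) (x v : ℕ) : Rep D (σ.setN x v) :=
  h.congr rfl rfl

namespace Exp

/-- A scaled coordinate. -/
def coord (a : ℕ) (j : Exp .nat) : Exp .real := 1 / 2 + rld a j * rvar 0

/-- The length of a segment. -/
def len (j : Exp .nat) : Exp .real :=
  sqrt ((coord 2 j - coord 0 j) * (coord 2 j - coord 0 j) +
    (coord 3 j - coord 1 j) * (coord 3 j - coord 1 j))

/-- The owner of a cell. -/
def own (u : Exp .nat) : Exp .nat := u / 121

/-- The level of a cell. -/
def level (u : Exp .nat) : Exp .nat := bdf (len (own u)) 0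

/-- The corner of a cell. -/
def cornerX (u : Exp .nat) : Exp .real :=
  shr (floor (shl (coord 0 (own u)) (level u)) + ofn ((u - own u * 121) / 11) - 5) (level u)

/-- The corner of a cell. -/
def cornerY (u : Exp .nat) : Exp .real :=
  shr (floor (shl (coord 1 (own u)) (level u)) +
    ofn (u - own u * 121 - (u - own u * 121) / 11 * 11) - 5) (level u)

/-- The side length of a cell. -/
def width (u : Exp .nat) : Exp .real := shr 1 (level u)

/-- The test whether a cell contains another one. -/
def contains (u v : Exp .nat) : Exp .nat :=
  nlt (level u) (level v + 1) * (rle (cornerX u) (cornerX v) *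
    ((1 - rle (cornerX u + width u) (cornerX v)) * (rle (cornerY u) (cornerY v) *
      (1 - rle (cornerY u + width u) (cornerY v)))))

/-- The test whether a cell comes before another one. -/
def le (u v : Exp .nat) : Exp .nat :=
  cond (bdf (cornerX u) (cornerX v))
    (cond (bdf (cornerY u) (cornerY v))
      (cond (nlt (bdf (cornerX u) (cornerX v)) (bdf (cornerY u) (cornerY v) + 1))
        (rle (cornerX u) (cornerX v)) (rle (cornerY u) (cornerY v)))
      (rle (cornerX u) (cornerX v)))
    (cond (bdf (cornerY u) (cornerY v)) (rle (cornerY u) (cornerY v))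
      (nlt (level u) (level v + 1)))

/-- The parameter of the orthogonal projection of a point to the line of a segment. -/
def proj (j : Exp .nat) (cx cy : Exp .real) : Exp .real :=
  ((cx - coord 0 j) * (coord 2 j - coord 0 j) + (cy - coord 1 j) * (coord 3 j - coord 1 j)) /
    ((coord 2 j - coord 0 j) * (coord 2 j - coord 0 j) +
      (coord 3 j - coord 1 j) * (coord 3 j - coord 1 j))

/-- The parameter of the point of a segment that is closest to a given point. -/
def clamp (j : Exp .nat) (cx cy : Exp .real) : Exp .real :=
  cond (rle (proj j cx cy) 0) 0 (cond (rle 1 (proj j cx cy)) 1 (proj j cx cy))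

/-- The test whether a segment meets a disc. -/
def meets (j : Exp .nat) (cx cy r : Exp .real) : Exp .nat :=
  rle ((coord 0 j + clamp j cx cy * (coord 2 j - coord 0 j) - cx) *
      (coord 0 j + clamp j cx cy * (coord 2 j - coord 0 j) - cx) +
    (coord 1 j + clamp j cx cy * (coord 3 j - coord 1 j) - cy) *
      (coord 1 j + clamp j cx cy * (coord 3 j - coord 1 j) - cy)) (r * r)

/-- The test whether a segment comes close to a cell. -/
def near (u j : Exp .nat) : Exp .nat :=
  meets j (cornerX u + width u / 2) (cornerY u + width u / 2) (3 * width u)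

/-- The radius of a candidate disc. -/
def candRadius (u c : Exp .nat) : Exp .real := ofn (64 + (c - c / 64 * 64)) / 64 * width u

/-- The test whether a segment counts for a candidate disc. -/
def hit (u c j : Exp .nat) : Exp .nat :=
  rle (candRadius u c) (len j) *
    meets j (cornerX u + (ofn (c / 64 - c / 8192 * 128) - 32) / 64 * width u)
      (cornerY u + (ofn (c / 8192) - 32) / 64 * width u) (candRadius u c)

end Exp

/-- The point of a segment closest to `(cx, cy)` decides whether the disc is met. -/
theorem meets_iff_clamp {px py dx dy cx cy r t : ℝ} (hpos : 0 < dx ^ 2 + dy ^ 2)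
    (ht : t = ((cx - px) * dx + (cy - py) * dy) / (dx ^ 2 + dy ^ 2)) :
    (∃ s : ℝ, 0 ≤ s ∧ s ≤ 1 ∧ (px + s * dx - cx) ^ 2 + (py + s * dy - cy) ^ 2 ≤ r ^ 2) ↔
      (px + (if t ≤ 0 then 0 else if 1 ≤ t then 1 else t) * dx - cx) ^ 2 +
      (py + (if t ≤ 0 then 0 else if 1 ≤ t then 1 else t) * dy - cy) ^ 2 ≤ r ^ 2 := by
  have ht' : t * (dx ^ 2 + dy ^ 2) = (cx - px) * dx + (cy - py) * dy := by
    rw [ht]; field_simp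
  -- The squared distance is a parabola in `s` with vertex `t`, so the clamped `t` minimises it on
  -- `[0, 1]`.
  have key : ∀ s, (px + s * dx - cx) ^ 2 + (py + s * dy - cy) ^ 2 =
      (dx ^ 2 + dy ^ 2) * (s - t) ^ 2 +
        ((px + t * dx - cx) ^ 2 + (py + t * dy - cy) ^ 2) := by
    intro s
    linear_combination (2 * s - 2 * t) * ht'
  constructor
  · rintro ⟨s, h0, h1, h2⟩
    refine le_trans ?_ h2
    rw [key, key s]
    gcongr ?_ + _
    refine mul_le_mul_of_nonneg_left ?_ hpos.le
    split_ifs with h3 h4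
    · nlinarith
    · nlinarith
    · rw [sub_self]; nlinarith [sq_nonneg (s - t)]
  · intro h
    refine ⟨_, ?_, ?_, h⟩
    · split_ifs with h3 h4 <;> linarith
    · split_ifs with h3 h4 <;> linarith

section

variable {D : SegData} {σ : State} (h : Rep D σ)
include h

open Exp

theorem Rep.rval_coord (j : Exp .nat) : (coord 0 j).rval σ = D.px (j.nval σ) ∧
    (coord 1 j).rval σ = D.py (j.nval σ) ∧ (coord 2 j).rval σ = D.qx (j.nval σ) ∧
    (coord 3 j).rval σ = D.qy (j.nval σ) := by
  have : ∀ a, (coord a j).rval σ = 1 / 2 + σ.rarr a (j.nval σ) * σ.rreg 0 := by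
    intro a
    simp only [coord, rval_add, rval_div, rval_mul, rval_rld, rval_rvar, rval_ofNat]
    norm_num
  rw [this, this, this, this]
  exact ⟨h.px _, h.py _, h.qx _, h.qy _⟩

theorem Rep.rval_len (j : Exp .nat) : (len j).rval σ = D.len (j.nval σ) := by
  obtain ⟨h1, h2, h3, h4⟩ := h.rval_coord j
  simp only [len, rval_sqrt, rval_add, rval_mul, rval_sub, h1, h2, h3, h4, SegData.len, sq]

theorem Rep.nval_level (u : Exp .nat) : (level u).nval σ = D.level (u.nval σ) := by
  simp only [level, nval_bdf, h.rval_len, own, nval_div, nval_ofNat, rval_ofNat, SegData.level,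
    SegData.lev, SegData.own, Nat.cast_zero]

theorem Rep.rval_cornerX (u : Exp .nat) : (cornerX u).rval σ = D.cornerX (u.nval σ) := by
  simp only [cornerX, rval_shr, rval_sub, rval_add, rval_floor, rval_shl, rval_ofn, nval_div,
    nval_sub, nval_mul, own, nval_ofNat, rval_ofNat, h.nval_level, (h.rval_coord _).1,
    SegData.cornerX, SegData.own]
  norm_num

theorem Rep.rval_cornerY (u : Exp .nat) : (cornerY u).rval σ = D.cornerY (u.nval σ) := by
  simp only [cornerY, rval_shr, rval_sub, rval_add, rval_floor, rval_shl, rval_ofn, nval_div,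
    nval_sub, nval_mul, own, nval_ofNat, rval_ofNat, h.nval_level, (h.rval_coord _).2.1,
    SegData.cornerY, SegData.own]
  norm_num

theorem Rep.rval_width (u : Exp .nat) : (width u).rval σ = D.width (u.nval σ) := by
  simp only [width, rval_shr, rval_ofNat, h.nval_level, SegData.width, Nat.cast_one]

theorem Rep.tru_contains (u v : Exp .nat) :
    (contains u v).Tru σ ↔ D.Contains (u.nval σ) (v.nval σ) := by
  simp only [contains, tru_mul, tru_not, tru_nlt, tru_rle, rval_add, nval_add, nval_ofNat,
    h.nval_level, h.rval_cornerX, h.rval_cornerY, h.rval_width, SegData.Contains]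

theorem Rep.tru_le (u v : Exp .nat) : (le u v).Tru σ ↔ D.Le (u.nval σ) (v.nval σ) := by
  rw [le, tru_cond, tru_cond, tru_cond, tru_cond_lt]
  simp only [nval_bdf, tru_rle, tru_nlt, nval_add, nval_ofNat,
    h.nval_level, h.rval_cornerX, h.rval_cornerY, SegData.Le, Zle]

/-- Positive length keeps the denominator of `proj` away from zero. -/
theorem Rep.tru_meets (j : Exp .nat) (cx cy r : Exp .real) (hj : 0 < D.len (j.nval σ)) :
    (meets j cx cy r).Tru σ ↔ D.Meets (j.nval σ) (cx.rval σ) (cy.rval σ) (r.rval σ) := by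
  obtain ⟨h1, h2, h3, h4⟩ := h.rval_coord j
  have hpos : 0 < (D.qx (j.nval σ) - D.px (j.nval σ)) ^ 2 +
      (D.qy (j.nval σ) - D.py (j.nval σ)) ^ 2 := Real.sqrt_pos.mp hj
  rw [SegData.Meets, meets_iff_clamp hpos rfl]
  simp only [meets, clamp, proj, tru_rle, rval_cond_le, rval_add, rval_sub, rval_mul, rval_div,
    rval_ofNat, h1, h2, h3, h4, sq, Nat.cast_zero, Nat.cast_one]

theorem Rep.tru_near (u j : Exp .nat) (hj : 0 < D.len (j.nval σ)) :
    (near u j).Tru σ ↔ D.Near (u.nval σ) (j.nval σ) := by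
  rw [near, h.tru_meets _ _ _ _ hj, SegData.Near]
  simp only [rval_add, rval_div, rval_mul, rval_ofNat, h.rval_cornerX, h.rval_cornerY,
    h.rval_width]
  norm_num

theorem Rep.tru_hit (u c j : Exp .nat) (hj : 0 < D.len (j.nval σ)) :
    (hit u c j).Tru σ ↔ D.Hit (u.nval σ) (c.nval σ) (j.nval σ) := by
  rw [hit, tru_mul, h.tru_meets _ _ _ _ hj, tru_rle, SegData.Hit, SegData.candX, SegData.candY,
    SegData.candRadius]
  simp only [candRadius, rval_add, rval_sub, rval_div, rval_mul, rval_ofn, rval_ofNat, nval_add,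
    nval_sub, nval_div, nval_mul, nval_ofNat, h.rval_cornerX, h.rval_cornerY,
    h.rval_width, h.rval_len]
  norm_num

end

end UnitRAM

/-! ## Sorting -/

namespace UnitRAM

/-- The list in the cells `b, …, b + k - 1` of an array. -/
def read (f : ℕ → ℕ) (b k : ℕ) : List ℕ := (List.range k).map fun t => f (b + t)

theorem length_read (f : ℕ → ℕ) (b k : ℕ) : (read f b k).length = k := by simp [read]

theorem read_succ (f : ℕ → ℕ) (b k : ℕ) : read f b (k + 1) = read f b k ++ [f (b + k)] := by
  simp [read, List.range_succ]

theorem read_congr {f f' : ℕ → ℕ} {b k : ℕ} (h : ∀ t < k, f (b + t) = f' (b + t)) :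
    read f b k = read f' b k :=
  List.map_congr_left fun t ht => h t (List.mem_range.mp ht)

theorem drop_read (f : ℕ → ℕ) (b k : ℕ) {a : ℕ} (ha : a < k) :
    (read f b k).drop a = f (b + a) :: (read f b k).drop (a + 1) := by
  rw [List.drop_eq_getElem_cons (by rwa [length_read])]
  simp [read]

theorem drop_read_of_le (f : ℕ → ℕ) (b k : ℕ) {a : ℕ} (ha : k ≤ a) : (read f b k).drop a = [] :=
  List.drop_eq_nil_of_le (by rwa [length_read])

theorem mem_read {f : ℕ → ℕ} {b k x : ℕ} : x ∈ read f b k ↔ ∃ t < k, f (b + t) = x := by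
  simp [read]

open Classical in
/-- The order of the cells as a Boolean function. -/
noncomputable def SegData.ord (D : SegData) (u v : ℕ) : Bool :=
  decide (zkey (D.cornerX u) (D.cornerY u) (D.level u) ≤
    zkey (D.cornerX v) (D.cornerY v) (D.level v))

open Exp Cmd

/-- The test whether the next element comes from the list of `2 * v`. -/
def mergeTest : Exp .nat :=
  cond (nlt (nvar 5) (nld 1 (2 * nvar 3 + 1)))
    (cond (nlt (nvar 4) (nld 1 (2 * nvar 3)))
      (le (nld 0 (2 * nvar 3 * nvar 1 + nvar 4)) (nld 0 ((2 * nvar 3 + 1) * nvar 1 + nvar 5)))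
      0) 1

/-- One step of the merging of the lists of `2 * v` and `2 * v + 1`. -/
def mergeStep : Cmd :=
  ite mergeTest
    (seq (nst 0 (nvar 3 * nvar 1 + nvar 6) (nld 0 (2 * nvar 3 * nvar 1 + nvar 4)))
      (nset 4 (nvar 4 + 1)))
    (seq (nst 0 (nvar 3 * nvar 1 + nvar 6) (nld 0 ((2 * nvar 3 + 1) * nvar 1 + nvar 5)))
      (nset 5 (nvar 5 + 1)))

/-- The merging of the lists of `2 * v` and `2 * v + 1`. -/
def mergeLoop : Cmd := loop 6 (nld 1 (2 * nvar 3) + nld 1 (2 * nvar 3 + 1)) mergeStep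

theorem exists_mergeStep_cost : ∃ K, ∀ σ, mergeStep.cost σ ≤ K :=
  LoopFree.exists_cost_le (c := mergeStep) ⟨⟨trivial, trivial⟩, ⟨trivial, trivial⟩⟩

theorem run_mergeStep_left {σ : State} (h : mergeTest.Tru σ) : mergeStep.run σ =
    (σ.setNArr 0 (σ.nreg 3 * σ.nreg 1 + σ.nreg 6)
      (σ.narr 0 (2 * σ.nreg 3 * σ.nreg 1 + σ.nreg 4))).setN 4 (σ.nreg 4 + 1) := by
  rw [mergeStep, run_ite_pos h]; rfl

theorem run_mergeStep_right {σ : State} (h : ¬ mergeTest.Tru σ) : mergeStep.run σ =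
    (σ.setNArr 0 (σ.nreg 3 * σ.nreg 1 + σ.nreg 6)
      (σ.narr 0 ((2 * σ.nreg 3 + 1) * σ.nreg 1 + σ.nreg 5))).setN 5 (σ.nreg 5 + 1) := by
  rw [mergeStep, run_ite_neg h]; rfl

/-- Node `v` of the merging tree has the `D.size` addresses from `v * D.size` on. Identifying the
result with `List.merge` makes order and content a matter of list lemmas. -/
theorem exists_mergeLoop : ∃ K, ∀ (D : SegData), D.Small → ∀ (σ : State), Rep D σ →
    ∀ v p q : ℕ, 1 ≤ v → σ.nreg 1 = D.size → σ.nreg 3 = v → σ.nreg 4 = 0 → σ.nreg 5 = 0 →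
    σ.narr 1 (2 * v) = p → σ.narr 1 (2 * v + 1) = q → p + q ≤ D.size →
    (∀ x ∈ read (σ.narr 0) (2 * v * D.size) p, x < D.size) →
    (∀ x ∈ read (σ.narr 0) ((2 * v + 1) * D.size) q, x < D.size) →
    read ((mergeLoop.run σ).narr 0) (v * D.size) (p + q) =
      (read (σ.narr 0) (2 * v * D.size) p).merge (read (σ.narr 0) ((2 * v + 1) * D.size) q) D.ord ∧
    (∀ i, i < v * D.size ∨ (v + 1) * D.size ≤ i → (mergeLoop.run σ).narr 0 i = σ.narr 0 i) ∧
    mergeLoop.cost σ ≤ K * (p + q + 1) := by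
  obtain ⟨K, hK⟩ := exists_mergeStep_cost
  refine ⟨(nld 1 (2 * nvar 3) + nld 1 (2 * nvar 3 + 1)).size + 2 + (K + 4), ?_⟩
  intro D hD σ hσ v p q hv h1 h3 h4 h5 hp hq hpq hxs hys
  set N := D.size with hN
  set xs := read (σ.narr 0) (2 * v * N) p with hxs'
  set ys := read (σ.narr 0) ((2 * v + 1) * N) q with hys'
  -- Since `1 ≤ v`, the target block lies below both source blocks, so writing never spoils data
  -- still to be read.
  have hNpos : v * N + N ≤ 2 * v * N := by nlinarith
  have e2 : 2 * v * N = 2 * (v * N) := by ring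
  have e3 : (2 * v + 1) * N = 2 * (v * N) + N := by ring
  have e1 : (v + 1) * N = v * N + N := by ring
  have hnv : (nld 1 (2 * nvar 3) + nld 1 (2 * nvar 3 + 1)).nval σ = p + q := by
    simp only [nval_add, nval_nld, nval_mul, nval_nvar, nval_ofNat, h3, hp, hq]
  let I : ℕ → State → Prop := fun k τ =>
    Rep D τ ∧ τ.nreg 1 = N ∧ τ.nreg 3 = v ∧ τ.narr 1 = σ.narr 1 ∧
    (∀ i, i < v * N ∨ v * N + k ≤ i → τ.narr 0 i = σ.narr 0 i) ∧
    ∃ a b, τ.nreg 4 = a ∧ τ.nreg 5 = b ∧ a + b = k ∧ a ≤ p ∧ b ≤ q ∧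
      read (τ.narr 0) (v * N) k ++ (xs.drop a).merge (ys.drop b) D.ord = xs.merge ys D.ord
  obtain ⟨⟨-, -, -, -, i5, a, b, -, -, hab, ha, hb, i9⟩, hcost⟩ := loop_rule_const (x := 6)
    (e := nld 1 (2 * nvar 3) + nld 1 (2 * nvar 3 + 1)) (c := mergeStep) (σ := σ)
    I K
    ⟨hσ, h1, h3, rfl, fun _ _ => rfl, 0, 0, h4, h5, rfl, by omega, by omega, by simp [read]⟩ (by
      rw [hnv]
      rintro k hk τ ⟨i1, i2, i3, i4, i5, a, b, i6, i7, hab, ha, hb, i9⟩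
      refine ⟨?_, hK _⟩
      have hr := i1.setN 6 k
      have n1 : (τ.setN 6 k).nreg 1 = N := i2
      have n3 : (τ.setN 6 k).nreg 3 = v := i3
      have n4 : (τ.setN 6 k).nreg 4 = a := i6
      have n5 : (τ.setN 6 k).nreg 5 = b := i7
      have n6 : (τ.setN 6 k).nreg 6 = k := by simp [State.setN]
      have m0 : (τ.setN 6 k).narr 0 = τ.narr 0 := rfl
      have m1 : (τ.setN 6 k).narr 1 = σ.narr 1 := i4
      have hx : ∀ a < p, τ.narr 0 (2 * v * N + a) = σ.narr 0 (2 * v * N + a) :=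
        fun a ha => i5 _ (by omega)
      have hy : ∀ b < q, τ.narr 0 ((2 * v + 1) * N + b) = σ.narr 0 ((2 * v + 1) * N + b) :=
        fun b hb => i5 _ (by omega)
      have hc : mergeTest.Tru (τ.setN 6 k) ↔
          (b < q → a < p ∧ D.Le (τ.narr 0 (2 * v * N + a))
            (τ.narr 0 ((2 * v + 1) * N + b))) := by
        rw [mergeTest, tru_cond_lt, tru_cond_lt, hr.tru_le]
        simp only [nval_nvar, nval_nld, nval_add, nval_mul, nval_ofNat, n1, n3, n4, n5, m0, m1,
          hp, hq, tru_zero, tru_one]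
        by_cases c1 : b < q <;> by_cases c2 : a < p <;> simp [c1, c2]
      have left : ∀ x, a < p → τ.narr 0 (2 * v * N + a) = x →
          (xs.drop a).merge (ys.drop b) D.ord = x :: (xs.drop (a + 1)).merge (ys.drop b) D.ord →
          mergeTest.Tru (τ.setN 6 k) → I (k + 1) (mergeStep.run (τ.setN 6 k)) := by
        intro x hap hx' hm ht
        rw [run_mergeStep_left ht, n1, n3, n4, n6, m0, hx']
        refine ⟨hr.congr rfl rfl, i2, i3, i4, ?_, a + 1, b, rfl, i7, by omega, by omega, hb, ?_⟩
        · intro i hi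
          have : i ≠ v * N + k := by omega
          simp only [State.setN, State.setNArr, Function.update_self, Function.update_of_ne this]
          exact i5 i (by omega)
        · rw [← i9, hm, read_succ, List.append_assoc]
          congr 1
          · refine read_congr fun t ht => ?_
            have : v * N + t ≠ v * N + k := by omega
            simp only [State.setN, State.setNArr, Function.update_self, Function.update_of_ne this]
          · simp [State.setN, State.setNArr]
      have right : ∀ x, b < q → τ.narr 0 ((2 * v + 1) * N + b) = x →
          (xs.drop a).merge (ys.drop b) D.ord = x :: (xs.drop a).merge (ys.drop (b + 1)) D.ord →
          ¬ mergeTest.Tru (τ.setN 6 k) → I (k + 1) (mergeStep.run (τ.setN 6 k)) := by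
        intro x hap hx' hm ht
        rw [run_mergeStep_right ht, n1, n3, n5, n6, m0, hx']
        refine ⟨hr.congr rfl rfl, i2, i3, i4, ?_, a, b + 1, i6, rfl, by omega, by omega,
          by omega, ?_⟩
        · intro i hi
          have : i ≠ v * N + k := by omega
          simp only [State.setN, State.setNArr, Function.update_self, Function.update_of_ne this]
          exact i5 i (by omega)
        · rw [← i9, hm, read_succ, List.append_assoc]
          congr 1
          · refine read_congr fun t ht => ?_
            have : v * N + t ≠ v * N + k := by omega
            simp only [State.setN, State.setNArr, Function.update_self, Function.update_of_ne this]
          · simp [State.setN, State.setNArr]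
      by_cases hbq : b < q
      · by_cases hap : a < p
        · have dx := drop_read (σ.narr 0) (2 * v * N) p hap
          have dy := drop_read (σ.narr 0) ((2 * v + 1) * N) q hbq
          have bx := hxs _ (mem_read.mpr ⟨a, hap, rfl⟩)
          have bY := hys _ (mem_read.mpr ⟨b, hbq, rfl⟩)
          have hle := hD.le_iff bx bY
          by_cases hl : D.Le (σ.narr 0 (2 * v * N + a)) (σ.narr 0 ((2 * v + 1) * N + b))
          · refine left _ hap (hx a hap) ?_ (hc.mpr fun _ => ⟨hap, by rw [hx a hap, hy b hbq]; exact hl⟩)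
            rw [dx, dy, List.cons_merge_cons, if_pos (by
              rw [SegData.ord, decide_eq_true_iff, ← hle]; exact hl)]
          · refine right _ hbq (hy b hbq) ?_ (fun h' => hl ?_)
            · rw [dx, dy, List.cons_merge_cons, if_neg (by
                rw [SegData.ord, decide_eq_true_iff, ← hle]; exact hl)]
            · have := (hc.mp h' hbq).2
              rwa [hx a hap, hy b hbq] at this
        · refine right _ hbq (hy b hbq) ?_ (fun h' => hap (hc.mp h' hbq).1)
          have dx := drop_read_of_le (σ.narr 0) (2 * v * N) p (not_lt.mp hap)
          have dy := drop_read (σ.narr 0) ((2 * v + 1) * N) q hbq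
          rw [dx, dy, List.nil_merge, List.nil_merge]
      -- The right list is exhausted; only `p + q` rounds are run, so the left one is not.
      · have hap : a < p := by omega
        refine left _ hap (hx a hap) ?_ (hc.mpr fun h' => absurd h' hbq)
        have dx := drop_read (σ.narr 0) (2 * v * N) p hap
        have dy := drop_read_of_le (σ.narr 0) ((2 * v + 1) * N) q (not_lt.mp hbq)
        rw [dx, dy, List.merge_right, List.merge_right])
  rw [hnv] at hcost i5 hab i9
  refine ⟨?_, fun i hi => i5 i (by omega), ?_⟩
  · have hap : a = p := by omega
    have hbq : b = q := by omega
    rw [hap, hbq, drop_read_of_le _ _ _ le_rfl, drop_read_of_le _ _ _ le_rfl, List.nil_merge,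
      List.append_nil] at i9
    exact i9
  · refine hcost.trans ?_
    nlinarith

end UnitRAM

/-! ### Bottom-up merge sort on a heap-numbered tree -/

namespace UnitRAM

open Exp Cmd

/-- The list of the node `u` of the merging tree. -/
def State.lst (τ : State) (N u : ℕ) : List ℕ := read (τ.narr 0) (u * N) (τ.narr 1 u)

theorem State.length_lst (τ : State) (N u : ℕ) : (τ.lst N u).length = τ.narr 1 u :=
  length_read _ _ _

/-- The processing of one node of the merging tree. -/
def mergeNode : Cmd :=
  seq (nset 3 (nvar 1 - 1 - nvar 2)) (seq (nset 4 0) (seq (nset 5 0) (seq mergeLoop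
    (nst 1 (nvar 3) (nld 1 (2 * nvar 3) + nld 1 (2 * nvar 3 + 1))))))

theorem exists_mergeNode : ∃ K, ∀ (D : SegData), D.Small → ∀ (σ : State), Rep D σ →
    ∀ v : ℕ, 1 ≤ v → σ.nreg 1 = D.size → σ.nreg 1 - 1 - σ.nreg 2 = v →
    (σ.lst D.size (2 * v)).length + (σ.lst D.size (2 * v + 1)).length ≤ D.size →
    (∀ x ∈ σ.lst D.size (2 * v), x < D.size) →
    (∀ x ∈ σ.lst D.size (2 * v + 1), x < D.size) →
    (mergeNode.run σ).lst D.size v =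
      (σ.lst D.size (2 * v)).merge (σ.lst D.size (2 * v + 1)) D.ord ∧
    (∀ u, v < u → (mergeNode.run σ).lst D.size u = σ.lst D.size u) ∧
    mergeNode.cost σ ≤
      K * ((σ.lst D.size (2 * v)).length + (σ.lst D.size (2 * v + 1)).length + 1) := by
  obtain ⟨K, hK⟩ := exists_mergeLoop
  refine ⟨(nvar 1 - 1 - nvar 2).size + 1 + ((0 : Exp .nat).size + 1) + ((0 : Exp .nat).size + 1) +
    K + ((nvar 3).size + (nld 1 (2 * nvar 3) + nld 1 (2 * nvar 3 + 1)).size + 1), ?_⟩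
  intro D hD σ hσ v hv h1 h2 hpq hxs hys
  set N := D.size with hN
  set σ' := ((σ.setN 3 v).setN 4 0).setN 5 0 with hσ'
  have hrun : mergeNode.run σ = (nst 1 (nvar 3)
      (nld 1 (2 * nvar 3) + nld 1 (2 * nvar 3 + 1))).run (mergeLoop.run σ') := by
    rw [hσ', ← h2]; rfl
  have hr : Rep D σ' := ((hσ.setN 3 v).setN 4 0).setN 5 0
  rw [σ.length_lst, σ.length_lst] at hpq ⊢
  obtain ⟨g1, g2, g3⟩ := hK D hD σ' hr v (σ.narr 1 (2 * v)) (σ.narr 1 (2 * v + 1)) hv h1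
    (by simp [hσ', State.setN]) (by simp [hσ', State.setN]) (by simp [hσ', State.setN]) rfl rfl
    hpq hxs hys
  have f3 : (mergeLoop.run σ').nreg 3 = v := by
    rw [run_nreg (by decide)]; simp [hσ', State.setN]
  have f1 : (mergeLoop.run σ').narr 1 = σ.narr 1 := run_narr (by decide)
  have e0 : (mergeNode.run σ).narr 0 = (mergeLoop.run σ').narr 0 := by
    rw [hrun]; rfl
  have e1 : (mergeNode.run σ).narr 1 =
      Function.update (σ.narr 1) v (σ.narr 1 (2 * v) + σ.narr 1 (2 * v + 1)) := by
    rw [hrun, run_nst]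
    simp only [State.setNArr, Function.update_self, nval_nvar, nval_add, nval_nld, nval_mul,
      nval_ofNat, f3, f1]
  refine ⟨?_, ?_, ?_⟩
  · rw [State.lst, e0, e1, Function.update_self]
    exact g1
  · intro u hu
    rw [State.lst, State.lst, e0, e1, Function.update_of_ne hu.ne']
    refine read_congr fun t _ => g2 _ (Or.inr ?_)
    exact (Nat.mul_le_mul_right _ hu).trans (Nat.le_add_right _ _)
  · have hc : mergeNode.cost σ = (nvar 1 - 1 - nvar 2).size + 1 + (((0 : Exp .nat).size + 1) +
        (((0 : Exp .nat).size + 1) + (mergeLoop.cost σ' +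
          ((nvar 3).size + (nld 1 (2 * nvar 3) + nld 1 (2 * nvar 3 + 1)).size + 1)))) := by
      rw [hσ', ← h2]; rfl
    rw [hc]
    nlinarith

/-- The merging of all lists, bottom-up. -/
def mergeAll : Cmd := loop 2 (nvar 1 - 1) mergeNode

/-- In heap numbering the nodes `v, …, 2 v - 1` form a cut that meets every path from a leaf to the
root once. Passing from the cut at `v + 1` to the cut at `v` replaces the children `2 v` and `2 v +
1` by their parent. -/
theorem sum_Ico_double {M : Type*} [AddCommMonoid M] (f : ℕ → M) {v : ℕ} (hv : 1 ≤ v) :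
    ∑ u ∈ Finset.Ico v (2 * v), f u + (f (2 * v) + f (2 * v + 1)) =
      f v + ∑ u ∈ Finset.Ico (v + 1) (2 * (v + 1)), f u := by
  rw [Finset.sum_eq_sum_Ico_succ_bot (by omega), show 2 * (v + 1) = 2 * v + 1 + 1 by ring,
    Finset.sum_Ico_succ_top (by omega), Finset.sum_Ico_succ_top (by omega)]
  abel

/-- The total size of the lists of the inner nodes. -/
theorem sum_length_le {N : ℕ} (f : ℕ → ℕ)
    (hf : ∀ v, 1 ≤ v → v ≤ N → ∑ u ∈ Finset.Ico v (2 * v), f u = N) :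
    ∑ u ∈ Finset.Ico 1 N, f u ≤ N * (Nat.log 2 N + 1) := by
  rcases Nat.eq_zero_or_pos N with rfl | hN
  · simp
  have key : ∀ J, J ≤ Nat.log 2 N + 1 → ∑ u ∈ Finset.Ico 1 (2 ^ J), f u = N * J := by
    intro J
    induction J with
    | zero => intro _; simp
    | succ J ih =>
      intro hJ
      have h1 : 2 ^ J ≤ N := Nat.pow_le_of_le_log (by omega) (by omega)
      have h2 := hf (2 ^ J) Nat.one_le_two_pow h1
      rw [← Finset.sum_Ico_consecutive _ (Nat.one_le_two_pow (n := J))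
        (Nat.pow_le_pow_right (by norm_num) (Nat.le_succ J)), ih (by omega), pow_succ,
        mul_comm (2 ^ J) 2, h2]
      ring
  rw [← key _ le_rfl]
  refine Finset.sum_le_sum_of_subset (Finset.Ico_subset_Ico_right ?_)
  exact (Nat.lt_pow_succ_log_self (by norm_num) N).le

/-- After `k` rounds the nodes from `N - k` on carry sorted lists, and every cut at such a node
carries each cell exactly once. The cut at `1` is the root, whose block starts at address `N`. The
cost is charged to the lengths of the merged lists. -/
theorem exists_mergeAll : ∃ K, ∀ (D : SegData), D.Small → 1 ≤ D.n → ∀ (σ : State), Rep D σ →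
    σ.nreg 1 = D.size → (∀ u < D.size, σ.lst D.size (D.size + u) = [u]) →
    D.Sorted (fun m => (mergeAll.run σ).narr 0 (D.size + m)) ∧
    mergeAll.cost σ ≤ K * (D.size * (Nat.log 2 D.size + 1)) := by
  obtain ⟨K, hK⟩ := exists_mergeNode
  refine ⟨(nvar 1 - 1).size + 2 + (2 * K + 4), ?_⟩
  intro D hD hn σ hσ h1 hl
  have hNpos : 1 ≤ D.size := by unfold SegData.size; omega
  set N := D.size with hN
  let I : ℕ → State → ℕ → Prop := fun k τ s => Rep D τ ∧ τ.nreg 1 = N ∧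
    (∀ u, N - k ≤ u → u < 2 * N → (τ.lst N u).Pairwise fun a b => D.ord a b = true) ∧
    (∀ v, N - k ≤ v → v ≤ N →
      ∑ u ∈ Finset.Ico v (2 * v), (τ.lst N u : Multiset ℕ) = Multiset.range N) ∧
    s ≤ (K + 4) * k + K * ∑ u ∈ Finset.Ico (N - k) N, (τ.lst N u).length
  have I0 : I 0 σ 0 := by
    refine ⟨hσ, h1, ?_, ?_, by simp⟩
    · intro u hu hu'
      obtain ⟨w, rfl⟩ := Nat.exists_eq_add_of_le hu
      rw [Nat.sub_zero, hl w (by omega)]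
      exact List.pairwise_singleton _ _
    · intro v hv hv'
      obtain rfl : v = N := by omega
      rw [Finset.sum_Ico_eq_sum_range, show 2 * N - N = N by omega,
        Finset.sum_congr rfl fun u hu => by rw [hl u (Finset.mem_range.mp hu)]]
      have : ∀ m, ∑ u ∈ Finset.range m, (([u] : List ℕ) : Multiset ℕ) = Multiset.range m := by
        intro m
        induction m with
        | zero => rfl
        | succ m ih =>
          rw [Finset.sum_range_succ, ih, Multiset.range_succ, Multiset.coe_singleton,
            add_comm, Multiset.singleton_add]
      exact this N
  have hnv : (nvar 1 - 1 : Exp .nat).nval σ = N - 1 := by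
    simp only [nval_sub, nval_nvar, nval_ofNat, h1]
  obtain ⟨s, ⟨j1, j2, j3, j4, j5⟩, hcost⟩ := loop_rule (x := 2) (e := nvar 1 - 1)
    (c := mergeNode) (σ := σ) I I0 (by
      rw [hnv]
      rintro k hk τ s ⟨i1, i2, i3, i4, i5⟩
      obtain ⟨v, hv⟩ : ∃ v, N - k = v + 1 := ⟨N - k - 1, by omega⟩
      have hv1 : N - (k + 1) = v := by omega
      rw [hv] at i3 i4 i5
      have hlst : ∀ u, (τ.setN 2 k).lst N u = τ.lst N u := fun _ => rfl
      have hfr := i4 (v + 1) le_rfl (by omega)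
      have hdbl := sum_Ico_double (fun u => (τ.lst N u : Multiset ℕ)) (v := v) (by omega)
      rw [hfr] at hdbl
      have hsub : (τ.lst N (2 * v) : Multiset ℕ) + (τ.lst N (2 * v + 1) : Multiset ℕ) ≤
          Multiset.range N := by
        rw [← hfr, show 2 * (v + 1) = 2 * v + 1 + 1 by ring, Finset.sum_Ico_succ_top (by omega),
          Finset.sum_Ico_succ_top (by omega), add_assoc]
        exact Multiset.le_add_left _ _
      have hlen : (τ.lst N (2 * v)).length + (τ.lst N (2 * v + 1)).length ≤ N := by
        have := Multiset.card_le_card hsub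
        simpa using this
      have hmem : ∀ x, x ∈ τ.lst N (2 * v) ∨ x ∈ τ.lst N (2 * v + 1) → x < N := by
        intro x hx
        have := Multiset.mem_of_le hsub (show x ∈ _ from Multiset.mem_add.mpr hx)
        exact Multiset.mem_range.mp this
      obtain ⟨a1, a2, a3⟩ := hK D hD (τ.setN 2 k) (i1.setN 2 k) v (by omega) i2
        (by simp [State.setN, i2]; omega) hlen (fun x hx => hmem x (Or.inl hx))
        (fun x hx => hmem x (Or.inr hx))
      rw [hlst, hlst] at a1 a3
      have hlv : ((mergeNode.run (τ.setN 2 k)).lst N v).length =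
          (τ.lst N (2 * v)).length + (τ.lst N (2 * v + 1)).length := by
        rw [a1, List.length_merge]
      refine ⟨(i1.setN 2 k).run (by decide), (run_nreg (by decide)).trans i2, ?_, ?_, ?_⟩
      · intro u hu hu'
        rw [hv1] at hu
        rcases hu.eq_or_lt with rfl | hlt
        · rw [a1]
          refine List.pairwise_merge ?_ ?_ _ _ (i3 _ (by omega) (by omega))
            (i3 _ (by omega) (by omega))
          -- `ord` is defined through `zkey` because that order is linear for all indices, whereas
          -- `Le` is matched with it only below `D.size`.
          · intro a b c
            simp only [SegData.ord, decide_eq_true_eq]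
            exact le_trans
          · intro a b
            simp only [SegData.ord, Bool.or_eq_true, decide_eq_true_eq]
            exact le_total _ _
        · rw [a2 u hlt]
          exact i3 u hlt hu'
      · intro w hw hw'
        rw [hv1] at hw
        rcases hw.eq_or_lt with rfl | hlt
        · rw [Finset.sum_eq_sum_Ico_succ_bot (by omega), Finset.sum_congr rfl fun u hu => by
            rw [a2 u (Finset.mem_Ico.mp hu).1], a1,
            Multiset.coe_eq_coe.mpr (List.merge_perm_append _), ← Multiset.coe_add]
          rw [← hfr, show 2 * (v + 1) = 2 * v + 1 + 1 by ring, Finset.sum_Ico_succ_top (by omega),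
            Finset.sum_Ico_succ_top (by omega)]
          abel
        · rw [Finset.sum_congr rfl fun u hu => by
            rw [a2 u (by have := (Finset.mem_Ico.mp hu).1; omega)]]
          exact i4 w hlt hw'
      · rw [hv1, Finset.sum_eq_sum_Ico_succ_bot (by omega), hlv, Finset.sum_congr rfl fun u hu => by
            rw [a2 u (Finset.mem_Ico.mp hu).1, hlst]]
        refine (add_le_add i5 (Nat.add_le_add_right a3 4)).trans (le_of_eq ?_)
        ring)
  rw [hnv] at j3 j4 j5
  rw [show N - (N - 1) = 1 by omega] at j3 j4 j5
  set τ := mergeAll.run σ with hτ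
  change ∀ v, 1 ≤ v → v ≤ N →
      ∑ u ∈ Finset.Ico v (2 * v), (τ.lst N u : Multiset ℕ) = Multiset.range N at j4
  change ∀ u, 1 ≤ u → u < 2 * N → (τ.lst N u).Pairwise fun a b => D.ord a b = true at j3
  have hperm : (τ.lst N 1 : Multiset ℕ) = Multiset.range N := by
    have := j4 1 le_rfl hNpos
    simpa using this
  have hlen : τ.narr 1 1 = N := by
    have := congrArg Multiset.card hperm
    simpa [State.length_lst] using this
  have hget : ∀ m (hm : m < (τ.lst N 1).length), (τ.lst N 1)[m] = τ.narr 0 (N + m) := by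
    intro m hm
    simp [State.lst, read]
  have hmlen : ∀ m < N, m < (τ.lst N 1).length := by
    intro m hm; rwa [τ.length_lst, hlen]
  have hnd : (τ.lst N 1).Nodup := by
    rw [← Multiset.coe_nodup, hperm]; exact Multiset.nodup_range N
  have hlt : ∀ m < N, τ.narr 0 (N + m) < N := by
    intro m hm
    rw [← hget m (hmlen m hm), ← Multiset.mem_range, ← hperm]
    exact List.getElem_mem _
  refine ⟨⟨hlt, ?_, ?_, ?_⟩, ?_⟩
  · intro u hu
    have : u ∈ (τ.lst N 1 : Multiset ℕ) := by rw [hperm]; exact Multiset.mem_range.mpr hu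
    obtain ⟨m, hm, hm'⟩ := List.getElem_of_mem (Multiset.mem_coe.mp this)
    refine ⟨m, by rwa [τ.length_lst, hlen] at hm, ?_⟩
    rw [← hm', hget]
  · intro m hm m' hm' he
    change τ.narr 0 (N + m) = τ.narr 0 (N + m') at he
    rw [← hget m (hmlen m hm), ← hget m' (hmlen m' hm')] at he
    exact (List.Nodup.getElem_inj_iff hnd).mp he
  · intro m m' hmm hm'
    have := List.pairwise_iff_getElem.mp (j3 1 le_rfl (by omega)) m m' (hmlen m (by omega))
      (hmlen m' hm') hmm
    rw [SegData.ord, decide_eq_true_iff, hget m (hmlen m (by omega)), hget m' (hmlen m' hm')]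
      at this
    exact (hD.le_iff (hlt m (by omega)) (hlt m' hm')).mpr this
  · have h6 := sum_length_le (N := N) (fun u => (τ.lst N u).length) (by
      intro v h1 h2
      have := congrArg Multiset.card (j4 v h1 h2)
      rw [Multiset.card_sum] at this
      simpa using this)
    change mergeAll.cost σ = _ at hcost
    rw [hcost]
    have h7 : s ≤ (K + 4) * (N - 1) + K * (N * (Nat.log 2 N + 1)) :=
      j5.trans (by gcongr; exact h6)
    have h8 : (K + 4) * (N - 1) ≤ (K + 4) * (N * (Nat.log 2 N + 1)) := by
      exact Nat.mul_le_mul_left _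
        ((Nat.sub_le N 1).trans (Nat.le_mul_of_pos_right N (Nat.succ_pos _)))
    have h9 : 1 ≤ N * (Nat.log 2 N + 1) := by nlinarith
    nlinarith

/-- The lists of the leaves. -/
def initLeaves : Cmd :=
  loop 2 (nvar 1) (seq (nst 0 ((nvar 1 + nvar 2) * nvar 1) (nvar 2))
    (nst 1 (nvar 1 + nvar 2) 1))

theorem exists_initLeaves : ∃ K, ∀ (D : SegData), 1 ≤ D.n → ∀ σ : State, σ.nreg 1 = D.size →
    (∀ u < D.size, (initLeaves.run σ).lst D.size (D.size + u) = [u]) ∧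
    initLeaves.cost σ ≤ K * D.size := by
  obtain ⟨K, hK⟩ := LoopFree.exists_cost_le (c := seq (nst 0 ((nvar 1 + nvar 2) * nvar 1) (nvar 2))
    (nst 1 (nvar 1 + nvar 2) 1)) ⟨trivial, trivial⟩
  refine ⟨(nvar 1).size + 2 + (K + 4), fun D hn σ h1 => ?_⟩
  have hNpos : 1 ≤ D.size := by unfold SegData.size; omega
  set N := D.size with hN
  obtain ⟨⟨-, h2⟩, h3⟩ := loop_rule_const (x := 2) (e := nvar 1) (σ := σ)
    (c := seq (nst 0 ((nvar 1 + nvar 2) * nvar 1) (nvar 2)) (nst 1 (nvar 1 + nvar 2) 1))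
    (fun k τ => τ.nreg 1 = N ∧ ∀ u < k, τ.narr 0 ((N + u) * N) = u ∧ τ.narr 1 (N + u) = 1) K
    ⟨h1, by simp⟩ (by
      rintro k hk τ ⟨i1, i2⟩
      refine ⟨⟨i1, fun u hu => ?_⟩, hK _⟩
      rw [run_seq, run_nst, run_nst]
      simp only [nval_nvar, nval_add, nval_mul, nval_ofNat]
      have n1 : (τ.setN 2 k).nreg 1 = N := i1
      have n2 : (τ.setN 2 k).nreg 2 = k := by simp [State.setN]
      simp only [State.setNArr, n1, n2]
      rcases Nat.lt_succ_iff_lt_or_eq.mp hu with hlt | rfl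
      · have ne1 : N + u ≠ N + k := by omega
        have ne2 : (N + u) * N ≠ (N + k) * N := by
          intro h
          exact ne1 (Nat.eq_of_mul_eq_mul_right hNpos h)
        simpa [Function.update_of_ne ne1, Function.update_of_ne ne2, State.setN] using i2 u hlt
      · simp)
  rw [show (nvar 1).nval σ = N from h1] at h2 h3
  refine ⟨fun u hu => ?_, ?_⟩
  · obtain ⟨g1, g2⟩ := h2 u hu
    change read ((initLeaves.run σ).narr 0) _ ((initLeaves.run σ).narr 1 _) = _
    change (initLeaves.run σ).narr 1 _ = _ at g2
    change (initLeaves.run σ).narr 0 _ = _ at g1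
    rw [g2]
    simp [read, g1]
  · change initLeaves.cost σ ≤ _ at h3
    nlinarith

end UnitRAM

/-! ## The lists of the cells and the candidate discs -/

namespace UnitRAM

open Exp Cmd SegData

/-- One step of the computation of the list of a cell from the list of its parent. -/
def filterStep : Cmd :=
  seq (nset 9 (cond (nlt (nvar 8) (nvar 12)) (nld 3 ((nvar 4 - 1) * nvar 1 + nvar 8))
      (own (nvar 6))))
    (ite (near (nvar 6) (nvar 9))
      (seq (nst 3 (nvar 4 * nvar 1 + nvar 7) (nvar 9)) (nset 7 (nvar 7 + 1))) skip)

/-- The computation of the list of a cell from the list of its parent. -/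
def filterLoop : Cmd := loop 8 (nvar 12 + 1) filterStep

-- The last round, number `pl`, lies beyond the parent's list and supplies the cell's own segment.
-- Source and target are the blocks of heights `sp - 1` and `sp`, so the parent's list survives.
open Classical in
theorem exists_filterLoop : ∃ K, ∀ (D : SegData), D.Small → ∀ (σ : State), Rep D σ →
    ∀ sp v pl : ℕ, σ.nreg 1 = D.size → σ.nreg 4 = sp → σ.nreg 6 = v → σ.nreg 7 = 0 →
    σ.nreg 12 = pl → pl ≤ D.size → (pl = 0 ∨ 1 ≤ sp) → ∀ xs ys : List ℕ,
    xs = read (σ.narr 3) ((sp - 1) * D.size) pl ++ [SegData.own v] →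
    ys = xs.filter (fun j => decide (D.Near v j)) → (∀ x ∈ xs, x < D.n) →
    (filterLoop.run σ).nreg 7 = ys.length ∧
    read ((filterLoop.run σ).narr 3) (sp * D.size) ys.length = ys ∧
    (∀ i < sp * D.size, (filterLoop.run σ).narr 3 i = σ.narr 3 i) ∧
    filterLoop.cost σ ≤ K * (pl + 1) := by
  obtain ⟨K, hK⟩ := LoopFree.exists_cost_le (c := filterStep) ⟨trivial, ⟨trivial, trivial⟩, trivial⟩
  refine ⟨(nvar 12 + 1).size + 2 + (K + 4), ?_⟩
  intro D hD σ hσ sp v pl h1 h4 h6 h7 h12 hpl hsp xs ys hxs hys hlt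
  set N := D.size with hN
  have hlen : xs.length = pl + 1 := by rw [hxs, List.length_append, length_read]; rfl
  have hnv : (nvar 12 + 1 : Exp .nat).nval σ = pl + 1 := by
    simp only [nval_add, nval_nvar, nval_ofNat, h12]
  -- On an empty stack the truncated `sp - 1` points to the target block itself, but then `pl = 0`
  -- and nothing is read there.
  have hsp' : pl = 0 ∨ (sp - 1) * N + N = sp * N := by
    rcases hsp with h | h
    · exact Or.inl h
    · right
      obtain ⟨w, rfl⟩ := Nat.exists_eq_add_of_le' h
      rw [Nat.add_sub_cancel]; ring
  let zs : ℕ → List ℕ := fun k => (xs.take k).filter fun j => decide (D.Near v j)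
  let I : ℕ → State → Prop := fun k τ => Rep D τ ∧ τ.nreg 1 = N ∧ τ.nreg 4 = sp ∧ τ.nreg 6 = v ∧
    τ.nreg 12 = pl ∧ (∀ i < sp * N, τ.narr 3 i = σ.narr 3 i) ∧ τ.nreg 7 = (zs k).length ∧
    read (τ.narr 3) (sp * N) (zs k).length = zs k
  obtain ⟨⟨-, -, -, -, -, i6, i7, i8⟩, hcost⟩ := loop_rule_const (x := 8) (e := nvar 12 + 1)
    (c := filterStep) (σ := σ) I K
    ⟨hσ, h1, h4, h6, h12, fun _ _ => rfl, by simpa [zs] using h7, by simp [zs, read]⟩ (by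
      rw [hnv]
      rintro k hk τ ⟨i1, i2, i3, i4, i5, i6, i7, i8⟩
      refine ⟨?_, hK _⟩
      have hkl : k < xs.length := by omega
      set τ1 := (nset 9 (cond (nlt (nvar 8) (nvar 12)) (nld 3 ((nvar 4 - 1) * nvar 1 + nvar 8))
        (own (nvar 6)))).run (τ.setN 8 k) with hτ1
      have hr : Rep D τ1 := (i1.setN 8 k).run (by decide)
      have m1 : τ1.nreg 1 = N := i2
      have m4 : τ1.nreg 4 = sp := i3
      have m6 : τ1.nreg 6 = v := i4
      have m12 : τ1.nreg 12 = pl := i5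
      have m7 : τ1.nreg 7 = (zs k).length := i7
      have m3 : τ1.narr 3 = τ.narr 3 := rfl
      have m9 : τ1.nreg 9 = xs[k] := by
        have n8 : (τ.setN 8 k).nreg 8 = k := by simp [State.setN]
        have n12 : (τ.setN 8 k).nreg 12 = pl := i5
        have n4 : (τ.setN 8 k).nreg 4 = sp := i3
        have n6 : (τ.setN 8 k).nreg 6 = v := i4
        have n1 : (τ.setN 8 k).nreg 1 = N := i2
        have n3 : (τ.setN 8 k).narr 3 = τ.narr 3 := rfl
        rw [hτ1, run_nset, nval_cond_lt]
        simp only [State.setN, Function.update_self]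
        change (if (τ.setN 8 k).nreg 8 < (τ.setN 8 k).nreg 12 then
          (τ.setN 8 k).narr 3 (((τ.setN 8 k).nreg 4 - 1) * (τ.setN 8 k).nreg 1 +
            (τ.setN 8 k).nreg 8) else (τ.setN 8 k).nreg 6 / 121) = _
        rw [n8, n12, n4, n6, n1, n3]
        split_ifs with hlt
        · rw [i6 _ (by omega)]
          simp [hxs, read, hlt]
        · simp [hxs, length_read, List.getElem_append, hlt, SegData.own]
      have hz : zs (k + 1) = zs k ++ [xs[k]].filter fun j => decide (D.Near v j) := by
        simp only [zs]
        rw [← List.take_concat_get' xs k hkl, List.filter_append]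
      have htru : (near (nvar 6) (nvar 9)).Tru τ1 ↔ D.Near v xs[k] := by
        have := hr.tru_near (nvar 6) (nvar 9) (by
          rw [nval_nvar, m9]; exact hD.len _ (hlt _ (List.getElem_mem _)))
        rw [nval_nvar, nval_nvar, m6, m9] at this
        exact this
      have hrun : filterStep.run (τ.setN 8 k) = (ite (near (nvar 6) (nvar 9))
        (seq (nst 3 (nvar 4 * nvar 1 + nvar 7) (nvar 9)) (nset 7 (nvar 7 + 1))) skip).run τ1 := rfl
      rw [hrun]
      by_cases hn : D.Near v xs[k]
      · rw [run_ite_pos (htru.mpr hn)]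
        have hz' : zs (k + 1) = zs k ++ [xs[k]] := by
          rw [hz, List.filter_singleton]; simp [hn]
        have e : (seq (nst 3 (nvar 4 * nvar 1 + nvar 7) (nvar 9)) (nset 7 (nvar 7 + 1))).run τ1 =
            (τ1.setNArr 3 (τ1.nreg 4 * τ1.nreg 1 + τ1.nreg 7) (τ1.nreg 9)).setN 7
              (τ1.nreg 7 + 1) := rfl
        rw [e, m4, m1, m7, m9]
        refine ⟨hr.congr rfl rfl, m1, m4, m6, m12, ?_, ?_, ?_⟩
        · intro i hi
          have : i ≠ sp * N + (zs k).length := by omega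
          simp only [State.setN, State.setNArr, Function.update_self, Function.update_of_ne this]
          exact i6 i hi
        · rw [hz', List.length_append]; rfl
        · rw [hz', List.length_append, List.length_singleton, read_succ]
          congr 1
          · refine Eq.trans (read_congr fun t ht => ?_) i8
            have : sp * N + t ≠ sp * N + (zs k).length := by omega
            simp only [State.setN, State.setNArr, Function.update_self, Function.update_of_ne this]
            rfl
          · simp [State.setN, State.setNArr]
      · rw [run_ite_neg (fun h => hn (htru.mp h)), run_skip]
        have hz' : zs (k + 1) = zs k := by
          rw [hz, List.filter_singleton]; simp [hn]
        refine ⟨hr, m1, m4, m6, m12, i6, ?_, ?_⟩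
        · rw [hz', m7]
        · rw [hz']; exact i8)
  rw [hnv] at i7 i8 hcost
  have hzs : zs (pl + 1) = ys := by
    simp only [zs]; rw [← hlen, List.take_length, hys]
  rw [hzs] at i7 i8
  exact ⟨i7, i8, i6, hcost.trans (by nlinarith)⟩

/-- One step of the counting for a candidate disc. -/
def countStep : Cmd :=
  seq (nset 9 (nld 3 (nvar 4 * nvar 1 + nvar 8)))
    (ite (hit (nvar 6) (nvar 10) (nvar 9)) (nset 11 (nvar 11 + 1)) skip)

/-- The counting for a candidate disc. -/
def countLoop : Cmd := loop 8 (nvar 7) countStep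

open Classical in
theorem exists_countLoop : ∃ K, ∀ (D : SegData), D.Small → ∀ (σ : State), Rep D σ →
    ∀ sp v c : ℕ, σ.nreg 1 = D.size → σ.nreg 4 = sp → σ.nreg 6 = v → σ.nreg 10 = c →
    σ.nreg 11 = 0 → ∀ ys : List ℕ, σ.nreg 7 = ys.length →
    read (σ.narr 3) (sp * D.size) ys.length = ys → (∀ x ∈ ys, x < D.n) →
    (countLoop.run σ).nreg 11 = (ys.filter fun j => decide (D.Hit v c j)).length ∧
    countLoop.cost σ ≤ K * (ys.length + 1) := by
  obtain ⟨K, hK⟩ := LoopFree.exists_cost_le (c := countStep) ⟨trivial, trivial, trivial⟩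
  refine ⟨(nvar 7).size + 2 + (K + 4), ?_⟩
  intro D hD σ hσ sp v c h1 h4 h6 h10 h11 ys h7 hread hlt
  set N := D.size with hN
  let I : ℕ → State → Prop := fun k τ => Rep D τ ∧ τ.nreg 1 = N ∧ τ.nreg 4 = sp ∧ τ.nreg 6 = v ∧
    τ.nreg 10 = c ∧ τ.narr 3 = σ.narr 3 ∧
    τ.nreg 11 = ((ys.take k).filter fun j => decide (D.Hit v c j)).length
  obtain ⟨⟨-, -, -, -, -, -, i7⟩, hcost⟩ := loop_rule_const (x := 8) (e := nvar 7)
    (c := countStep) (σ := σ) I K ⟨hσ, h1, h4, h6, h10, rfl, by simpa using h11⟩ (by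
      rw [nval_nvar, h7]
      rintro k hk τ ⟨i1, i2, i3, i4, i5, i6, i7⟩
      refine ⟨?_, hK _⟩
      set τ1 := (nset 9 (nld 3 (nvar 4 * nvar 1 + nvar 8))).run (τ.setN 8 k) with hτ1
      have hr : Rep D τ1 := (i1.setN 8 k).run (by decide)
      have m6 : τ1.nreg 6 = v := i4
      have m10 : τ1.nreg 10 = c := i5
      have m9 : τ1.nreg 9 = ys[k] := by
        have n8 : (τ.setN 8 k).nreg 8 = k := by simp [State.setN]
        have n4 : (τ.setN 8 k).nreg 4 = sp := i3
        have n1 : (τ.setN 8 k).nreg 1 = N := i2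
        have n3 : (τ.setN 8 k).narr 3 = σ.narr 3 := i6
        have : τ1.nreg 9 = (τ.setN 8 k).narr 3 ((τ.setN 8 k).nreg 4 * (τ.setN 8 k).nreg 1 +
            (τ.setN 8 k).nreg 8) := by
          rw [hτ1, run_nset]; simp only [State.setN, Function.update_self]; rfl
        rw [this, n8, n4, n1, n3]
        have h2 : (read (σ.narr 3) (sp * N) ys.length)[k]'(by rwa [length_read]) = ys[k] := by
          simp only [hread]
        rw [← h2]; simp [read]
      have htru : (hit (nvar 6) (nvar 10) (nvar 9)).Tru τ1 ↔ D.Hit v c ys[k] := by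
        have := hr.tru_hit (nvar 6) (nvar 10) (nvar 9) (by
          rw [nval_nvar, m9]; exact hD.len _ (hlt _ (List.getElem_mem _)))
        rw [nval_nvar, nval_nvar, nval_nvar, m6, m10, m9] at this
        exact this
      have hrun : countStep.run (τ.setN 8 k) =
        (ite (hit (nvar 6) (nvar 10) (nvar 9)) (nset 11 (nvar 11 + 1)) skip).run τ1 := rfl
      rw [hrun]
      have m11 : τ1.nreg 11 = ((ys.take k).filter fun j => decide (D.Hit v c j)).length := i7
      by_cases hn : D.Hit v c ys[k]
      · rw [run_ite_pos (htru.mpr hn), run_nset]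
        refine ⟨hr.setN _ _, i2, i3, i4, i5, i6, ?_⟩
        rw [← List.take_concat_get' ys k hk, List.filter_append, List.filter_singleton]
        simp [State.setN, nval_add, nval_nvar, nval_ofNat, m11, hn]
      · rw [run_ite_neg (fun h => hn (htru.mp h)), run_skip]
        refine ⟨hr, i2, i3, i4, i5, i6, ?_⟩
        rw [← List.take_concat_get' ys k hk, List.filter_append, List.filter_singleton]
        simp [m11, hn])
  rw [nval_nvar, h7] at i7 hcost
  rw [List.take_length] at i7
  exact ⟨i7, hcost.trans (by nlinarith)⟩

/-- The treatment of one candidate disc. -/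
def candStep : Cmd :=
  seq (nset 11 0) (seq countLoop (ite (nlt (nvar 5) (nvar 11)) (nset 5 (nvar 11)) skip))

/-- The treatment of all candidate discs of a cell. -/
def candLoop : Cmd := loop 10 (nvar 13) candStep

theorem run_update_max (σ : State) :
    ((ite (nlt (nvar 5) (nvar 11)) (nset 5 (nvar 11)) skip).run σ).nreg 5 =
      max (σ.nreg 5) (σ.nreg 11) := by
  by_cases h : σ.nreg 5 < σ.nreg 11
  · rw [run_ite_pos ((tru_nlt σ (nvar 5) (nvar 11)).mpr h), run_nset, max_eq_right h.le]
    simp [State.setN, nval_nvar]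
  · rw [run_ite_neg (fun h' => h ((tru_nlt σ (nvar 5) (nvar 11)).mp h')), run_skip, max_eq_left (not_lt.mp h)]

-- The running maximum is bounded on both sides: it dominates every count seen so far, and it stays
-- below every common bound of the counts. The second half avoids naming a candidate that attains
-- it.
open Classical in
theorem exists_candLoop : ∃ K, ∀ (D : SegData), D.Small → ∀ (σ : State), Rep D σ →
    ∀ sp v : ℕ, σ.nreg 1 = D.size → σ.nreg 4 = sp → σ.nreg 6 = v → σ.nreg 13 = candCount →
    ∀ ys : List ℕ, σ.nreg 7 = ys.length →
    read (σ.narr 3) (sp * D.size) ys.length = ys → (∀ x ∈ ys, x < D.n) →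
    σ.nreg 5 ≤ (candLoop.run σ).nreg 5 ∧
    (∀ c < candCount, (ys.filter fun j => decide (D.Hit v c j)).length ≤ (candLoop.run σ).nreg 5) ∧
    (∀ M, σ.nreg 5 ≤ M → (∀ c, (ys.filter fun j => decide (D.Hit v c j)).length ≤ M) →
      (candLoop.run σ).nreg 5 ≤ M) ∧
    candLoop.cost σ ≤ K * (ys.length + 1) := by
  obtain ⟨K, hK⟩ := exists_countLoop
  obtain ⟨K', hK'⟩ := LoopFree.exists_cost_le
    (c := ite (nlt (nvar 5) (nvar 11)) (nset 5 (nvar 11)) skip) ⟨trivial, trivial⟩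
  refine ⟨(nvar 13).size + 2 + candCount * ((0 : Exp .nat).size + 1 + K + K' + 4), ?_⟩
  intro D hD σ hσ sp v h1 h4 h6 h13 ys h7 hread hlt
  let I : ℕ → State → Prop := fun k τ => Rep D τ ∧ τ.nreg 1 = D.size ∧ τ.nreg 4 = sp ∧
    τ.nreg 6 = v ∧ τ.nreg 7 = ys.length ∧ τ.narr 3 = σ.narr 3 ∧ σ.nreg 5 ≤ τ.nreg 5 ∧
    (∀ c < k, (ys.filter fun j => decide (D.Hit v c j)).length ≤ τ.nreg 5) ∧
    (∀ M, σ.nreg 5 ≤ M → (∀ c, (ys.filter fun j => decide (D.Hit v c j)).length ≤ M) →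
      τ.nreg 5 ≤ M)
  obtain ⟨⟨-, -, -, -, -, -, i7, i8, i9⟩, hcost⟩ := loop_rule_const (x := 10) (e := nvar 13)
    (c := candStep) (σ := σ) I ((0 : Exp .nat).size + 1 + K * (ys.length + 1) + K')
    ⟨hσ, h1, h4, h6, h7, rfl, le_rfl, by simp, fun _ h _ => h⟩ (by
      rintro k - τ ⟨i1, i2, i3, i4, i5, i6, i7, i8, i9⟩
      set τ1 := (τ.setN 10 k).setN 11 0 with hτ1
      have n3 : τ1.narr 3 = σ.narr 3 := i6
      obtain ⟨g1, g2⟩ := hK D hD τ1 ((i1.setN _ _).setN _ _) sp v k i2 i3 i4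
        (by simp [hτ1, State.setN]) (by simp [hτ1, State.setN]) ys i5 (by rw [n3]; exact hread) hlt
      set τ2 := countLoop.run τ1 with hτ2
      have q1 : Rep D τ2 := ((i1.setN _ _).setN _ _).run (by decide)
      have q2 : τ2.nreg 1 = D.size := (run_nreg (by decide)).trans i2
      have q3 : τ2.nreg 4 = sp := (run_nreg (by decide)).trans i3
      have q4 : τ2.nreg 6 = v := (run_nreg (by decide)).trans i4
      have q5 : τ2.nreg 7 = ys.length := (run_nreg (by decide)).trans i5
      have q6 : τ2.narr 3 = σ.narr 3 := (run_narr (by decide)).trans i6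
      have q7 : τ2.nreg 5 = τ.nreg 5 := run_nreg (by decide)
      have hrun : candStep.run (τ.setN 10 k) =
        (ite (nlt (nvar 5) (nvar 11)) (nset 5 (nvar 11)) skip).run τ2 := rfl
      have hc : candStep.cost (τ.setN 10 k) = (0 : Exp .nat).size + 1 + (countLoop.cost τ1 +
        (ite (nlt (nvar 5) (nvar 11)) (nset 5 (nvar 11)) skip).cost τ2) := rfl
      rw [hrun, hc]
      have h5 := run_update_max τ2
      rw [q7, g1] at h5
      refine ⟨⟨q1.run (by decide), (run_nreg (by decide)).trans q2,
        (run_nreg (by decide)).trans q3, (run_nreg (by decide)).trans q4,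
        (run_nreg (by decide)).trans q5, (run_narr (by decide)).trans q6, ?_, ?_, ?_⟩, ?_⟩
      · rw [h5]; exact i7.trans (le_max_left _ _)
      · intro c hc
        rw [h5]
        rcases Nat.lt_succ_iff_lt_or_eq.mp hc with h | rfl
        · exact (i8 c h).trans (le_max_left _ _)
        · exact le_max_right _ _
      · intro M hM hM'
        rw [h5]
        exact max_le (i9 M hM hM') (hM' k)
      · have := hK' τ2
        omega)
  rw [nval_nvar, h13] at i8 hcost
  refine ⟨i7, i8, i9, hcost.trans ?_⟩
  have h2 : (0 : Exp .nat).size + 1 + K * (ys.length + 1) + K' + 4 ≤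
      ((0 : Exp .nat).size + 1 + K + K' + 4) * (ys.length + 1) := by nlinarith
  have h3 := Nat.mul_le_mul_left candCount h2
  rw [add_mul, mul_assoc]
  exact add_le_add (Nat.le_mul_of_pos_right _ (Nat.succ_pos _)) h3

/-- A cell is put on the stack, its list is computed and its candidate discs are treated. -/
def pushCell : Cmd :=
  seq (nst 2 (nvar 4) (nvar 6)) (seq (nset 12 (cond (nlt 0 (nvar 4)) (nld 4 (nvar 4 - 1)) 0))
    (seq (nset 7 0) (seq filterLoop (seq (nst 4 (nvar 4) (nvar 7)) (seq candLoop
      (seq (nset 4 (nvar 4 + 1)) (nset 3 (nvar 3 + 1))))))))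

-- Filtering is linear in the parent's list, and the counting runs a fixed number of times over a
-- list at most one longer.
open Classical in
theorem exists_pushCell : ∃ K, ∀ (D : SegData), D.Small → ∀ (σ : State), Rep D σ →
    ∀ sp v pl : ℕ, σ.nreg 1 = D.size → σ.nreg 4 = sp → σ.nreg 6 = v → σ.nreg 13 = candCount →
    (if 0 < sp then σ.narr 4 (sp - 1) else 0) = pl → pl ≤ D.size → ∀ xs ys : List ℕ,
    xs = read (σ.narr 3) ((sp - 1) * D.size) pl ++ [SegData.own v] →
    ys = xs.filter (fun j => decide (D.Near v j)) → (∀ x ∈ xs, x < D.n) →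
    (pushCell.run σ).nreg 3 = σ.nreg 3 + 1 ∧ (pushCell.run σ).nreg 4 = sp + 1 ∧
    (pushCell.run σ).narr 2 = Function.update (σ.narr 2) sp v ∧
    (pushCell.run σ).narr 4 = Function.update (σ.narr 4) sp ys.length ∧
    read ((pushCell.run σ).narr 3) (sp * D.size) ys.length = ys ∧
    (∀ i < sp * D.size, (pushCell.run σ).narr 3 i = σ.narr 3 i) ∧
    σ.nreg 5 ≤ (pushCell.run σ).nreg 5 ∧
    (∀ c < candCount, (ys.filter fun j => decide (D.Hit v c j)).length ≤ (pushCell.run σ).nreg 5) ∧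
    (∀ M, σ.nreg 5 ≤ M → (∀ c, (ys.filter fun j => decide (D.Hit v c j)).length ≤ M) →
      (pushCell.run σ).nreg 5 ≤ M) ∧
    pushCell.cost σ ≤ K * (pl + 1) := by
  obtain ⟨K, hK⟩ := exists_filterLoop
  obtain ⟨K', hK'⟩ := exists_candLoop
  refine ⟨(nvar 4).size + (nvar 6).size + 1 +
    ((cond (nlt 0 (nvar 4)) (nld 4 (nvar 4 - 1)) 0).size + 1) + ((0 : Exp .nat).size + 1) + K +
    ((nvar 4).size + (nvar 7).size + 1) + 2 * K' + ((nvar 4 + 1).size + 1) +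
    ((nvar 3 + 1).size + 1), ?_⟩
  intro D hD σ hσ sp v pl h1 h4 h6 h13 hpl hplN xs ys hxs hys hlt
  set σ1 := ((σ.setNArr 2 sp v).setN 12 pl).setN 7 0 with hσ1
  have hrun : pushCell.run σ = (seq (nset 4 (nvar 4 + 1)) (nset 3 (nvar 3 + 1))).run
      (candLoop.run ((nst 4 (nvar 4) (nvar 7)).run (filterLoop.run σ1))) := by
    rw [hσ1, ← hpl, ← h4, ← h6]
    have : (cond (nlt 0 (nvar 4)) (nld 4 (nvar 4 - 1)) 0).nval (σ.setNArr 2 (σ.nreg 4) (σ.nreg 6)) =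
      if 0 < σ.nreg 4 then σ.narr 4 (σ.nreg 4 - 1) else 0 := nval_cond_lt _ _ _ _ _
    rw [← this]; rfl
  have hcost : pushCell.cost σ = (nvar 4).size + (nvar 6).size + 1 +
      ((cond (nlt 0 (nvar 4)) (nld 4 (nvar 4 - 1)) 0).size + 1 + ((0 : Exp .nat).size + 1 +
      (filterLoop.cost σ1 + ((nvar 4).size + (nvar 7).size + 1 +
      (candLoop.cost ((nst 4 (nvar 4) (nvar 7)).run (filterLoop.run σ1)) +
        ((nvar 4 + 1).size + 1 + ((nvar 3 + 1).size + 1))))))) := by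
    rw [hσ1, ← hpl, ← h4, ← h6]
    have : (cond (nlt 0 (nvar 4)) (nld 4 (nvar 4 - 1)) 0).nval (σ.setNArr 2 (σ.nreg 4) (σ.nreg 6)) =
      if 0 < σ.nreg 4 then σ.narr 4 (σ.nreg 4 - 1) else 0 := nval_cond_lt _ _ _ _ _
    rw [← this]; rfl
  have hr1 : Rep D σ1 := hσ.congr rfl rfl
  have hsp : pl = 0 ∨ 1 ≤ sp := by
    by_cases h : 0 < sp
    · exact Or.inr h
    · left; rw [← hpl, if_neg h]
  obtain ⟨f1, f2, f3, f4⟩ := hK D hD σ1 hr1 sp v pl h1 h4 h6 (by simp [hσ1, State.setN])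
    (by simp [hσ1, State.setN]) hplN hsp xs ys hxs hys hlt
  set σ2 := filterLoop.run σ1 with hσ2
  have a1 : σ2.nreg 1 = D.size := (run_nreg (by decide)).trans h1
  have a4 : σ2.nreg 4 = sp := (run_nreg (by decide)).trans h4
  have a6 : σ2.nreg 6 = v := (run_nreg (by decide)).trans h6
  have a5 : σ2.nreg 5 = σ.nreg 5 := run_nreg (by decide)
  have a13 : σ2.nreg 13 = candCount := (run_nreg (by decide)).trans h13
  have a3 : σ2.nreg 3 = σ.nreg 3 := run_nreg (by decide)
  have b2 : σ2.narr 2 = Function.update (σ.narr 2) sp v := by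
    rw [hσ2, run_narr (by decide)]; simp [hσ1, State.setN, State.setNArr]
  have b4 : σ2.narr 4 = σ.narr 4 := run_narr (by decide)
  set σ3 := (nst 4 (nvar 4) (nvar 7)).run σ2 with hσ3
  have c4 : σ3.narr 4 = Function.update (σ.narr 4) sp ys.length := by
    rw [hσ3, run_nst, nval_nvar, nval_nvar, a4, f1, ← b4]; simp [State.setNArr]
  have c3 : σ3.narr 3 = σ2.narr 3 := rfl
  have hys' : ∀ x ∈ ys, x < D.n := fun x hx => hlt x (by
    rw [hys] at hx; exact List.mem_of_mem_filter hx)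
  obtain ⟨g1, g2, g3, g4⟩ := hK' D hD σ3 ((hr1.run (by decide)).run (by decide)) sp v a1 a4 a6 a13 ys f1
    (by rw [c3]; exact f2) hys'
  set σ4 := candLoop.run σ3 with hσ4
  have e : (seq (nset 4 (nvar 4 + 1)) (nset 3 (nvar 3 + 1))).run σ4 =
    (σ4.setN 4 (σ4.nreg 4 + 1)).setN 3 (σ4.nreg 3 + 1) := rfl
  have d4 : σ4.nreg 4 = sp := (run_nreg (by decide)).trans a4
  have d3 : σ4.nreg 3 = σ.nreg 3 := (run_nreg (by decide)).trans a3
  have s5 : σ3.nreg 5 = σ.nreg 5 := a5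
  rw [s5] at g1 g3
  have r3 : σ4.narr 3 = σ2.narr 3 := run_narr (by decide)
  have hylen : ys.length ≤ pl + 1 := by
    rw [hys]
    refine (List.length_filter_le _ _).trans ?_
    rw [hxs, List.length_append, length_read]; rfl
  rw [hrun, e, d4, d3]
  refine ⟨by simp [State.setN], by simp [State.setN], ?_, ?_, ?_, ?_, g1, g2, g3, ?_⟩
  · exact (run_narr (σ := σ3) (c := candLoop) (x := 2) (by decide)).trans b2
  · exact (run_narr (σ := σ3) (c := candLoop) (x := 4) (by decide)).trans c4
  · change read (σ4.narr 3) _ _ = _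
    rw [r3]; exact f2
  · intro i hi
    change σ4.narr 3 i = _
    rw [r3, f3 i hi]; rfl
  · rw [hcost]
    have key : ∀ A F G L : ℕ, 1 ≤ L → F ≤ K * L → G ≤ K' * (2 * L) →
        A + F + G ≤ (A + K + 2 * K') * L := by
      intro A F G L hL hF hG
      have : A ≤ A * L := Nat.le_mul_of_pos_right _ hL
      rw [add_mul, add_mul]
      linarith
    have := key ((nvar 4).size + (nvar 6).size + 1 +
      ((cond (nlt 0 (nvar 4)) (nld 4 (nvar 4 - 1)) 0).size + 1) + ((0 : Exp .nat).size + 1) +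
      ((nvar 4).size + (nvar 7).size + 1) + ((nvar 4 + 1).size + 1) + ((nvar 3 + 1).size + 1))
      _ _ (pl + 1) (by omega) f4 (g4.trans (Nat.mul_le_mul_left _ (by omega)))
    refine (le_of_eq ?_).trans (this.trans (le_of_eq ?_)) <;> ring

end UnitRAM

/-! ## The traversal of the cells -/

namespace UnitRAM

namespace SegData

variable {D : SegData} {g : ℕ → ℕ} {m sp : ℕ} {S : ℕ → ℕ} {L : ℕ → List ℕ}

theorem contains_refl (u : ℕ) : D.Contains u u := contains_iff.mpr ⟨le_rfl, fun _ _ => rfl⟩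

/-- The stack `S` of height `sp` holds the cells among the first `m` ones that can contain the next
one, and `L` holds the lists of the segments close to them. -/
structure Stack (D : SegData) (g : ℕ → ℕ) (m sp : ℕ) (S : ℕ → ℕ) (L : ℕ → List ℕ) : Prop where
  mem : ∀ d < sp, ∃ p < m, S d = g p
  complete : m < D.size → ∀ p < m, D.Contains (g p) (g m) → ∃ d < sp, S d = g p
  chain : ∀ d d', d < d' → d' < sp → D.Contains (S d) (S d')
  nodup : ∀ d < sp, (L d).Nodup
  list : ∀ d < sp, ∀ j, j ∈ L d ↔ D.Near (S d) j ∧ ∃ d' ≤ d, own (S d') = j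

theorem Stack.congr (h : D.Stack g m sp S L) {S' : ℕ → ℕ} {L' : ℕ → List ℕ}
    (hS : ∀ d < sp, S' d = S d) (hL : ∀ d < sp, L' d = L d) : D.Stack g m sp S' L' where
  mem d hd := by rw [hS d hd]; exact h.mem d hd
  complete hm p hp hc := by
    obtain ⟨d, hd, he⟩ := h.complete hm p hp hc
    exact ⟨d, hd, (hS d hd).trans he⟩
  chain d d' hd hd' := by rw [hS d (hd.trans hd'), hS d' hd']; exact h.chain d d' hd hd'
  nodup d hd := by rw [hL d hd]; exact h.nodup d hd
  list d hd j := by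
    rw [hL d hd, hS d hd, h.list d hd]
    refine and_congr_right fun _ => exists_congr fun d' => and_congr_right fun hd' => ?_
    rw [hS d' (by omega)]

theorem Stack.nil (D : SegData) (g : ℕ → ℕ) (S : ℕ → ℕ) (L : ℕ → List ℕ) : D.Stack g 0 0 S L := by
  constructor <;> intros <;> omega

/-- Completeness asks only for cells that contain the next one, so a top that does not may go. -/
theorem Stack.pop (h : D.Stack g m (sp + 1) S L) (hn : ¬ D.Contains (S sp) (g m)) :
    D.Stack g m sp S L where
  mem d hd := h.mem d (by omega)
  complete hm p hp hc := by
    obtain ⟨d, hd, he⟩ := h.complete hm p hp hc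
    rcases Nat.lt_succ_iff_lt_or_eq.mp hd with hd | rfl
    · exact ⟨d, hd, he⟩
    · rw [he] at hn; exact absurd hc hn
  chain d d' hd hd' := h.chain d d' hd (by omega)
  nodup d hd := h.nodup d (by omega)
  list d hd := h.list d (by omega)

theorem Stack.lt_size (h : D.Stack g m sp S L) (hg : D.Sorted g) (hm : m ≤ D.size) {d : ℕ}
    (hd : d < sp) : S d < D.size := by
  obtain ⟨p, hp, he⟩ := h.mem d hd
  rw [he]; exact hg.lt _ (by omega)

theorem Stack.lt_of_mem (h : D.Stack g m sp S L) (hg : D.Sorted g) (hm : m ≤ D.size) {d : ℕ}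
    (hd : d < sp) {j : ℕ} (hj : j ∈ L d) : j < D.n := by
  obtain ⟨-, d', hd', rfl⟩ := (h.list d hd j).mp hj
  exact SegData.own_lt (h.lt_size hg hm (by omega))

theorem Stack.contains_of_le (h : D.Stack g m sp S L) {d d' : ℕ} (hd : d ≤ d') (hd' : d' < sp) :
    D.Contains (S d) (S d') := by
  rcases hd.lt_or_eq with hlt | rfl
  · exact h.chain d d' hlt hd'
  · exact contains_refl _

theorem Contains.width_le {u v : ℕ} (h : D.Contains u v) : D.width v ≤ D.width u := by
  have := (contains_iff.mp h).1
  unfold width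
  gcongr
  norm_num

/-- The listed segments own cells at or below this height of the stack. These contain the cell, so
the segments are at least as long as it is wide and `card_le_of_near` applies. -/
theorem Stack.length_le (h : D.Stack g m sp S L) (hD : D.Small) (hg : D.Sorted g)
    (hm : m ≤ D.size) {M : ℕ} (hM : ∀ cx cy r, 0 < r → D.count cx cy r ≤ M) {d : ℕ} (hd : d < sp) :
    (L d).length ≤ 49 * M := by
  classical
  rw [← List.toFinset_card_of_nodup (h.nodup d hd)]
  refine card_le_of_near hM (u := S d) fun j hj => ?_
  rw [List.mem_toFinset] at hj
  refine ⟨h.lt_of_mem hg hm hd hj, ?_, ((h.list d hd j).mp hj).1⟩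
  obtain ⟨-, d', hd', rfl⟩ := (h.list d hd j).mp hj
  exact (h.contains_of_le hd' hd).width_le.trans
    (hD.lev_bounds (SegData.own_lt (h.lt_size hg hm (by omega)))).1

/-- A crude bound, needed so that a list fits into its block of `D.size` addresses. -/
theorem Stack.length_le_size (h : D.Stack g m sp S L) (hg : D.Sorted g) (hm : m ≤ D.size) {d : ℕ}
    (hd : d < sp) : (L d).length ≤ D.size := by
  classical
  rw [← List.toFinset_card_of_nodup (h.nodup d hd)]
  refine (Finset.card_le_card (t := Finset.range D.n) fun j hj => ?_).trans ?_
  · exact Finset.mem_range.mpr (h.lt_of_mem hg hm hd (List.mem_toFinset.mp hj))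
  · rw [Finset.card_range]; unfold size; omega

-- Once the top contains `g m`, so does the whole stack, and by `Near.mono` the filtered list of the
-- top misses no owner below. The new list therefore consists exactly of the segments in `Listed`,
-- and its counts are `hits`.
open Classical in
theorem Stack.push (h : D.Stack g m sp S L) (hD : D.Small) (hg : D.Sorted g) (hm : m < D.size)
    (ht : 0 < sp → D.Contains (S (sp - 1)) (g m)) {xs ys : List ℕ}
    (hxs : xs = (if 0 < sp then L (sp - 1) else []) ++ [own (g m)])
    (hys : ys = xs.filter fun j => decide (D.Near (g m) j)) :
    D.Stack g (m + 1) (sp + 1) (Function.update S sp (g m)) (Function.update L sp ys) ∧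
    ∀ c, (ys.filter fun j => decide (D.Hit (g m) c j)).length = D.hits g m c := by
  have hc : ∀ d < sp, D.Contains (S d) (g m) := fun d hd =>
    (h.contains_of_le (Nat.le_sub_one_of_lt hd) (by omega)).trans (ht (by omega))
  have hx : ∀ j, j ∈ ys ↔ D.Near (g m) j ∧ (j = own (g m) ∨ ∃ d < sp, own (S d) = j) := by
    intro j
    rw [hys, hxs, List.mem_filter, List.mem_append, List.mem_singleton, decide_eq_true_iff,
      and_comm]
    refine and_congr_right fun hj => ?_
    rw [or_comm]
    refine or_congr_right ?_
    by_cases hsp : 0 < sp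
    · rw [if_pos hsp, h.list _ (by omega)]
      constructor
      · rintro ⟨-, d, hd, he⟩
        exact ⟨d, by omega, he⟩
      · rintro ⟨d, hd, he⟩
        exact ⟨hj.mono (ht hsp), d, by omega, he⟩
    · rw [if_neg hsp]
      constructor
      · intro h'; simp at h'
      · rintro ⟨d, hd, -⟩; omega
  have hnd : ys.Nodup := by
    rw [hys, hxs]
    refine List.Nodup.filter _ (List.Nodup.append ?_ (List.nodup_singleton _) ?_)
    · split_ifs with hsp
      · exact h.nodup _ (by omega)
      · exact List.nodup_nil
    · rw [List.disjoint_singleton]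
      split_ifs with hsp
      · intro hmem
        obtain ⟨-, d, hd, he⟩ := (h.list _ (by omega) _).mp hmem
        -- A repeated entry would give one segment two cells containing `g m`; they coincide,
        -- against the injectivity of the enumeration.
        have h1 := eq_of_own_eq (hc d (by omega)) (contains_refl (g m)) he
        obtain ⟨p, hp, hp'⟩ := h.mem d (by omega)
        have := hg.inj p (by omega) m hm (hp'.symm.trans h1)
        omega
      · exact List.not_mem_nil
  have hup : ∀ d < sp, Function.update S sp (g m) d = S d := fun d hd =>
    Function.update_of_ne hd.ne _ _
  have hlp : ∀ d < sp, Function.update L sp ys d = L d := fun d hd =>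
    Function.update_of_ne hd.ne _ _
  have h' := h.congr hup hlp
  refine ⟨⟨?_, ?_, ?_, ?_, ?_⟩, ?_⟩
  · intro d hd
    rcases Nat.lt_succ_iff_lt_or_eq.mp hd with hd | rfl
    · obtain ⟨p, hp, he⟩ := h'.mem d hd
      exact ⟨p, by omega, he⟩
    · exact ⟨m, by omega, Function.update_self _ _ _⟩
  · intro hm' p hp hcp
    rcases Nat.lt_succ_iff_lt_or_eq.mp hp with hp | rfl
    -- An earlier cell that contains the cell at `m + 1` also contains the one at `m`, so it is
    -- still on the stack.
    · have := hD.contains_between (hg.lt p (by omega)) (hg.lt m hm) (hg.lt _ hm')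
        (hg.le p m hp hm) (hg.le m (m + 1) (by omega) hm') hcp
      obtain ⟨d, hd, he⟩ := h'.complete hm p hp this
      exact ⟨d, by omega, he⟩
    · exact ⟨sp, by omega, Function.update_self _ _ _⟩
  · intro d d' hd hd'
    rcases Nat.lt_succ_iff_lt_or_eq.mp hd' with hd' | rfl
    · exact h'.chain d d' hd hd'
    · rw [Function.update_self, hup d hd]
      exact hc d hd
  · intro d hd
    rcases Nat.lt_succ_iff_lt_or_eq.mp hd with hd | rfl
    · exact h'.nodup d hd
    · rw [Function.update_self]; exact hnd
  · intro d hd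
    rcases Nat.lt_succ_iff_lt_or_eq.mp hd with hd | rfl
    · exact h'.list d hd
    · intro j
      rw [Function.update_self, Function.update_self, hx]
      refine and_congr_right fun _ => ?_
      constructor
      · rintro (rfl | ⟨d', hd', he⟩)
        · exact ⟨d, le_rfl, by rw [Function.update_self]⟩
        · exact ⟨d', hd'.le, by rw [hup d' hd']; exact he⟩
      · rintro ⟨d', hd', he⟩
        rcases hd'.lt_or_eq with hlt | rfl
        · rw [hup d' hlt] at he; exact Or.inr ⟨d', hlt, he⟩
        · rw [Function.update_self] at he; exact Or.inl he.symm
  · intro c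
    rw [← List.toFinset_card_of_nodup (hnd.filter _), hits]
    congr 1
    ext j
    rw [List.mem_toFinset, List.mem_filter, decide_eq_true_iff, hx, Finset.mem_filter,
      Finset.mem_range]
    constructor
    · rintro ⟨⟨h1, h2⟩, h3⟩
      have hj : j < D.n := by
        rcases h2 with rfl | ⟨d, hd, rfl⟩
        · exact SegData.own_lt (hg.lt m hm)
        · exact SegData.own_lt (h.lt_size hg hm.le hd)
      refine ⟨hj, ⟨hj, h1, ?_⟩, h3⟩
      rcases h2 with rfl | ⟨d, hd, he⟩
      · exact ⟨m, le_rfl, rfl, contains_refl _⟩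
      · obtain ⟨p, hp, hp'⟩ := h.mem d hd
        exact ⟨p, hp.le, by rw [← hp']; exact he, by rw [← hp']; exact hc d hd⟩
    · rintro ⟨hj, ⟨-, h1, p, hp, he, hcp⟩, h3⟩
      refine ⟨⟨h1, ?_⟩, h3⟩
      rcases hp.lt_or_eq with hlt | rfl
      · obtain ⟨d, hd, hd'⟩ := h.complete hm p hlt hcp
        exact Or.inr ⟨d, hd, by rw [hd']; exact he⟩
      · exact Or.inl he.symm

end SegData

end UnitRAM

/-! ### The main loop: one pop or one push per step -/

namespace UnitRAM

open Exp Cmd SegData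

/-- The test whether the top of the stack does not contain the current cell. -/
def popTest : Exp .nat :=
  cond (nlt 0 (nvar 4)) (1 - contains (nld 2 (nvar 4 - 1)) (nvar 6)) 0

/-- One step of the traversal: the stack is popped, or the next cell is pushed. -/
def stepCell : Cmd :=
  ite (nlt (nvar 3) (nvar 1))
    (seq (nset 6 (nld 0 (nvar 1 + nvar 3))) (ite popTest (nset 4 (nvar 4 - 1)) pushCell)) skip

/-- The traversal of the cells. -/
def mainLoop : Cmd :=
  seq (nset 3 0) (seq (nset 4 0) (seq (nset 5 0) (seq (nset 13 (ncst candCount))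
    (loop 2 (2 * nvar 1) stepCell))))

/-- The lists of the cells on the stack. -/
def State.lists (τ : State) (N d : ℕ) : List ℕ := read (τ.narr 3) (d * N) (τ.narr 4 d)

/-- The invariant of the traversal after `u` steps. -/
structure Traversed (D : SegData) (g : ℕ → ℕ) (Λ u : ℕ) (τ : State) : Prop where
  rep : Rep D τ
  n1 : τ.nreg 1 = D.size
  n13 : τ.nreg 13 = candCount
  arr : ∀ m, τ.narr 0 (D.size + m) = g m
  le : τ.nreg 3 ≤ D.size
  progress : u + τ.nreg 4 = 2 * τ.nreg 3 ∨ τ.nreg 3 = D.size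
  stack : D.Stack g (τ.nreg 3) (τ.nreg 4) (τ.narr 2) (τ.lists D.size)
  best : ∀ m < τ.nreg 3, ∀ c < candCount, D.hits g m c ≤ τ.nreg 5
  best_le : τ.nreg 5 ≤ Λ

/-- A pop takes constant time, and a push time linear in the parent's list, which has at most `49 *
Λ` entries. After the last cell the steps are idle. -/
theorem exists_stepCell : ∃ K, ∀ (D : SegData), D.Small → ∀ (g : ℕ → ℕ), D.Sorted g → ∀ Λ,
    (∀ cx cy r, 0 < r → D.count cx cy r ≤ Λ) → ∀ u τ, Traversed D g Λ u τ → ∀ x,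
    Traversed D g Λ (u + 1) (stepCell.run (τ.setN 2 x)) ∧
      stepCell.cost (τ.setN 2 x) ≤ K * (49 * Λ + 1) := by
  obtain ⟨K, hK⟩ := exists_pushCell
  refine ⟨(nlt (nvar 3) (nvar 1)).size + 2 + ((nld 0 (nvar 1 + nvar 3)).size + 1 +
    (popTest.size + 2 + ((nvar 4 - 1).size + 1 + K))) + 1, ?_⟩
  intro D hD g hg Λ hΛ u τ hτ x
  set σ := τ.setN 2 x with hσ
  set N := D.size with hN
  have hL : 1 ≤ 49 * Λ + 1 := by omega
  by_cases hm : σ.nreg 3 < σ.nreg 1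
  · have htru : (nlt (nvar 3) (nvar 1)).Tru σ := (tru_nlt _ _ _).mpr hm
    rw [stepCell, run_ite_pos htru, cost_ite_pos htru, run_seq, cost_seq]
    set σ1 := (nset 6 (nld 0 (nvar 1 + nvar 3))).run σ with hσ1
    have hm' : τ.nreg 3 < N := lt_of_lt_of_eq hm hτ.n1
    have m6 : σ1.nreg 6 = g (τ.nreg 3) := by
      have : σ1.nreg 6 = τ.narr 0 (τ.nreg 1 + τ.nreg 3) := by
        rw [hσ1, run_nset]; simp only [State.setN, Function.update_self]; rfl
      rw [this, hτ.n1, hτ.arr]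
    have m1 : σ1.nreg 1 = N := hτ.n1
    have m13 : σ1.nreg 13 = candCount := hτ.n13
    have m4 : σ1.nreg 4 = τ.nreg 4 := rfl
    have m3 : σ1.nreg 3 = τ.nreg 3 := rfl
    have m5 : σ1.nreg 5 = τ.nreg 5 := rfl
    have a0 : σ1.narr = τ.narr := rfl
    have hr : Rep D σ1 := hτ.rep.congr rfl rfl
    have hcost1 : (nset 6 (nld 0 (nvar 1 + nvar 3))).cost σ = (nld 0 (nvar 1 + nvar 3)).size + 1 :=
      rfl
    have hpop : popTest.Tru σ1 ↔ 0 < τ.nreg 4 ∧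
        ¬ D.Contains (τ.narr 2 (τ.nreg 4 - 1)) (g (τ.nreg 3)) := by
      have e1 : (nld 2 (nvar 4 - 1)).nval σ1 = τ.narr 2 (τ.nreg 4 - 1) := rfl
      have e2 : (0 : Exp .nat).nval σ1 = 0 := rfl
      rw [popTest, tru_cond_lt, tru_not, hr.tru_contains, e1, e2, nval_nvar, nval_nvar, m4, m6]
      split_ifs with h
      · exact ⟨fun h' => ⟨h, h'⟩, fun h' => h'.2⟩
      · exact ⟨fun h' => absurd h' (tru_zero _), fun h' => absurd h'.1 h⟩
    clear_value σ1
    rw [hcost1]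
    by_cases hp : 0 < τ.nreg 4 ∧ ¬ D.Contains (τ.narr 2 (τ.nreg 4 - 1)) (g (τ.nreg 3))
    · rw [run_ite_pos (hpop.mpr hp), cost_ite_pos (hpop.mpr hp), run_nset]
      have e3 : (nvar 4 - 1 : Exp .nat).nval σ1 = τ.nreg 4 - 1 := by
        rw [nval_sub, nval_nvar, m4, nval_ofNat]
      rw [e3]
      have q4 : (σ1.setN 4 (τ.nreg 4 - 1)).nreg 4 = τ.nreg 4 - 1 := by simp [State.setN]
      refine ⟨⟨hr.setN _ _, m1, m13, ?_, ?_, ?_, ?_, ?_, ?_⟩, ?_⟩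
      · intro m
        change σ1.narr 0 _ = _
        rw [a0]; exact hτ.arr m
      · exact m3.le.trans hτ.le
      · change _ + (σ1.setN 4 (τ.nreg 4 - 1)).nreg 4 = 2 * σ1.nreg 3 ∨ σ1.nreg 3 = _
        rw [q4, m3]
        have := hτ.progress
        omega
      · change D.Stack g (σ1.nreg 3) ((σ1.setN 4 (τ.nreg 4 - 1)).nreg 4) (σ1.narr 2)
          (fun d => read (σ1.narr 3) (d * N) (σ1.narr 4 d))
        rw [q4, m3, a0]
        refine Stack.pop ?_ hp.2
        rw [Nat.sub_add_cancel hp.1]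
        exact hτ.stack
      · change ∀ m < σ1.nreg 3, ∀ c < candCount, _ ≤ σ1.nreg 5
        rw [m3, m5]; exact hτ.best
      · exact m5.le.trans hτ.best_le
      · have e : (nset 4 (nvar 4 - 1)).cost σ1 = (nvar 4 - 1 : Exp .nat).size + 1 := rfl
        rw [e]
        refine le_trans ?_ (Nat.le_mul_of_pos_right _ hL)
        omega
    · rw [run_ite_neg (fun h => hp (hpop.mp h)), cost_ite_neg (fun h => hp (hpop.mp h))]
      have ht : 0 < τ.nreg 4 → D.Contains (τ.narr 2 (τ.nreg 4 - 1)) (g (τ.nreg 3)) := by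
        intro h; by_contra h'; exact hp ⟨h, h'⟩
      classical
      set pl := if 0 < τ.nreg 4 then τ.narr 4 (τ.nreg 4 - 1) else 0 with hpl
      set xs := read (τ.narr 3) ((τ.nreg 4 - 1) * N) pl ++ [SegData.own (g (τ.nreg 3))] with hxs
      set ys := xs.filter (fun j => decide (D.Near (g (τ.nreg 3)) j)) with hys
      have hxs' : xs = (if 0 < τ.nreg 4 then τ.lists N (τ.nreg 4 - 1) else []) ++
          [SegData.own (g (τ.nreg 3))] := by
        rw [hxs, hpl]
        split_ifs with h
        · rfl
        · simp [read]
      have hlen : ∀ d, (τ.lists N d).length = τ.narr 4 d := fun d => length_read _ _ _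
      have hplN : pl ≤ N ∧ pl ≤ 49 * Λ := by
        rw [hpl]
        split_ifs with h
        · rw [← hlen]
          exact ⟨hτ.stack.length_le_size hg hτ.le (by omega),
            hτ.stack.length_le hD hg hτ.le hΛ (by omega)⟩
        · exact ⟨Nat.zero_le _, Nat.zero_le _⟩
      have hlt : ∀ x ∈ xs, x < D.n := by
        intro x hx
        rw [hxs', List.mem_append, List.mem_singleton] at hx
        rcases hx with hx | rfl
        · split_ifs at hx with h
          · exact hτ.stack.lt_of_mem hg hτ.le (by omega) hx
          · simp at hx
        · exact SegData.own_lt (hg.lt _ hm')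
      obtain ⟨k3, k4, k2, kl, kr, kf, k5, kh, kM, kc⟩ := hK D hD σ1 hr (τ.nreg 4) (g (τ.nreg 3)) pl
        m1 m4 m6 m13 (by rw [a0]) hplN.1 xs ys (by rw [a0]) hys hlt
      obtain ⟨s1, s2⟩ := hτ.stack.push hD hg hm' ht hxs' hys
      have hr' : Rep D (pushCell.run σ1) := hr.run (by decide)
      have p1 : (pushCell.run σ1).nreg 1 = σ1.nreg 1 := run_nreg (by decide)
      have p13 : (pushCell.run σ1).nreg 13 = σ1.nreg 13 := run_nreg (by decide)
      have p0 : (pushCell.run σ1).narr 0 = σ1.narr 0 := run_narr (by decide)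
      rw [a0] at k2 kl kf p0
      rw [m5] at k5 kM
      rw [m3] at k3
      generalize pushCell.run σ1 = ρ at *
      refine ⟨⟨hr', p1.trans m1, p13.trans m13, ?_, ?_, ?_, ?_, ?_, ?_⟩, ?_⟩
      · intro m; rw [p0]; exact hτ.arr m
      · rw [k3]; exact hm'
      · have := hτ.progress
        rw [k3, k4]; omega
      · rw [k3, k4, k2]
        refine s1.congr (fun _ _ => rfl) fun d hd => ?_
        change read (ρ.narr 3) (d * N) (ρ.narr 4 d) = _
        rw [kl]
        rcases Nat.lt_succ_iff_lt_or_eq.mp hd with hd | rfl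
        · rw [Function.update_of_ne hd.ne, Function.update_of_ne hd.ne]
          -- Older lists fit into their own blocks, all below the one just written.
          refine read_congr fun t ht => kf _ ?_
          have h1 := hτ.stack.length_le_size hg hτ.le hd
          rw [hlen] at h1
          calc d * N + t < (d + 1) * N := by rw [add_mul, one_mul]; omega
            _ ≤ τ.nreg 4 * N := Nat.mul_le_mul_right _ hd
        · rw [Function.update_self, Function.update_self]; exact kr
      · rw [k3]
        intro m hm c hc
        rcases Nat.lt_succ_iff_lt_or_eq.mp hm with hm | rfl
        · exact (hτ.best m hm c hc).trans k5
        · rw [← s2]; exact kh c hc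
      · exact kM Λ hτ.best_le fun c => by rw [s2]; exact hits_le hΛ g _ c
      · have key : ∀ A B Y L : ℕ, 1 ≤ L → Y ≤ K * L → A + Y ≤ (A + B + K) * L := by
          intro A B Y L hL hY
          have : A ≤ A * L := Nat.le_mul_of_pos_right _ hL
          rw [add_mul, add_mul]
          linarith [Nat.zero_le (B * L)]
        have := key ((nlt (nvar 3) (nvar 1)).size + 2 + ((nld 0 (nvar 1 + nvar 3)).size + 1 +
          (popTest.size + 2))) ((nvar 4 - 1 : Exp .nat).size + 1 + 1) _ (49 * Λ + 1) hL
          (kc.trans (Nat.mul_le_mul_left _ (by omega)))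
        refine (le_of_eq ?_).trans (this.trans (le_of_eq ?_)) <;> ring
  · have htru : ¬ (nlt (nvar 3) (nvar 1)).Tru σ := fun h => hm ((tru_nlt _ _ _).mp h)
    rw [stepCell, run_ite_neg htru, cost_ite_neg htru, run_skip]
    have h3 : τ.nreg 3 = N := by
      have : ¬ τ.nreg 3 < τ.nreg 1 := hm
      rw [hτ.n1] at this
      exact le_antisymm hτ.le (not_lt.mp this)
    refine ⟨⟨hτ.rep.setN _ _, hτ.n1, hτ.n13, hτ.arr, hτ.le, Or.inr h3, hτ.stack, hτ.best,
      hτ.best_le⟩, ?_⟩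
    have e : skip.cost σ = 1 := rfl
    rw [e]
    refine le_trans ?_ (Nat.le_mul_of_pos_right _ hL)
    omega

theorem exists_mainLoop : ∃ K, ∀ (D : SegData), D.Small → ∀ (g : ℕ → ℕ), D.Sorted g → ∀ Λ,
    (∀ cx cy r, 0 < r → D.count cx cy r ≤ Λ) → ∀ σ, Rep D σ → σ.nreg 1 = D.size →
    (∀ m, σ.narr 0 (D.size + m) = g m) →
    (mainLoop.run σ).nreg 5 ≤ Λ ∧
    (∀ cx cy r, 0 < r → D.count cx cy r ≤ 3 * (mainLoop.run σ).nreg 5) ∧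
    mainLoop.cost σ ≤ K * (D.size * (49 * Λ + 1) + 1) := by
  obtain ⟨K, hK⟩ := exists_stepCell
  refine ⟨(0 : Exp .nat).size + 1 + ((0 : Exp .nat).size + 1) + ((0 : Exp .nat).size + 1) +
    ((ncst candCount).size + 1) + ((2 * nvar 1 : Exp .nat).size + 2) + 2 * (K + 4), ?_⟩
  intro D hD g hg Λ hΛ σ hσ h1 harr
  set σ1 := (((σ.setN 3 0).setN 4 0).setN 5 0).setN 13 candCount with hσ1
  have hrun : mainLoop.run σ = (loop 2 (2 * nvar 1) stepCell).run σ1 := rfl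
  have hcost : mainLoop.cost σ = (0 : Exp .nat).size + 1 + ((0 : Exp .nat).size + 1 +
    ((0 : Exp .nat).size + 1 + ((ncst candCount).size + 1 +
      (loop 2 (2 * nvar 1) stepCell).cost σ1))) := rfl
  have n3 : σ1.nreg 3 = 0 := by simp [hσ1, State.setN]
  have n4 : σ1.nreg 4 = 0 := by simp [hσ1, State.setN]
  have n5 : σ1.nreg 5 = 0 := by simp [hσ1, State.setN]
  have n13 : σ1.nreg 13 = candCount := by simp [hσ1, State.setN]
  have n1 : σ1.nreg 1 = D.size := h1
  have hr : Rep D σ1 := hσ.congr rfl rfl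
  have a : ∀ m, σ1.narr 0 (D.size + m) = g m := harr
  obtain ⟨h2, h3⟩ := loop_rule_const (x := 2) (e := 2 * nvar 1) (σ := σ1) (c := stepCell)
    (Traversed D g Λ) (K * (49 * Λ + 1))
    ⟨hr, n1, n13, a, by rw [n3]; omega, by rw [n3, n4]; omega, by
      rw [n3, n4]; exact Stack.nil _ _ _ _, by rw [n3]; omega, by rw [n5]; omega⟩
    (fun k _ τ hτ => hK D hD g hg Λ hΛ k τ hτ k)
  have hnv : (2 * nvar 1 : Exp .nat).nval σ1 = 2 * D.size := by
    rw [nval_mul, nval_ofNat, nval_nvar, n1]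
  rw [hnv] at h2 h3
  rw [hrun, hcost]
  -- With `m` pushes and `m - sp` pops, the number of steps plus `sp` is `2 m`. After `2 N` steps,
  -- `m ≤ N` forces `m = N`.
  have hm : ((loop 2 (2 * nvar 1) stepCell).run σ1).nreg 3 = D.size := by
    have := h2.progress
    have := h2.le
    omega
  refine ⟨h2.best_le, fun cx cy r hr => hD.count_le hg ?_ hr, ?_⟩
  · rw [← hm]; exact h2.best
  · have key : ∀ A X N M : ℕ, X ≤ 2 * N * (K * (M + 1) + 4) →
        A + X ≤ (A + 2 * (K + 4)) * (N * (M + 1) + 1) := by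
      intro A X N M hX
      have h : (A + 2 * (K + 4)) * (N * (M + 1) + 1) = A + 2 * N * (K * (M + 1) + 4) +
        (A * (N * (M + 1)) + 2 * (K + 4) + 8 * (N * M)) := by ring
      omega
    have := key ((0 : Exp .nat).size + 1 + ((0 : Exp .nat).size + 1) + ((0 : Exp .nat).size + 1) +
      ((ncst candCount).size + 1) + ((2 * nvar 1 : Exp .nat).size + 2)) _ D.size (49 * Λ)
      (Nat.sub_le_iff_le_add'.mpr h3)
    omega

end UnitRAM

/-! ## Scaling -/

namespace UnitRAM

open Exp Cmd SegData

/-- The sum of the squares of the coordinates of the segments is computed. -/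
def scaleStep : Cmd :=
  rset 0 (rvar 0 + (rld 0 (nvar 2) * rld 0 (nvar 2) + rld 1 (nvar 2) * rld 1 (nvar 2) +
    rld 2 (nvar 2) * rld 2 (nvar 2) + rld 3 (nvar 2) * rld 3 (nvar 2)))

/-- The scale and the number of cells are computed. -/
def scaleCmd : Cmd :=
  seq (rset 0 1) (seq (loop 2 (nvar 0) scaleStep)
    (seq (rset 0 (1 / (256 * rvar 0))) (nset 1 (121 * nvar 0))))

/-- The segments in memory, scaled by `A` and shifted. -/
noncomputable def scaled (σ : State) (A : ℝ) : SegData where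
  n := σ.nreg 0
  px j := 1 / 2 + σ.rarr 0 j * A
  py j := 1 / 2 + σ.rarr 1 j * A
  qx j := 1 / 2 + σ.rarr 2 j * A
  qy j := 1 / 2 + σ.rarr 3 j * A

/-- Since `|x| ≤ x² + 1`, one plus the sum of all squares dominates every coordinate, and no maximum
is needed. Scaled coordinates are not stored but recomputed from the scale on each access. -/
theorem exists_scaleCmd : ∃ K, ∀ σ : State, ∃ A : ℝ, 0 < A ∧
    (∀ a < 4, ∀ j < σ.nreg 0, |σ.rarr a j * A| ≤ 1 / 256) ∧
    Rep (scaled σ A) (scaleCmd.run σ) ∧ (scaleCmd.run σ).nreg 1 = 121 * σ.nreg 0 ∧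
    scaleCmd.cost σ ≤ K * (σ.nreg 0 + 1) := by
  obtain ⟨K, hK⟩ := LoopFree.exists_cost_le (c := scaleStep) trivial
  refine ⟨(1 : Exp .real).size + 1 + ((nvar 0).size + 2) +
    ((1 / (256 * rvar 0) : Exp .real).size + 1 + ((121 * nvar 0 : Exp .nat).size + 1)) + (K + 4),
    fun σ => ?_⟩
  set σ1 := (rset 0 1).run σ with hσ1
  have hr1 : σ1.rreg 0 = 1 := by
    rw [hσ1, run_rset, rval_ofNat]; simp [State.setR]
  obtain ⟨⟨h1, h2⟩, h3⟩ := loop_rule_const (x := 2) (e := nvar 0) (σ := σ1) (c := scaleStep)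
    (fun k τ => τ.rarr = σ.rarr ∧ 1 ≤ τ.rreg 0 ∧
      ∀ a < 4, ∀ j < k, σ.rarr a j ^ 2 + 1 ≤ τ.rreg 0) K
    ⟨rfl, hr1.ge, by omega⟩ (by
      rintro k - τ ⟨i1, i2, i3⟩
      refine ⟨⟨run_rarr.trans i1, ?_⟩, hK _⟩
      have e : (scaleStep.run (τ.setN 2 k)).rreg 0 = τ.rreg 0 + (σ.rarr 0 k * σ.rarr 0 k +
          σ.rarr 1 k * σ.rarr 1 k + σ.rarr 2 k * σ.rarr 2 k + σ.rarr 3 k * σ.rarr 3 k) := by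
        rw [scaleStep, run_rset]
        simp only [State.setR, Function.update_self, rval_add, rval_mul, rval_rvar, rval_rld,
          nval_nvar, State.setN, i1]
      have hp := fun a => mul_self_nonneg (σ.rarr a k)
      rw [e]
      have hp0 := hp 0
      have hp1 := hp 1
      have hp2 := hp 2
      have hp3 := hp 3
      refine ⟨by linarith, fun a ha j hj => ?_⟩
      rcases Nat.lt_succ_iff_lt_or_eq.mp hj with hj | rfl
      · linarith [i3 a ha j hj]
      · rw [pow_two]
        interval_cases a <;> linarith)
  have hn : (nvar 0).nval σ1 = σ.nreg 0 := rfl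
  rw [hn] at h2 h3
  set σ2 := (loop 2 (nvar 0) scaleStep).run σ1 with hσ2
  obtain ⟨h2, h4⟩ := h2
  have hpos : (0 : ℝ) < 256 * σ2.rreg 0 := by linarith
  have hn2 : σ2.nreg 0 = σ.nreg 0 := run_nreg (by decide)
  have hA : (scaleCmd.run σ).rreg 0 = 1 / (256 * σ2.rreg 0) := by
    have : scaleCmd.run σ = ((σ2.setR 0 ((1 / (256 * rvar 0) : Exp .real).rval σ2)).setN 1
      (121 * σ2.nreg 0)) := rfl
    rw [this]
    simp only [State.setN, State.setR, Function.update_self, rval_div, rval_mul, rval_ofNat,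
      rval_rvar]
    norm_num
  refine ⟨1 / (256 * σ2.rreg 0), by positivity, fun a ha j hj => ?_, ?_, ?_, ?_⟩
  · have h5 := h4 a ha j hj
    rw [abs_mul, abs_of_pos (by positivity : (0 : ℝ) < 1 / (256 * σ2.rreg 0)), mul_one_div,
      div_le_div_iff₀ hpos (by norm_num)]
    have : |σ.rarr a j| ≤ σ2.rreg 0 := by
      rw [← sq_abs] at h5
      nlinarith [sq_nonneg (|σ.rarr a j| - 1), abs_nonneg (σ.rarr a j)]
    linarith
  · constructor <;> intro j <;> rw [hA, run_rarr] <;> rfl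
  · have : (scaleCmd.run σ).nreg 1 = 121 * σ2.nreg 0 := by
      have : scaleCmd.run σ = ((σ2.setR 0 ((1 / (256 * rvar 0) : Exp .real).rval σ2)).setN 1
        (121 * σ2.nreg 0)) := rfl
      rw [this]; simp [State.setN]
    rw [this, hn2]
  · have hc : scaleCmd.cost σ = (1 : Exp .real).size + 1 + ((loop 2 (nvar 0) scaleStep).cost σ1 +
      ((1 / (256 * rvar 0) : Exp .real).size + 1 + ((121 * nvar 0 : Exp .nat).size + 1))) := rfl
    rw [hc]
    have key : ∀ A B C X M n : ℕ, X ≤ B + n * M → A + (X + C) ≤ (A + B + C + M) * (n + 1) := by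
      intro A B C X M n hX
      have : (A + B + C + M) * (n + 1) = A + B + C + n * M + ((A + B + C) * n + M) := by ring
      omega
    exact key _ _ _ _ _ _ h3

/-! ### From the scaled data back to the given segments -/

section Bridge

variable {n : ℕ} (S : Fin n → PlaneSegment) {A : ℝ}

theorem dist_sq_eq (x y : EuclideanSpace ℝ (Fin 2)) :
    dist x y = Real.sqrt ((x 0 - y 0) ^ 2 + (x 1 - y 1) ^ 2) := by
  rw [EuclideanSpace.dist_eq, Fin.sum_univ_two, Real.dist_eq, Real.dist_eq, sq_abs, sq_abs]

theorem scaled_coord (i : Fin n) : (scaled (initState S) A).px i = 1 / 2 + (S i).p 0 * A ∧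
    (scaled (initState S) A).py i = 1 / 2 + (S i).p 1 * A ∧
    (scaled (initState S) A).qx i = 1 / 2 + (S i).q 0 * A ∧
    (scaled (initState S) A).qy i = 1 / 2 + (S i).q 1 * A := by
  simp [scaled, initState]

theorem len_scaled (hA : 0 < A) (i : Fin n) :
    (scaled (initState S) A).len i = (S i).length * A := by
  obtain ⟨h1, h2, h3, h4⟩ := scaled_coord S (A := A) i
  rw [SegData.len, h1, h2, h3, h4, PlaneSegment.length, dist_comm, dist_sq_eq]
  rw [← Real.sqrt_sq hA.le, ← Real.sqrt_mul (by positivity), Real.sqrt_sq hA.le]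
  congr 1; ring

theorem meets_scaled (hA : 0 < A) (i : Fin n) (c : EuclideanSpace ℝ (Fin 2)) {r : ℝ} (hr : 0 < r) :
    (scaled (initState S) A).Meets i (1 / 2 + c 0 * A) (1 / 2 + c 1 * A) (r * A) ↔
      ((S i).carrier ∩ Metric.closedBall c r).Nonempty := by
  obtain ⟨h1, h2, h3, h4⟩ := scaled_coord S (A := A) i
  rw [SegData.Meets, h1, h2, h3, h4, PlaneSegment.carrier, segment_eq_image']
  have key : ∀ t : ℝ, (1 / 2 + (S i).p 0 * A + t * (1 / 2 + (S i).q 0 * A -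
      (1 / 2 + (S i).p 0 * A)) - (1 / 2 + c 0 * A)) ^ 2 + (1 / 2 + (S i).p 1 * A + t *
      (1 / 2 + (S i).q 1 * A - (1 / 2 + (S i).p 1 * A)) - (1 / 2 + c 1 * A)) ^ 2 ≤ (r * A) ^ 2 ↔
      (S i).p + t • ((S i).q - (S i).p) ∈ Metric.closedBall c r := by
    intro t
    rw [Metric.mem_closedBall, dist_sq_eq, Real.sqrt_le_left hr.le, mul_pow]
    simp only [PiLp.add_apply, PiLp.smul_apply, PiLp.sub_apply, smul_eq_mul]
    rw [← mul_le_mul_iff_left₀ (by positivity : 0 < A ^ 2) (c := r ^ 2)]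
    refine iff_of_eq (congrArg (· ≤ r ^ 2 * A ^ 2) ?_)
    ring
  constructor
  · rintro ⟨t, ht0, ht1, h⟩
    exact ⟨_, ⟨t, ⟨ht0, ht1⟩, rfl⟩, (key t).mp h⟩
  · rintro ⟨_, ⟨t, ⟨ht0, ht1⟩, rfl⟩, h⟩
    exact ⟨t, ht0, ht1, (key t).mpr h⟩

/-- The map `x ↦ 1/2 + A x` is a similarity: it scales lengths and radii alike and preserves
incidence. -/
theorem count_scaled (hA : 0 < A) (c : EuclideanSpace ℝ (Fin 2)) {r : ℝ} (hr : 0 < r) :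
    (scaled (initState S) A).count (1 / 2 + c 0 * A) (1 / 2 + c 1 * A) (r * A) =
      ballCount S c r := by
  classical
  rw [ballCount, Set.ncard_eq_toFinset_card', SegData.count]
  rw [← Finset.card_map Fin.valEmbedding]
  congr 1
  ext j
  rw [Finset.mem_filter, Finset.mem_range, Finset.mem_map]
  constructor
  · rintro ⟨hj, h1, h2⟩
    have hj : j < n := hj
    refine ⟨⟨j, hj⟩, ?_, rfl⟩
    rw [Set.mem_toFinset]
    refine ⟨?_, (meets_scaled S hA ⟨j, hj⟩ c hr).mp h2⟩
    have := len_scaled S hA ⟨j, hj⟩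
    rw [this] at h1
    exact le_of_mul_le_mul_right h1 hA
  · rintro ⟨i, hi, rfl⟩
    rw [Set.mem_toFinset] at hi
    refine ⟨i.2, ?_, (meets_scaled S hA i c hr).mpr hi.2⟩
    change _ ≤ (scaled (initState S) A).len i
    rw [len_scaled S hA]
    exact mul_le_mul_of_nonneg_right hi.1 hA.le

theorem length_pos (s : PlaneSegment) : 0 < s.length := dist_pos.mpr s.p_ne_q

theorem small_scaled (hA : 0 < A)
    (h : ∀ a < 4, ∀ j < n, |(initState S).rarr a j * A| ≤ 1 / 256) :
    (scaled (initState S) A).Small where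
  px j hj := by
    have := h 0 (by norm_num) j hj
    simpa [scaled] using this
  py j hj := by
    have := h 1 (by norm_num) j hj
    simpa [scaled] using this
  qx j hj := by
    have := h 2 (by norm_num) j hj
    simpa [scaled] using this
  qy j hj := by
    have := h 3 (by norm_num) j hj
    simpa [scaled] using this
  len j hj := by
    have hj : j < n := hj
    rw [len_scaled S hA ⟨j, hj⟩]
    exact mul_pos (length_pos _) hA

theorem ballCount_le (c : EuclideanSpace ℝ (Fin 2)) {r : ℝ} (hr : 0 < r) :
    (ballCount S c r : ℝ) ≤ densityValue S := (densityValue_isLeast S).1.2 c r hr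

/-- A ball about an endpoint whose radius is the length of the segment counts that segment. This
lets `λ n` absorb all linear terms of the running time. -/
theorem one_le_densityValue (hn : 1 ≤ n) : 1 ≤ densityValue S := by
  refine le_trans ?_ (ballCount_le S (S ⟨0, hn⟩).p (length_pos (S ⟨0, hn⟩)))
  rw [Nat.one_le_cast, Nat.one_le_iff_ne_zero, ← Nat.pos_iff_ne_zero, ballCount, Set.ncard_pos]
  exact ⟨⟨0, hn⟩, le_rfl, _, left_mem_segment _ _ _, Metric.mem_closedBall_self (length_pos _).le⟩

/-- Counts are integers, so the floor of the density value bounds them and serves as the natural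
number `Λ` in the step bounds. -/
theorem count_scaled_le (hA : 0 < A) (cx cy r : ℝ) (hr : 0 < r) :
    (scaled (initState S) A).count cx cy r ≤ ⌊densityValue S⌋₊ := by
  have h := count_scaled S hA !₂[(cx - 1 / 2) / A, (cy - 1 / 2) / A] (div_pos hr hA)
  have e1 : 1 / 2 + (!₂[(cx - 1 / 2) / A, (cy - 1 / 2) / A] : EuclideanSpace ℝ (Fin 2)) 0 * A =
      cx := by simp [div_mul_cancel₀ _ hA.ne']
  have e2 : 1 / 2 + (!₂[(cx - 1 / 2) / A, (cy - 1 / 2) / A] : EuclideanSpace ℝ (Fin 2)) 1 * A =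
      cy := by simp [div_mul_cancel₀ _ hA.ne']
  rw [e1, e2, div_mul_cancel₀ _ hA.ne'] at h
  rw [h]
  exact Nat.le_floor (ballCount_le S _ (div_pos hr hA))

end Bridge

/-! ## The program -/

/-- The whole program. -/
def densityCmd : Cmd :=
  seq scaleCmd (seq initLeaves (seq mergeAll (seq mainLoop (nset 0 (nvar 5)))))

theorem exists_densityCmd : ∃ K : ℕ, ∀ (n : ℕ), 1 ≤ n → ∀ (S : Fin n → PlaneSegment),
    densityCmd.cost (initState S) ≤ K * (n + 121 * n * (Nat.log 2 (121 * n) + 1) +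
      121 * n * (49 * ⌊densityValue S⌋₊ + 1) + 1) ∧
    (((densityCmd.run (initState S)).nreg 0 : ℕ) : ℝ) ≤ densityValue S ∧
    densityValue S ≤ 3 * ((densityCmd.run (initState S)).nreg 0 : ℕ) := by
  obtain ⟨K1, h1⟩ := exists_scaleCmd
  obtain ⟨K2, h2⟩ := exists_initLeaves
  obtain ⟨K3, h3⟩ := exists_mergeAll
  obtain ⟨K4, h4⟩ := exists_mainLoop
  refine ⟨K1 + K2 + K3 + K4 + ((nvar 5).size + 1), fun n hn S => ?_⟩
  obtain ⟨A, hA, b1, b2, b3, b4⟩ := h1 (initState S)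
  set σ1 := scaleCmd.run (initState S) with hσ1
  set D := scaled (initState S) A with hDdef
  have hn0 : (initState S).nreg 0 = n := rfl
  have hDn : D.n = n := rfl
  have hsize : D.size = 121 * n := rfl
  rw [hn0] at b1 b3 b4
  have hD : D.Small := small_scaled S hA b1
  have hDn1 : 1 ≤ D.n := hn
  obtain ⟨c1, c2⟩ := h2 D hDn1 σ1 b3
  set σ2 := initLeaves.run σ1 with hσ2
  have r2 : Rep D σ2 := b2.run (by decide)
  have n2 : σ2.nreg 1 = D.size := (run_nreg (by decide)).trans b3
  obtain ⟨d1, d2⟩ := h3 D hD hDn1 σ2 r2 n2 c1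
  set σ3 := mergeAll.run σ2 with hσ3
  have r3 : Rep D σ3 := r2.run (by decide)
  have n3 : σ3.nreg 1 = D.size := (run_nreg (by decide)).trans n2
  have hΛ := count_scaled_le S hA
  obtain ⟨e1, e2, e3⟩ := h4 D hD _ d1 _ hΛ σ3 r3 n3 fun _ => rfl
  have hout : (densityCmd.run (initState S)).nreg 0 = (mainLoop.run σ3).nreg 5 := by
    have : densityCmd.run (initState S) = (nset 0 (nvar 5)).run (mainLoop.run σ3) := rfl
    rw [this, run_nset]; simp [State.setN, nval_nvar]
  have hcost : densityCmd.cost (initState S) = scaleCmd.cost (initState S) +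
      (initLeaves.cost σ1 + (mergeAll.cost σ2 + (mainLoop.cost σ3 + ((nvar 5).size + 1)))) := rfl
  have hd0 : 0 ≤ densityValue S := (densityValue_isLeast S).1.1
  rw [hout]
  refine ⟨?_, ?_, ?_⟩
  · rw [hcost]
    rw [hsize] at c2 d2 e3
    set Λ := ⌊densityValue S⌋₊
    have key : ∀ X1 X2 X3 X4 X5 Y Z1 Z2 Z3 Z4 : ℕ, X1 ≤ K1 * Z1 → X2 ≤ K2 * Z2 → X3 ≤ K3 * Z3 →
        X4 ≤ K4 * Z4 → 1 ≤ Y → Z1 ≤ Y → Z2 ≤ Y → Z3 ≤ Y → Z4 ≤ Y →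
        X1 + (X2 + (X3 + (X4 + X5))) ≤ (K1 + K2 + K3 + K4 + X5) * Y := by
      intro X1 X2 X3 X4 X5 Y Z1 Z2 Z3 Z4 g1 g2 g3 g4 g5 g6 g7 g8 g9
      have := g1.trans (Nat.mul_le_mul_left K1 g6)
      have := g2.trans (Nat.mul_le_mul_left K2 g7)
      have := g3.trans (Nat.mul_le_mul_left K3 g8)
      have := g4.trans (Nat.mul_le_mul_left K4 g9)
      have : X5 ≤ X5 * Y := Nat.le_mul_of_pos_right _ g5
      simp only [add_mul]
      omega
    have hpos : 121 * n ≤ 121 * n * (Nat.log 2 (121 * n) + 1) :=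
      Nat.le_mul_of_pos_right _ (Nat.succ_pos _)
    refine key _ _ _ _ _ _ _ _ _ _ b4 c2 d2 e3 ?_ ?_ ?_ ?_ ?_ <;> omega
  · exact (Nat.cast_le (α := ℝ).mpr e1).trans (Nat.floor_le hd0)
  · refine (densityValue_isLeast S).2 ⟨by positivity, fun c r hr => ?_⟩
    rw [← count_scaled S hA c hr]
    exact_mod_cast e2 _ _ _ (mul_pos hr hA)

theorem natLog_le_log {n : ℕ} (hn : 1 ≤ n) :
    (Nat.log 2 (121 * n) : ℝ) ≤ 2 * Real.log n + 7 := by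
  -- Because `121 < 2 ^ 7`.
  have h1 : Nat.log 2 (121 * n) ≤ Nat.log 2 n + 7 := by
    refine Nat.lt_succ_iff.mp (Nat.log_lt_of_lt_pow (by omega) ?_)
    have := Nat.lt_pow_succ_log_self (b := 2) (by norm_num) n
    calc 121 * n < 128 * 2 ^ (Nat.log 2 n + 1) := by omega
      _ = 2 ^ (Nat.log 2 n + 7 + 1) := by ring
  have h2 := Real.natLog_le_logb n 2
  have h3 : Real.logb 2 n ≤ 2 * Real.log n := by
    have h4 : (1 : ℝ) / 2 < Real.log 2 := by linarith [Real.log_two_gt_d9]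
    have h5 : 0 ≤ Real.log n := Real.log_nonneg (by exact_mod_cast hn)
    rw [Real.logb, div_le_iff₀ (by linarith)]
    nlinarith
  have h6 : (Nat.log 2 (121 * n) : ℝ) ≤ Nat.log 2 n + 7 := by exact_mod_cast h1
  push_cast at h2
  linarith

end UnitRAM

theorem mainTheorem1 :
    ∃ (P : UnitRAM.Program) (C : ℝ), ∀ (n : ℕ), 1 ≤ n → ∀ (S : Fin n → PlaneSegment),
      ∃ t v : ℕ, UnitRAM.Computes P S t v ∧
        (t : ℝ) ≤ C * (n * Real.log n + densityValue S * n) ∧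
        (v : ℝ) ≤ densityValue S ∧ densityValue S ≤ 3 * v := by
  obtain ⟨K, hK⟩ := UnitRAM.exists_densityCmd
  -- With `1 ≤ n ≤ n d`, the bracket in the step bound is at most `242 n log n + 7020 n d`, where
  -- `d` is the density value.
  refine ⟨UnitRAM.densityCmd.compile 0, K * 8000, fun n hn S => ?_⟩
  obtain ⟨h1, h2, h3⟩ := hK n hn S
  obtain ⟨t, ht, hle⟩ := UnitRAM.densityCmd.computes S
  refine ⟨t, _, ht, ?_, h2, h3⟩
  have hd := UnitRAM.one_le_densityValue S hn
  have hfl : (⌊densityValue S⌋₊ : ℝ) ≤ densityValue S := Nat.floor_le (by linarith)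
  have hlog := UnitRAM.natLog_le_log hn
  have hn1 : (1 : ℝ) ≤ n := by exact_mod_cast hn
  have h4 : (t : ℝ) ≤ K * (n + 121 * n * (Nat.log 2 (121 * n) + 1) +
      121 * n * (49 * ⌊densityValue S⌋₊ + 1) + 1) := by exact_mod_cast hle.trans h1
  refine h4.trans ?_
  rw [mul_assoc (K : ℝ) 8000]
  refine mul_le_mul_of_nonneg_left ?_ (Nat.cast_nonneg (α := ℝ) K)
  set l := Real.log n with hl
  set d := densityValue S with hdd
  have hl0 : 0 ≤ l := Real.log_nonneg hn1
  have hn0 : (0 : ℝ) ≤ n := by linarith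
  have h5 : (n : ℝ) * (Nat.log 2 (121 * n)) ≤ n * (2 * l + 7) := mul_le_mul_of_nonneg_left hlog hn0
  have h6 : (n : ℝ) * ⌊d⌋₊ ≤ n * d := mul_le_mul_of_nonneg_left hfl hn0
  have h7 : (n : ℝ) ≤ n * d := le_mul_of_one_le_right hn0 hd
  have h8 : 0 ≤ (n : ℝ) * l := mul_nonneg hn0 hl0
  linarith
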